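/- Let the scalar field $\mathbb{K}$ be $\mathbb{R}$ or $\mathbb{C}$, let $1\le p<\infty$, and let $\mathbf{w}=(w_i)_{i=1}^\infty$ be a weight in $$\mathcal{W}=\{(w_i)_{i=1}^\infty\in c_0\setminus\ell_1 : 1=w_1\ge w_2\ge\cdots\ge w_i\ge w_{i+1}\ge\cdots>0\}.$$ Let $g(\mathbf{w},p)$ be the Garling sequence space, i.e. the Banach space of all scalar sequences $f=(b_k)_{k=1}^\infty$ with $$\|f\|_{g(\mathbf{w},p)}=\sup_{\phi}\Big(\sum_{i=1}^\infty |b_{\phi(i)}|^p w_i\Big)^{1/p}<\infty,$$ the supremum being taken over all increasing functions $\phi\colon\mathbb{N}\to\mathbb{N}$. Let $d(\mathbf{w},p)$ be the weighted Lorentz sequence space, i.e. the Banach space of all $f=(b_k)_{k=1}^\infty\in c_0$ with $$\|f\|_{d(\mathbf{w},p)}=\Big(\sum_{i=1}^\infty (b_i^*)^p w_i\Big)^{1/p}<\infty,$$ where $(b_i^*)_{i=1}^\infty$ is the decreasing rearrangement of $(|b_k|)_{k=1}^\infty$. Then: (i) $g(\mathbf{w},p)$ has no symmetric basis, where a Schauder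 basis $(x_n)_{n=1}^\infty$ is called symmetric if, for every permutation $\pi$ of $\mathbb{N}$ and all scalars $(a_n)_{n=1}^\infty$, the series $\sum_n a_n x_{\pi(n)}$ converges if and only if $\sum_n a_n x_n$ converges. (ii) $d(\mathbf{w},p)\subsetneq g(\mathbf{w},p)$. (iii) No subspace of $d(\mathbf{w},p)$ is isomorphic to $g(\mathbf{w},p)$. (iv) Let $I_{d,g}\colon d(\mathbf{w},p)\to g(\mathbf{w},p)$ be the inclusion map (which is bounded). Then $I_{d,g}$ is not strictly singular, i.e. there is a closed infinite-dimensional subspace of $d(\mathbf{w},p)$ on which $I_{d,g}$ is an isomorphism onto its image. On the other hand, for every bounded linear operator $T\colon g(\mathbf{w},p)\to d(\mathbf{w},p)$ and every subspace $X$ of $d(\mathbf{w},p)$ isomorphic to $d(\mathbf{w},p)$, the restriction $(T\circ I_{d,g})|_X$ is not an isomorphism onto its image. -/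

import Mathlib

open Filter Topology
open scoped ENNReal

noncomputable section

namespace SeqSpace

/-! ### Weights -/

/-- The class `𝒲` of weights: non-increasing sequences of positive scalars that converge to `0`,
are not summable, and start with `1`. Sequences are indexed from `0`. -/
structure Weight where
  /-- The underlying sequence of scalars. -/
  seq : ℕ → ℝ
  zero_eq_one : seq 0 = 1
  antitone : Antitone seq
  pos : ∀ i, 0 < seq i
  tendsto_zero : Tendsto seq atTop (𝓝 0)
  not_summable : ¬ Summable seq

/-- `(∑ aᵢ ^ p wᵢ) ^ (1/p)` for a sequence with values in `[0, ∞]`. -/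
def weightedNorm (w : Weight) (p : ℝ) (a : ℕ → ℝ≥0∞) : ℝ≥0∞ :=
  (∑' i, a i ^ p * ENNReal.ofReal (w.seq i)) ^ (1 / p)

/-- The decreasing rearrangement `a*` of a sequence of non-negative numbers:
`a* n` is the infimum of the levels `t` such that at most `n` terms of `a` exceed `t`
(so `a* 0` is the supremum of `a`). -/
def decreasingRearrangement (a : ℕ → ℝ≥0∞) (n : ℕ) : ℝ≥0∞ :=
  sInf {t : ℝ≥0∞ | {k : ℕ | t < a k}.encard ≤ n}

/-- The Garling (extended) norm: the supremum of `(∑ |f (φ i)| ^ p wᵢ) ^ (1/p)` over all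
increasing functions `φ : ℕ → ℕ`. -/
def garlingENorm {𝕜 : Type*} [RCLike 𝕜] (w : Weight) (p : ℝ) (f : ℕ → 𝕜) : ℝ≥0∞ :=
  ⨆ φ : {φ : ℕ → ℕ // StrictMono φ}, weightedNorm w p (fun i => ‖f (φ.1 i)‖ₑ)

/-- The Lorentz (extended) norm `(∑ (f*ᵢ) ^ p wᵢ) ^ (1/p)`. -/
def lorentzENorm {𝕜 : Type*} [RCLike 𝕜] (w : Weight) (p : ℝ) (f : ℕ → 𝕜) : ℝ≥0∞ :=
  weightedNorm w p (decreasingRearrangement fun k => ‖f k‖ₑ)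

/-! ### Facts that make the two spaces normed spaces -/

/-- Finite truncation of `weightedNorm`. -/
def weightedNormFin (w : Weight) (p : ℝ) (N : ℕ) (a : ℕ → ℝ≥0∞) : ℝ≥0∞ :=
  (∑ i ∈ Finset.range N, a i ^ p * ENNReal.ofReal (w.seq i)) ^ (1 / p)

theorem weightedNormFin_le (w : Weight) {p : ℝ} (hp : 1 ≤ p) (N : ℕ) (a : ℕ → ℝ≥0∞) :
    weightedNormFin w p N a ≤ weightedNorm w p a :=
  ENNReal.rpow_le_rpow (ENNReal.sum_le_tsum _) (by positivity)

theorem weightedNorm_le (w : Weight) {p : ℝ} (hp : 1 ≤ p) {a : ℕ → ℝ≥0∞} {C : ℝ≥0∞}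
    (h : ∀ N, weightedNormFin w p N a ≤ C) : weightedNorm w p a ≤ C := by
  have hp0 : 0 < p := by linarith
  unfold weightedNorm
  rw [one_div, ENNReal.rpow_inv_le_iff hp0, ENNReal.tsum_eq_iSup_nat]
  refine iSup_le fun N => ?_
  have := h N
  unfold weightedNormFin at this
  rwa [one_div, ENNReal.rpow_inv_le_iff hp0] at this

theorem weightedNormFin_mono (w : Weight) {p : ℝ} (hp : 1 ≤ p) {N : ℕ} {a b : ℕ → ℝ≥0∞}
    (h : ∀ i < N, a i ≤ b i) : weightedNormFin w p N a ≤ weightedNormFin w p N b := by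
  refine ENNReal.rpow_le_rpow (Finset.sum_le_sum fun i hi => ?_) (by positivity)
  gcongr
  exact h i (Finset.mem_range.1 hi)

theorem weightedNormFin_add_le (w : Weight) {p : ℝ} (hp : 1 ≤ p) (N : ℕ) (a b : ℕ → ℝ≥0∞) :
    weightedNormFin w p N (fun i => a i + b i) ≤
      weightedNormFin w p N a + weightedNormFin w p N b := by
  have hp0 : 0 < p := by linarith
  have key : ∀ (x : ℝ≥0∞) (i : ℕ), (x * ENNReal.ofReal (w.seq i) ^ (1 / p)) ^ p =
      x ^ p * ENNReal.ofReal (w.seq i) := fun x i => by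
    rw [ENNReal.mul_rpow_of_nonneg _ _ hp0.le, ← ENNReal.rpow_mul, one_div,
      inv_mul_cancel₀ hp0.ne', ENNReal.rpow_one]
  have := ENNReal.Lp_add_le (Finset.range N) (fun i => a i * ENNReal.ofReal (w.seq i) ^ (1 / p))
    (fun i => b i * ENNReal.ofReal (w.seq i) ^ (1 / p)) hp
  simp only [← add_mul, key] at this
  exact this

theorem weightedNormFin_mul (w : Weight) {p : ℝ} (hp : 1 ≤ p) (N : ℕ) (c : ℝ≥0∞)
    (a : ℕ → ℝ≥0∞) :
    weightedNormFin w p N (fun i => c * a i) = c * weightedNormFin w p N a := by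
  have hp0 : 0 < p := by linarith
  unfold weightedNormFin
  simp only [ENNReal.mul_rpow_of_nonneg _ _ hp0.le, mul_assoc, ← Finset.mul_sum]
  rw [ENNReal.mul_rpow_of_nonneg _ _ (by positivity), ← ENNReal.rpow_mul, one_div,
    mul_inv_cancel₀ hp0.ne', ENNReal.rpow_one]

theorem le_rearrangement {a : ℕ → ℝ≥0∞} {n : ℕ} {m : ℝ≥0∞} {F : Finset ℕ}
    (hF : F.card = n + 1) (h : ∀ k ∈ F, m ≤ a k) : m ≤ decreasingRearrangement a n := by
  refine le_sInf fun t ht => ?_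
  by_contra hlt
  rw [not_le] at hlt
  have h1 : (F : Set ℕ).encard ≤ {k : ℕ | t < a k}.encard :=
    Set.encard_le_encard fun k hk => hlt.trans_le (h k hk)
  rw [Set.encard_coe_eq_coe_finsetCard, hF] at h1
  have h2 : ((n + 1 : ℕ) : ℕ∞) ≤ n := h1.trans ht
  have h3 : n + 1 ≤ n := by exact_mod_cast h2
  omega

theorem sum_le_sum_rearrangement {p : ℝ} (hp : 0 ≤ p) (a : ℕ → ℝ≥0∞) (n : ℕ) :
    ∀ F : Finset ℕ, F.card = n →
      ∑ k ∈ F, a k ^ p ≤ ∑ i ∈ Finset.range n, decreasingRearrangement a i ^ p := by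
  induction n with
  | zero => intro F hF; simp [Finset.card_eq_zero.1 hF]
  | succ n ih =>
    intro F hF
    obtain ⟨k, hk, hmin⟩ := F.exists_min_image a (Finset.card_pos.1 (by omega))
    rw [← Finset.sum_erase_add _ _ hk, Finset.sum_range_succ]
    refine add_le_add (ih _ (by rw [Finset.card_erase_of_mem hk, hF]; rfl)) ?_
    exact ENNReal.rpow_le_rpow (le_rearrangement hF hmin) hp

theorem sum_mul_le_sum_mul_of_antitone {x y : ℕ → ℝ≥0∞} (N : ℕ) :
    ∀ v : ℕ → ℝ≥0∞, Antitone v →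
      (∀ n ≤ N, ∑ i ∈ Finset.range n, x i ≤ ∑ i ∈ Finset.range n, y i) →
      ∑ i ∈ Finset.range N, x i * v i ≤ ∑ i ∈ Finset.range N, y i * v i := by
  induction N with
  | zero => intro v _ _; simp
  | succ N ih =>
    intro v hv h
    have key : ∀ z : ℕ → ℝ≥0∞, ∑ i ∈ Finset.range (N + 1), z i * v i =
        ∑ i ∈ Finset.range N, z i * (v i - v N) + (∑ i ∈ Finset.range (N + 1), z i) * v N := by
      intro z
      rw [Finset.sum_range_succ, Finset.sum_range_succ, add_mul, ← add_assoc, Finset.sum_mul,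
        ← Finset.sum_add_distrib]
      congr 1
      refine Finset.sum_congr rfl fun i hi => ?_
      rw [← mul_add, tsub_add_cancel_of_le (hv (Finset.mem_range.1 hi).le)]
    rw [key, key]
    refine add_le_add (ih _ (fun i j hij => tsub_le_tsub_right (hv hij) _)
      fun n hn => h n (by omega)) ?_
    exact mul_le_mul_left (h _ le_rfl) _

/-- Every injective selection is dominated by the decreasing rearrangement. -/
theorem weightedNormFin_le_rearrangement (w : Weight) {p : ℝ} (hp : 1 ≤ p) (a : ℕ → ℝ≥0∞)
    (N : ℕ) (σ : ℕ → ℕ) (hσ : Set.InjOn σ (Finset.range N)) :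
    weightedNormFin w p N (fun i => a (σ i)) ≤
      weightedNormFin w p N (decreasingRearrangement a) := by
  refine ENNReal.rpow_le_rpow (sum_mul_le_sum_mul_of_antitone N _
    (fun i j hij => ENNReal.ofReal_le_ofReal (w.antitone hij)) fun n hn => ?_) (by positivity)
  have hinj : Set.InjOn σ (Finset.range n) := hσ.mono (by
    intro i hi; simp only [Finset.coe_range, Set.mem_Iio] at hi ⊢; omega)
  rw [← Finset.sum_image (f := fun k => a k ^ p) hinj]
  exact sum_le_sum_rearrangement (by linarith) a n _ (by
    rw [Finset.card_image_of_injOn hinj, Finset.card_range])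

/-- For a null sequence, the first terms of the decreasing rearrangement are attained. -/
theorem exists_selection {𝕜 : Type*} [RCLike 𝕜] {f : ℕ → 𝕜} (hf : Tendsto f atTop (𝓝 0))
    (N : ℕ) : ∃ σ : ℕ → ℕ, Set.InjOn σ (Finset.range N) ∧
      ∀ i < N, decreasingRearrangement (fun k => ‖f k‖ₑ) i ≤ ‖f (σ i)‖ₑ := by
  induction N with
  | zero => exact ⟨id, by simp, by simp⟩
  | succ N ih =>
    obtain ⟨σ, hσ, hle⟩ := ih
    set F : Finset ℕ := (Finset.range N).image σ with hFdef
    have hF : F.card ≤ N := by simpa using Finset.card_image_le (s := Finset.range N) (f := σ)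
    obtain ⟨k, hkF, hk⟩ : ∃ k ∉ F, decreasingRearrangement (fun k => ‖f k‖ₑ) N ≤ ‖f k‖ₑ := by
      obtain ⟨m, hmF, hmax⟩ : ∃ m ∉ F, ∀ k ∉ F, ‖f k‖ ≤ ‖f m‖ := by
        obtain ⟨k₀, hk₀⟩ := Infinite.exists_notMem_finset F
        by_cases h0 : ∃ k ∉ F, f k ≠ 0
        · obtain ⟨k₁, hk₁, hne⟩ := h0
          have hev : ∀ᶠ k in atTop, ‖f k‖ < ‖f k₁‖ :=
            (tendsto_zero_iff_norm_tendsto_zero.1 hf).eventually_lt_const (norm_pos_iff.2 hne)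
          obtain ⟨M, hM⟩ := eventually_atTop.1 hev
          have hk₁M : k₁ < M := by
            by_contra hc
            exact lt_irrefl _ (hM k₁ (not_lt.1 hc))
          obtain ⟨m, hm, hmmax⟩ := ((Finset.range M) \ F).exists_max_image (fun k => ‖f k‖)
            ⟨k₁, by simp [hk₁M, hk₁]⟩
          refine ⟨m, (Finset.mem_sdiff.1 hm).2, fun k hk => ?_⟩
          by_cases hkM : k < M
          · exact hmmax k (by simp [hkM, hk])
          · exact (hM k (not_lt.1 hkM)).le.trans (hmmax k₁ (by simp [hk₁M, hk₁]))
        · push Not at h0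
          exact ⟨k₀, hk₀, fun k hk => by simp [h0 k hk]⟩
      refine ⟨m, hmF, sInf_le ?_⟩
      have hsub : {k : ℕ | ‖f m‖ₑ < ‖f k‖ₑ} ⊆ (F : Set ℕ) := by
        intro k hk
        by_contra hkF
        have : ‖f k‖ₑ ≤ ‖f m‖ₑ := enorm_le_iff_norm_le.2 (hmax k hkF)
        exact absurd hk (not_lt.2 this)
      refine (Set.encard_le_encard hsub).trans ?_
      rw [Set.encard_coe_eq_coe_finsetCard]
      exact_mod_cast hF
    have hout : ∀ i < N, σ i ≠ k := fun i hi h => hkF (by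
      rw [hFdef, Finset.mem_image]; exact ⟨i, Finset.mem_range.2 hi, h⟩)
    refine ⟨Function.update σ N k, ?_, ?_⟩
    · intro i hi j hj hij
      simp only [Finset.coe_range, Set.mem_Iio] at hi hj
      rcases Nat.lt_succ_iff_lt_or_eq.1 hi with hi' | rfl <;>
        rcases Nat.lt_succ_iff_lt_or_eq.1 hj with hj' | rfl
      · rw [Function.update_of_ne hi'.ne, Function.update_of_ne hj'.ne] at hij
        exact hσ (by simpa using hi') (by simpa using hj') hij
      · rw [Function.update_of_ne hi'.ne, Function.update_self] at hij
        exact absurd hij (hout i hi')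
      · rw [Function.update_of_ne hj'.ne, Function.update_self] at hij
        exact absurd hij.symm (hout j hj')
      · rfl
    · intro i hi
      rcases Nat.lt_succ_iff_lt_or_eq.1 hi with hi' | rfl
      · rw [Function.update_of_ne hi'.ne]; exact hle i hi'
      · rw [Function.update_self]; exact hk

section Norms

variable {𝕜 : Type*} [RCLike 𝕜] (w : Weight) {p : ℝ}

theorem garlingENorm_add_le (hp : 1 ≤ p) (f g : ℕ → 𝕜) :
    garlingENorm w p (f + g) ≤ garlingENorm w p f + garlingENorm w p g := by
  refine iSup_le fun φ => weightedNorm_le w hp fun N => ?_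
  calc weightedNormFin w p N (fun i => ‖(f + g) (φ.1 i)‖ₑ)
      ≤ weightedNormFin w p N (fun i => ‖f (φ.1 i)‖ₑ + ‖g (φ.1 i)‖ₑ) :=
        weightedNormFin_mono w hp fun i _ => enorm_add_le _ _
    _ ≤ _ := weightedNormFin_add_le w hp N _ _
    _ ≤ _ := add_le_add
      ((weightedNormFin_le w hp N _).trans
        (le_iSup (fun φ : {φ : ℕ → ℕ // StrictMono φ} =>
          weightedNorm w p (fun i => ‖f (φ.1 i)‖ₑ)) φ))
      ((weightedNormFin_le w hp N _).trans
        (le_iSup (fun φ : {φ : ℕ → ℕ // StrictMono φ} =>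
          weightedNorm w p (fun i => ‖g (φ.1 i)‖ₑ)) φ))

theorem garlingENorm_smul_le (hp : 1 ≤ p) (c : 𝕜) (f : ℕ → 𝕜) :
    garlingENorm w p (c • f) ≤ ‖c‖ₑ * garlingENorm w p f := by
  refine iSup_le fun φ => weightedNorm_le w hp fun N => ?_
  simp only [Pi.smul_apply, enorm_smul]
  rw [weightedNormFin_mul w hp]
  gcongr
  exact (weightedNormFin_le w hp N _).trans
    (le_iSup (fun φ : {φ : ℕ → ℕ // StrictMono φ} =>
      weightedNorm w p (fun i => ‖f (φ.1 i)‖ₑ)) φ)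

theorem weightedNormFin_one (hp : 1 ≤ p) (a : ℕ → ℝ≥0∞) : weightedNormFin w p 1 a = a 0 := by
  have hp0 : 0 < p := by linarith
  simp [weightedNormFin, w.zero_eq_one, ← ENNReal.rpow_mul, mul_inv_cancel₀ hp0.ne']

theorem enorm_apply_le_garlingENorm (hp : 1 ≤ p) (f : ℕ → 𝕜) (k : ℕ) :
    ‖f k‖ₑ ≤ garlingENorm w p f := by
  have h := weightedNormFin_le w hp 1 (fun i => ‖f (i + k)‖ₑ)
  rw [weightedNormFin_one w hp, zero_add] at h
  exact h.trans (le_iSup (fun φ : {φ : ℕ → ℕ // StrictMono φ} =>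
    weightedNorm w p (fun i => ‖f (φ.1 i)‖ₑ)) ⟨fun i => i + k, fun i j h => by simpa using h⟩)

theorem garlingENorm_zero (hp : 1 ≤ p) : garlingENorm w p (0 : ℕ → 𝕜) = 0 := by
  have := garlingENorm_smul_le w hp (0 : 𝕜) 0
  simpa using this

theorem garlingENorm_le_lorentzENorm (hp : 1 ≤ p) (f : ℕ → 𝕜) :
    garlingENorm w p f ≤ lorentzENorm w p f :=
  iSup_le fun φ => weightedNorm_le w hp fun N =>
    (weightedNormFin_le_rearrangement w hp (fun k => ‖f k‖ₑ) N φ.1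
      φ.2.injective.injOn).trans (weightedNormFin_le w hp N _)

theorem lorentzENorm_add_le (hp : 1 ≤ p) {f g : ℕ → 𝕜} (hf : Tendsto f atTop (𝓝 0))
    (hg : Tendsto g atTop (𝓝 0)) :
    lorentzENorm w p (f + g) ≤ lorentzENorm w p f + lorentzENorm w p g := by
  refine weightedNorm_le w hp fun N => ?_
  obtain ⟨σ, hσ, hle⟩ := exists_selection (f := f + g) (by simpa using! hf.add hg) N
  calc weightedNormFin w p N (decreasingRearrangement fun k => ‖(f + g) k‖ₑ)
      ≤ weightedNormFin w p N (fun i => ‖f (σ i)‖ₑ + ‖g (σ i)‖ₑ) :=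
        weightedNormFin_mono w hp fun i hi => (hle i hi).trans (enorm_add_le _ _)
    _ ≤ _ := weightedNormFin_add_le w hp N _ _
    _ ≤ _ := add_le_add
      ((weightedNormFin_le_rearrangement w hp (fun k => ‖f k‖ₑ) N σ hσ).trans
        (weightedNormFin_le w hp N _))
      ((weightedNormFin_le_rearrangement w hp (fun k => ‖g k‖ₑ) N σ hσ).trans
        (weightedNormFin_le w hp N _))

theorem lorentzENorm_smul_le (hp : 1 ≤ p) (c : 𝕜) {f : ℕ → 𝕜} (hf : Tendsto f atTop (𝓝 0)) :
    lorentzENorm w p (c • f) ≤ ‖c‖ₑ * lorentzENorm w p f := by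
  refine weightedNorm_le w hp fun N => ?_
  obtain ⟨σ, hσ, hle⟩ := exists_selection (f := c • f) (by simpa using! hf.const_smul c) N
  calc weightedNormFin w p N (decreasingRearrangement fun k => ‖(c • f) k‖ₑ)
      ≤ weightedNormFin w p N (fun i => ‖c‖ₑ * ‖f (σ i)‖ₑ) :=
        weightedNormFin_mono w hp fun i hi => (hle i hi).trans (by simp)
    _ = ‖c‖ₑ * weightedNormFin w p N (fun i => ‖f (σ i)‖ₑ) := weightedNormFin_mul w hp N _ _
    _ ≤ _ := by
      gcongr
      exact (weightedNormFin_le_rearrangement w hp (fun k => ‖f k‖ₑ) N σ hσ).trans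
        (weightedNormFin_le w hp N _)

theorem lorentzENorm_zero (hp : 1 ≤ p) : lorentzENorm w p (0 : ℕ → 𝕜) = 0 := by
  have := lorentzENorm_smul_le w hp (0 : 𝕜) (f := 0) tendsto_const_nhds
  simpa using this

end Norms

/-! ### The spaces -/

section Spaces

variable (𝕜 : Type*) [RCLike 𝕜] (w : Weight) (p : ℝ) [hp : Fact (1 ≤ p)]

/-- The sequences of finite Garling norm. -/
def garlingSubmodule : Submodule 𝕜 (ℕ → 𝕜) where
  carrier := {f | garlingENorm w p f < ∞}
  zero_mem' := by simp [garlingENorm_zero w hp.out]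
  add_mem' hf hg := (garlingENorm_add_le w hp.out _ _).trans_lt (ENNReal.add_lt_top.2 ⟨hf, hg⟩)
  smul_mem' c _ hf :=
    (garlingENorm_smul_le w hp.out c _).trans_lt (ENNReal.mul_lt_top enorm_lt_top hf)

/-- The null sequences of finite Lorentz norm. -/
def lorentzSubmodule : Submodule 𝕜 (ℕ → 𝕜) where
  carrier := {f | Tendsto f atTop (𝓝 0) ∧ lorentzENorm w p f < ∞}
  zero_mem' := ⟨tendsto_const_nhds, by simp [lorentzENorm_zero w hp.out]⟩
  add_mem' hf hg := ⟨by simpa using! hf.1.add hg.1,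
    (lorentzENorm_add_le w hp.out hf.1 hg.1).trans_lt (ENNReal.add_lt_top.2 ⟨hf.2, hg.2⟩)⟩
  smul_mem' c _ hf := ⟨by simpa using! hf.1.const_smul c,
    (lorentzENorm_smul_le w hp.out c hf.1).trans_lt (ENNReal.mul_lt_top enorm_lt_top hf.2)⟩

/-- The Garling sequence space `g(w, p)`. -/
def GarlingSpace : Type _ := garlingSubmodule 𝕜 w p

/-- The weighted Lorentz sequence space `d(w, p)`. -/
def LorentzSpace : Type _ := lorentzSubmodule 𝕜 w p

instance : AddCommGroup (GarlingSpace 𝕜 w p) :=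
  inferInstanceAs (AddCommGroup (garlingSubmodule 𝕜 w p))

instance : Module 𝕜 (GarlingSpace 𝕜 w p) :=
  inferInstanceAs (Module 𝕜 (garlingSubmodule 𝕜 w p))

instance : AddCommGroup (LorentzSpace 𝕜 w p) :=
  inferInstanceAs (AddCommGroup (lorentzSubmodule 𝕜 w p))

instance : Module 𝕜 (LorentzSpace 𝕜 w p) :=
  inferInstanceAs (Module 𝕜 (lorentzSubmodule 𝕜 w p))

instance : Norm (GarlingSpace 𝕜 w p) := ⟨fun f => (garlingENorm w p f.1).toReal⟩

instance : Norm (LorentzSpace 𝕜 w p) := ⟨fun f => (lorentzENorm w p f.1).toReal⟩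

theorem garlingCore : NormedSpace.Core 𝕜 (GarlingSpace 𝕜 w p) := by
  have hle : ∀ (c : 𝕜) (f : GarlingSpace 𝕜 w p), ‖c • f‖ ≤ ‖c‖ * ‖f‖ := fun c f => by
    have := ENNReal.toReal_mono (ENNReal.mul_lt_top enorm_lt_top f.2).ne
      (garlingENorm_smul_le w hp.out c f.1)
    rwa [ENNReal.toReal_mul, toReal_enorm] at this
  refine ⟨⟨fun f => ENNReal.toReal_nonneg, fun c f => le_antisymm (hle c f) ?_, fun f g => ?_⟩,
    fun f => ⟨fun h => ?_, fun h => ?_⟩⟩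
  · rcases eq_or_ne c 0 with rfl | hc
    · rw [norm_zero, zero_mul]
      exact ENNReal.toReal_nonneg
    · have := hle c⁻¹ (c • f)
      rw [inv_smul_smul₀ hc, norm_inv] at this
      rwa [← le_inv_mul_iff₀ (norm_pos_iff.2 hc)]
  · have := ENNReal.toReal_mono (ENNReal.add_lt_top.2 ⟨f.2, g.2⟩).ne
      (garlingENorm_add_le w hp.out f.1 g.1)
    rwa [ENNReal.toReal_add f.2.ne g.2.ne] at this
  · have h0 : garlingENorm w p f.1 = 0 := (ENNReal.toReal_eq_zero_iff _).1 h |>.resolve_right f.2.ne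
    refine Subtype.ext (funext fun k => ?_)
    have := enorm_apply_le_garlingENorm w hp.out f.1 k
    rw [h0] at this
    exact enorm_eq_zero.1 (le_antisymm this zero_le)
  · subst h
    exact (congrArg ENNReal.toReal (garlingENorm_zero (𝕜 := 𝕜) w hp.out)).trans (by simp)

theorem lorentzCore : NormedSpace.Core 𝕜 (LorentzSpace 𝕜 w p) := by
  have hle : ∀ (c : 𝕜) (f : LorentzSpace 𝕜 w p), ‖c • f‖ ≤ ‖c‖ * ‖f‖ := fun c f => by
    have := ENNReal.toReal_mono (ENNReal.mul_lt_top enorm_lt_top f.2.2).ne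
      (lorentzENorm_smul_le w hp.out c f.2.1)
    rwa [ENNReal.toReal_mul, toReal_enorm] at this
  refine ⟨⟨fun f => ENNReal.toReal_nonneg, fun c f => le_antisymm (hle c f) ?_, fun f g => ?_⟩,
    fun f => ⟨fun h => ?_, fun h => ?_⟩⟩
  · rcases eq_or_ne c 0 with rfl | hc
    · rw [norm_zero, zero_mul]
      exact ENNReal.toReal_nonneg
    · have := hle c⁻¹ (c • f)
      rw [inv_smul_smul₀ hc, norm_inv] at this
      rwa [← le_inv_mul_iff₀ (norm_pos_iff.2 hc)]
  · have := ENNReal.toReal_mono (ENNReal.add_lt_top.2 ⟨f.2.2, g.2.2⟩).ne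
      (lorentzENorm_add_le w hp.out f.2.1 g.2.1)
    rwa [ENNReal.toReal_add f.2.2.ne g.2.2.ne] at this
  · have h0 : lorentzENorm w p f.1 = 0 :=
      (ENNReal.toReal_eq_zero_iff _).1 h |>.resolve_right f.2.2.ne
    refine Subtype.ext (funext fun k => ?_)
    have := (enorm_apply_le_garlingENorm w hp.out f.1 k).trans
      (garlingENorm_le_lorentzENorm w hp.out f.1)
    rw [h0] at this
    exact enorm_eq_zero.1 (le_antisymm this zero_le)
  · subst h
    exact (congrArg ENNReal.toReal (lorentzENorm_zero (𝕜 := 𝕜) w hp.out)).trans (by simp)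

instance : NormedAddCommGroup (GarlingSpace 𝕜 w p) :=
  NormedAddCommGroup.ofCore (garlingCore 𝕜 w p)

instance : NormedSpace 𝕜 (GarlingSpace 𝕜 w p) :=
  NormedSpace.ofCore (garlingCore 𝕜 w p)

instance : NormedAddCommGroup (LorentzSpace 𝕜 w p) :=
  NormedAddCommGroup.ofCore (lorentzCore 𝕜 w p)

instance : NormedSpace 𝕜 (LorentzSpace 𝕜 w p) :=
  NormedSpace.ofCore (lorentzCore 𝕜 w p)

theorem lorentzSubmodule_le_garlingSubmodule : lorentzSubmodule 𝕜 w p ≤ garlingSubmodule 𝕜 w p :=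
  fun f hf => (garlingENorm_le_lorentzENorm w hp.out f).trans_lt hf.2

/-- The natural inclusion `I_{d,g} : d(w, p) → g(w, p)`. -/
def inclusionDG : LorentzSpace 𝕜 w p →L[𝕜] GarlingSpace 𝕜 w p :=
  LinearMap.mkContinuous
    { toFun := fun f => ⟨f.1, lorentzSubmodule_le_garlingSubmodule 𝕜 w p f.2⟩
      map_add' := fun _ _ => rfl
      map_smul' := fun _ _ => rfl }
    1 fun f => by
      rw [one_mul]
      exact ENNReal.toReal_mono f.2.2.ne (garlingENorm_le_lorentzENorm w hp.out f.1)

end Spaces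

/-! ### Notions from Banach space theory -/

section Banach

variable {𝕜 : Type*} [RCLike 𝕜]
  {E F : Type*} [NormedAddCommGroup E] [NormedSpace 𝕜 E] [NormedAddCommGroup F] [NormedSpace 𝕜 F]

variable (𝕜) in
/-- Two sequences of vectors are equivalent if, for every sequence of scalars `a`, the series
`∑ aₙ xₙ` converges if and only if `∑ aₙ yₙ` converges. -/
def EquivalentSequences (x : ℕ → E) (y : ℕ → F) : Prop :=
  ∀ a : ℕ → 𝕜,
    (∃ s : E, Tendsto (fun n => ∑ i ∈ Finset.range n, a i • x i) atTop (𝓝 s)) ↔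
      ∃ s : F, Tendsto (fun n => ∑ i ∈ Finset.range n, a i • y i) atTop (𝓝 s)

/-- A Schauder basis is symmetric if it is equivalent to each of its permutations. -/
def IsSymmetricBasis (b : SchauderBasis 𝕜 E) : Prop :=
  ∀ π : Equiv.Perm ℕ, EquivalentSequences 𝕜 (fun n => b.basis (π n)) b.basis

/-- The restriction of `S` to the subspace `X` is an isomorphism onto its image `S(X)`. -/
def IsIsomorphismOn (S : E →L[𝕜] F) (X : Submodule 𝕜 E) : Prop :=
  ∃ e : X ≃L[𝕜] X.map (S : E →ₗ[𝕜] F), ∀ x : X, (e x : F) = S x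

/-- An operator is strictly singular if it is not an isomorphism on any closed
infinite-dimensional subspace. -/
def IsStrictlySingular (S : E →L[𝕜] F) : Prop :=
  ∀ X : Submodule 𝕜 E, IsClosed (X : Set E) → ¬ FiniteDimensional 𝕜 X → ¬ IsIsomorphismOn S X

end Banach

end SeqSpace

end

/-! Put `a k = |b k| ^ p`. The `p`-th power of either norm is the supremum of the sums `∑ a k * w (r
k)` over finite sets of coordinates `k` with assigned positions `r k`: in increasing order for `g`,
merely distinct for `d` (`garlingENorm_rpow`, `lorentzENorm_rpow`). Everything rests on this gauge,
so most lemmas serve both spaces at once.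

The gauge is subadditive. It is also almost superadditive when the second summand is flat compared
with the size of the support of the first (`gauge_add_gauge_le`): giving the first few positions
away costs a flat sequence very little. This yields a dichotomy for block sequences. If flat parts
of non-negligible gauge persist, some subsequence has a lower `ℓ₁` estimate in gauge, that is, a
lower `ℓ_p` estimate in norm (`IsBlock.exists_lower_estimate`). Otherwise (`NoFlatPart`), up to any
prescribed error, each block lives on a bounded number of coordinates.

In the second case order matters in `g`. Take groups of blocks of rapidly growing sizes, each group
normalized. With the short, tall groups first, the gauges of the groups nearly add up. With the
long, flat groups first, an increasing selection must either take many flat terms, which pushes the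
tall ones to positions of tiny weight, or take few, which contribute little; so the gauge stays
bounded (`exists_separating_coefficients`). Hence a symmetric block sequence in `g` cannot lack flat
parts, and a bounded separated symmetric sequence in `g` has `ℓ_p` estimates
(`SymmetricWith.estimates`). The averages of the weight tend to `0`, so the sum of `n` unit vectors,
whose norm to the power `p` is `w₁ + ⋯ + wₙ`, is incompatible with a lower `ℓ_p` estimate.

Consequences. The unit vectors of `d` are symmetric, so `d` does not embed in `g`; this gives the
second half of (iv) and, through the open mapping theorem, (ii). If `g` embedded in `d`, the unit
vectors of `g` would be equivalent to a block sequence of `d`, where order is irrelevant, and the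
separating coefficients forbid this; hence (iii). A tail of a symmetric basis of `g` would be
equivalent to the `ℓ_p` basis, and blocks of it close to differences of unit vectors contradict the
averages again; hence (i). Finally, normalized indicators of longer and longer intervals have, along
a subsequence, `ℓ_p` estimates in both spaces, so the inclusion is not strictly singular. -/

open scoped NNReal

noncomputable section

namespace SeqSpace

/-! ### Selection rules and their gauges -/

namespace Weight

variable (w : Weight)

/-- The weight as a sequence of extended non-negative numbers. -/
def ew (i : ℕ) : ℝ≥0∞ := ENNReal.ofReal (w.seq i)

/-- The partial sums of the weight. -/
def partialSum (n : ℕ) : ℝ≥0∞ := ∑ i ∈ Finset.range n, w.ew i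

theorem ew_antitone : Antitone w.ew := fun _ _ h => ENNReal.ofReal_le_ofReal (w.antitone h)

theorem ew_zero : w.ew 0 = 1 := by simp [ew, w.zero_eq_one]

theorem ew_le_one (i : ℕ) : w.ew i ≤ 1 := w.ew_zero ▸ w.ew_antitone (Nat.zero_le i)

theorem tendsto_ew : Tendsto w.ew atTop (𝓝 0) := by
  simpa [ew] using! ENNReal.tendsto_ofReal w.tendsto_zero

theorem partialSum_mono : Monotone w.partialSum := fun _ _ h =>
  Finset.sum_le_sum_of_subset (Finset.range_mono h)

theorem partialSum_le (n : ℕ) : w.partialSum n ≤ n := by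
  refine (Finset.sum_le_sum fun i _ => w.ew_le_one i).trans (by simp)

theorem partialSum_ne_top (n : ℕ) : w.partialSum n ≠ ∞ :=
  ((w.partialSum_le n).trans_lt (ENNReal.natCast_lt_top n)).ne

theorem one_le_partialSum {n : ℕ} (hn : n ≠ 0) : 1 ≤ w.partialSum n := by
  have := w.partialSum_mono (Nat.one_le_iff_ne_zero.2 hn)
  simpa [partialSum, w.ew_zero] using this

theorem tendsto_partialSum : Tendsto w.partialSum atTop (𝓝 ∞) := by
  have h : ∑' i, w.ew i = ∞ := by
    by_contra h
    exact w.not_summable (by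
      have := ENNReal.summable_toReal h
      simpa [ew, ENNReal.toReal_ofReal (w.pos _).le] using this)
  rw [← h]
  exact ENNReal.tendsto_nat_tsum _

theorem exists_partialSum_ge {x : ℝ≥0∞} (hx : x ≠ ∞) : ∃ N, ∀ n ≥ N, x ≤ w.partialSum n := by
  obtain ⟨N, hN⟩ := eventually_atTop.1
    (w.tendsto_partialSum.eventually_const_lt (lt_top_iff_ne_top.2 hx))
  exact ⟨N, fun n hn => (hN n hn).le⟩

/-- The averages of the weight tend to zero. -/
theorem exists_partialSum_lt {η : ℝ≥0∞} (hη : 0 < η) : ∃ n : ℕ, 0 < n ∧ w.partialSum n < η * n := by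
  rcases eq_or_ne η ∞ with rfl | hη'
  · exact ⟨1, one_pos, by simpa using (w.partialSum_ne_top 1).lt_top⟩
  obtain ⟨N, hN⟩ := eventually_atTop.1 (w.tendsto_ew.eventually_lt_const (ENNReal.half_pos hη.ne'))
  -- `M` terms below `η / 2` leave room `M * (η / 2)`, enough to absorb the first `N` terms, which
  -- are at most `1` each.
  obtain ⟨M, hM⟩ := ENNReal.exists_nat_mul_gt (ENNReal.half_pos hη.ne').ne' (ENNReal.natCast_ne_top N)
  have hM0 : 0 < M := by
    rcases Nat.eq_zero_or_pos M with rfl | h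
    · simp at hM
    · exact h
  refine ⟨N + M, by omega, ?_⟩
  calc w.partialSum (N + M) = w.partialSum N + ∑ i ∈ Finset.range M, w.ew (N + i) :=
        Finset.sum_range_add _ _ _
    _ ≤ N + ∑ i ∈ Finset.range M, (η / 2) :=
        add_le_add (w.partialSum_le N) (Finset.sum_le_sum fun i _ => (hN _ (by omega)).le)
    _ = N + M * (η / 2) := by simp
    _ < M * (η / 2) + M * (η / 2) := by
        refine ENNReal.add_lt_add_right ?_ hM
        exact ENNReal.mul_ne_top (ENNReal.natCast_ne_top _) (ENNReal.div_ne_top hη' (by simp))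
    _ = M * η := by rw [← mul_add, ENNReal.add_halves]
    _ ≤ η * (N + M : ℕ) := by
        rw [mul_comm]
        gcongr
        omega

end Weight

/-- A rule that tells which assignments `r` of positions to the elements of a finite set are
admissible. -/
structure SelectionRule where
  Adm : Finset ℕ → (ℕ → ℕ) → Prop
  injOn : ∀ {S r}, Adm S r → Set.InjOn r S
  of_strictMonoOn : ∀ {S : Finset ℕ} {r}, StrictMonoOn r S → Adm S r
  -- The next two closure properties allow coordinates to be discarded and positions to be changed
  -- without reversing their order; in particular positions may be compressed to their ranks.
  subset : ∀ {S S' r}, Adm S r → S' ⊆ S → Adm S' r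
  of_order : ∀ {S r r'}, Adm S r → (∀ j ∈ S, ∀ k ∈ S, r j < r k → r' j < r' k) → Adm S r'

namespace SelectionRule

/-- The rule of Garling spaces: positions are assigned in increasing order. -/
def increasing : SelectionRule where
  Adm S r := StrictMonoOn r S
  injOn h := h.injOn
  of_strictMonoOn h := h
  subset h hS := h.mono hS
  of_order h hr := fun j hj k hk hjk => hr j hj k hk (h hj hk hjk)

/-- The rule of Lorentz spaces: positions are distinct. -/
def injective : SelectionRule where
  Adm S r := Set.InjOn r S
  injOn h := h
  of_strictMonoOn h := h.injOn
  subset h hS := h.mono hS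
  of_order {S r r'} h hr := fun j hj k hk hjk => by
    by_contra hne
    rcases lt_or_gt_of_ne (fun h' => hne (h hj hk h')) with h' | h'
    · exact (hr j hj k hk h').ne hjk
    · exact (hr k hk j hj h').ne' hjk

variable (R : SelectionRule) (w : Weight)

/-- The selections: a finite set of coordinates together with admissible positions. -/
def Selection : Type := {x : Finset ℕ × (ℕ → ℕ) // R.Adm x.1 x.2}

instance : Nonempty R.Selection := ⟨⟨(∅, id), R.of_strictMonoOn (by intro a ha; simp at ha)⟩⟩

/-- The weighted sum of `a` along a selection. -/
def selSum (w : Weight) (a : ℕ → ℝ≥0∞) (S : Finset ℕ) (r : ℕ → ℕ) : ℝ≥0∞ :=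
  ∑ k ∈ S, a k * w.ew (r k)

/-- The supremum of the weighted sums of `a` along all selections. -/
def gauge (a : ℕ → ℝ≥0∞) : ℝ≥0∞ := ⨆ x : R.Selection, selSum w a x.1.1 x.1.2

variable {R w}

theorem selSum_le_gauge {S r} (h : R.Adm S r) (a : ℕ → ℝ≥0∞) :
    selSum w a S r ≤ R.gauge w a :=
  le_iSup (fun x : R.Selection => selSum w a x.1.1 x.1.2) ⟨(S, r), h⟩

theorem gauge_le {a : ℕ → ℝ≥0∞} {C : ℝ≥0∞} (h : ∀ S r, R.Adm S r → selSum w a S r ≤ C) :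
    R.gauge w a ≤ C := iSup_le fun x => h _ _ x.2

theorem selSum_mono {a b : ℕ → ℝ≥0∞} {S : Finset ℕ} {r : ℕ → ℕ} (h : ∀ k ∈ S, a k ≤ b k) :
    selSum w a S r ≤ selSum w b S r :=
  Finset.sum_le_sum fun k hk => mul_le_mul_left (h k hk) _

theorem gauge_mono {a b : ℕ → ℝ≥0∞} (h : ∀ k, a k ≤ b k) : R.gauge w a ≤ R.gauge w b :=
  gauge_le fun _ _ hr => (selSum_mono fun k _ => h k).trans (selSum_le_gauge hr b)

theorem selSum_add (a b : ℕ → ℝ≥0∞) (S : Finset ℕ) (r : ℕ → ℕ) :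
    selSum w (fun k => a k + b k) S r = selSum w a S r + selSum w b S r := by
  simp [selSum, add_mul, Finset.sum_add_distrib]

theorem gauge_add_le (a b : ℕ → ℝ≥0∞) :
    R.gauge w (fun k => a k + b k) ≤ R.gauge w a + R.gauge w b :=
  gauge_le fun S r hr => by
    rw [selSum_add]
    exact add_le_add (selSum_le_gauge hr a) (selSum_le_gauge hr b)

theorem gauge_zero : R.gauge w (fun _ => 0) = 0 :=
  le_antisymm (gauge_le fun S r _ => by simp [selSum]) zero_le

theorem gauge_sum_le {ι : Type*} (A : Finset ι) (a : ι → ℕ → ℝ≥0∞) :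
    R.gauge w (fun k => ∑ i ∈ A, a i k) ≤ ∑ i ∈ A, R.gauge w (a i) := by
  classical
  induction A using Finset.induction_on with
  | empty => simp [gauge_zero]
  | insert i A hi ih =>
    simp only [Finset.sum_insert hi]
    exact (gauge_add_le _ _).trans (add_le_add le_rfl ih)

theorem selSum_mul (c : ℝ≥0∞) (a : ℕ → ℝ≥0∞) (S : Finset ℕ) (r : ℕ → ℕ) :
    selSum w (fun k => c * a k) S r = c * selSum w a S r := by
  simp [selSum, Finset.mul_sum, mul_assoc]

theorem gauge_mul (c : ℝ≥0∞) (a : ℕ → ℝ≥0∞) :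
    R.gauge w (fun k => c * a k) = c * R.gauge w a := by
  simp only [gauge, selSum_mul, ENNReal.mul_iSup]

theorem le_gauge (a : ℕ → ℝ≥0∞) (k : ℕ) : a k ≤ R.gauge w a := by
  have := selSum_le_gauge (R := R) (w := w) (S := {k}) (r := fun _ => 0)
    (R.of_strictMonoOn (by simp [StrictMonoOn])) a
  simpa [selSum, w.ew_zero] using this

/-! ### Ranks -/

/-- The rank of a position among the positions in use. -/
def rank (S : Finset ℕ) (r : ℕ → ℕ) (k : ℕ) : ℕ := (S.filter fun j => r j < r k).card

theorem rank_lt_rank {S : Finset ℕ} {r : ℕ → ℕ} {j k : ℕ} (hj : j ∈ S) (h : r j < r k) :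
    rank S r j < rank S r k := by
  refine Finset.card_lt_card ⟨fun i hi => ?_, fun hs => ?_⟩
  · simp only [Finset.mem_filter] at hi ⊢
    exact ⟨hi.1, hi.2.trans h⟩
  · have := hs (Finset.mem_filter.2 ⟨hj, h⟩)
    simp at this

theorem rank_lt_card {S : Finset ℕ} {r : ℕ → ℕ} {k : ℕ} (hk : k ∈ S) : rank S r k < S.card :=
  Finset.card_lt_card (Finset.filter_ssubset.2 ⟨k, hk, lt_irrefl _⟩)

/-- The positions counted by the rank are distinct numbers below `r k`. Since weights decrease,
replacing positions by ranks only increases a weighted sum. -/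
theorem rank_le {S : Finset ℕ} {r : ℕ → ℕ} (hr : Set.InjOn r S) (k : ℕ) : rank S r k ≤ r k := by
  have : (S.filter fun j => r j < r k).card ≤ (Finset.range (r k)).card :=
    Finset.card_le_card_of_injOn r (fun j hj => by simpa using (Finset.mem_filter.1 hj).2)
      (hr.mono (by intro j hj; exact (Finset.mem_filter.1 hj).1))
  simpa [rank] using this

theorem adm_rank {S : Finset ℕ} {r : ℕ → ℕ} (h : R.Adm S r) : R.Adm S (rank S r) :=
  R.of_order h fun _ hj _ _ hjk => rank_lt_rank hj hjk

theorem image_rank {S : Finset ℕ} {r : ℕ → ℕ} (hr : Set.InjOn r S) :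
    S.image (rank S r) = Finset.range S.card := by
  refine Finset.eq_of_subset_of_card_le (fun i hi => ?_) ?_
  · obtain ⟨k, hk, rfl⟩ := Finset.mem_image.1 hi
    exact Finset.mem_range.2 (rank_lt_card hk)
  · rw [Finset.card_image_of_injOn (injective.injOn (adm_rank (R := injective) hr)),
      Finset.card_range]

theorem sum_ew_rank {S : Finset ℕ} {r : ℕ → ℕ} (hr : Set.InjOn r S) :
    ∑ k ∈ S, w.ew (rank S r k) = w.partialSum S.card := by
  rw [Weight.partialSum, ← image_rank hr,
    Finset.sum_image (injective.injOn (adm_rank (R := injective) hr))]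

theorem selSum_le_selSum_rank {S : Finset ℕ} {r : ℕ → ℕ} (hr : Set.InjOn r S) (a : ℕ → ℝ≥0∞) :
    selSum w a S r ≤ selSum w a S (rank S r) :=
  Finset.sum_le_sum fun k _ => mul_le_mul_right (w.ew_antitone (rank_le hr k)) _

theorem sum_ew_le {S : Finset ℕ} {r : ℕ → ℕ} (hr : Set.InjOn r S) :
    ∑ k ∈ S, w.ew (r k) ≤ w.partialSum S.card := by
  rw [← sum_ew_rank hr]
  exact Finset.sum_le_sum fun k _ => w.ew_antitone (rank_le hr k)

/-- Taking `F` in its natural order is admissible for every rule, and compressing to ranks uses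
exactly the first `F.card` weights. -/
theorem mul_partialSum_le_gauge {a : ℕ → ℝ≥0∞} {m : ℝ≥0∞} (F : Finset ℕ) (h : ∀ k ∈ F, m ≤ a k) :
    m * w.partialSum F.card ≤ R.gauge w a := by
  have hid : StrictMonoOn (id : ℕ → ℕ) F := strictMono_id.strictMonoOn _
  rw [← sum_ew_rank hid.injOn, Finset.mul_sum]
  refine le_trans (Finset.sum_le_sum fun k hk => ?_)
    (selSum_le_gauge (adm_rank (R.of_strictMonoOn hid)) a)
  exact mul_le_mul_left (h k hk) _

theorem gauge_le_mul_partialSum {a : ℕ → ℝ≥0∞} {m : ℝ≥0∞} (F : Finset ℕ) (h : ∀ k, a k ≤ m)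
    (h0 : ∀ k ∉ F, a k = 0) : R.gauge w a ≤ m * w.partialSum F.card := by
  refine gauge_le fun S r hr => ?_
  calc selSum w a S r = selSum w a (S.filter (· ∈ F)) r := by
        refine (Finset.sum_filter_of_ne fun k _ hk => ?_).symm
        by_contra hF
        simp [h0 k hF] at hk
    _ ≤ ∑ k ∈ S.filter (· ∈ F), m * w.ew (r k) :=
        Finset.sum_le_sum fun k _ => mul_le_mul_left (h k) _
    _ = m * ∑ k ∈ S.filter (· ∈ F), w.ew (r k) := by rw [Finset.mul_sum]
    _ ≤ m * w.partialSum F.card := by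
        refine mul_le_mul_right ((sum_ew_le ((R.injOn hr).mono ?_)).trans
          (w.partialSum_mono (Finset.card_le_card ?_))) _
        · exact fun k hk => (Finset.mem_filter.1 hk).1
        · exact fun k hk => (Finset.mem_filter.1 hk).2

/-! ### Concatenation -/

/-- Selections in `A` can be followed by selections in `B`. -/
def Precedes (R : SelectionRule) (A B : Set ℕ) : Prop :=
  ∀ (S₁ S₂ : Finset ℕ) (r₁ r₂ : ℕ → ℕ), (S₁ : Set ℕ) ⊆ A → (S₂ : Set ℕ) ⊆ B →
    R.Adm S₁ r₁ → R.Adm S₂ r₂ → (∀ i ∈ S₁, ∀ j ∈ S₂, r₁ i < r₂ j) →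
      R.Adm (S₁ ∪ S₂) (fun k => if k ∈ S₁ then r₁ k else r₂ k)

theorem precedes_increasing {A B : Set ℕ} (h : ∀ a ∈ A, ∀ b ∈ B, a < b) :
    increasing.Precedes A B := by
  intro S₁ S₂ r₁ r₂ h₁ h₂ hr₁ hr₂ hlt i hi j hj hij
  simp only [Finset.coe_union, Set.mem_union, Finset.mem_coe] at hi hj
  by_cases hi1 : i ∈ S₁ <;> by_cases hj1 : j ∈ S₁
  · simpa [hi1, hj1] using hr₁ hi1 hj1 hij
  · simpa [hi1, hj1] using hlt i hi1 j (hj.resolve_left hj1)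
  · exact absurd hij (h j (h₁ hj1) i (h₂ (hi.resolve_left hi1))).not_gt
  · simpa [hi1, hj1] using hr₂ (hi.resolve_left hi1) (hj.resolve_left hj1) hij

/-- For distinct positions the location of the supports plays no role; this is why Lorentz spaces
also allow blocks in reversed order. -/
theorem precedes_injective (A B : Set ℕ) : injective.Precedes A B := by
  intro S₁ S₂ r₁ r₂ h₁ h₂ hr₁ hr₂ hlt i hi j hj hij
  simp only [Finset.coe_union, Set.mem_union, Finset.mem_coe] at hi hj
  by_cases hi1 : i ∈ S₁ <;> by_cases hj1 : j ∈ S₁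
  · exact hr₁ hi1 hj1 (by simpa [hi1, hj1] using hij)
  · exact absurd (by simpa [hi1, hj1] using hij) (hlt i hi1 j (hj.resolve_left hj1)).ne
  · exact absurd (by simpa [hi1, hj1] using hij) (hlt j hj1 i (hi.resolve_left hi1)).ne'
  · exact hr₂ (hi.resolve_left hi1) (hj.resolve_left hj1) (by simpa [hi1, hj1] using hij)

/-- If `a` has at most `L` non-zero terms and `b` is bounded by `m`, then the gauge is
superadditive on `a` and `b` up to an error `L * m`. -/
theorem gauge_add_gauge_le {a b : ℕ → ℝ≥0∞} {A B : Set ℕ} (hAB : R.Precedes A B)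
    (hd : Disjoint A B) (ha : ∀ k ∉ A, a k = 0) (hb : ∀ k ∉ B, b k = 0) {F : Finset ℕ}
    (hF : ∀ k ∉ F, a k = 0) {m : ℝ≥0∞} (hm : ∀ k, b k ≤ m) :
    R.gauge w a + R.gauge w b ≤ R.gauge w (fun k => a k + b k) + F.card * m := by
  classical
  refine ENNReal.iSup_add_iSup_le ?_
  rintro ⟨⟨S₁, r₁⟩, h₁⟩ ⟨⟨S₂, r₂⟩, h₂⟩
  dsimp only at h₁ h₂ ⊢
  -- The selection for `a` is compressed to ranks, all below `F.card`. The selection for `b` gives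
  -- up the positions below `F.card`. The two can then be concatenated, and what is given up is at
  -- most `F.card` terms of size at most `m`.
  set T₁ := S₁.filter fun k => a k ≠ 0 with hT₁
  set T₂ := S₂.filter fun k => b k ≠ 0 ∧ F.card ≤ r₂ k with hT₂
  have hT₁A : (T₁ : Set ℕ) ⊆ A := fun k hk => by
    by_contra h
    exact (Finset.mem_filter.1 hk).2 (ha k h)
  have hT₂B : (T₂ : Set ℕ) ⊆ B := fun k hk => by
    by_contra h
    exact (Finset.mem_filter.1 hk).2.1 (hb k h)
  have hcard : T₁.card ≤ F.card := Finset.card_le_card fun k hk => by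
    by_contra h
    exact (Finset.mem_filter.1 hk).2 (hF k h)
  have hT : Disjoint T₁ T₂ := by
    rw [Finset.disjoint_left]
    exact fun k hk1 hk2 => Set.disjoint_left.1 hd (hT₁A hk1) (hT₂B hk2)
  have adm₁ : R.Adm T₁ (rank T₁ r₁) := adm_rank (R.subset h₁ (Finset.filter_subset _ _))
  have adm₂ : R.Adm T₂ r₂ := R.subset h₂ (Finset.filter_subset _ _)
  have adm := hAB T₁ T₂ _ _ hT₁A hT₂B adm₁ adm₂ fun i hi j hj =>
    (rank_lt_card hi).trans_le (hcard.trans (Finset.mem_filter.1 hj).2.2)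
  have e₁ : selSum w a S₁ r₁ ≤ selSum w a T₁ (rank T₁ r₁) := by
    refine le_trans (le_of_eq ?_)
      (selSum_le_selSum_rank (R.injOn (R.subset h₁ (Finset.filter_subset _ _))) a)
    exact (Finset.sum_filter_of_ne fun k _ hk => by
      intro h; simp [h] at hk).symm
  have e₂ : selSum w b S₂ r₂ ≤ selSum w b T₂ r₂ + F.card * m := by
    have hsplit : selSum w b S₂ r₂ = selSum w b (S₂.filter fun k => F.card ≤ r₂ k) r₂ +
        selSum w b (S₂.filter fun k => ¬ F.card ≤ r₂ k) r₂ :=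
      (Finset.sum_filter_add_sum_filter_not _ _ _).symm
    rw [hsplit]
    refine add_le_add (le_of_eq ?_) ?_
    · have : T₂ = (S₂.filter fun k => F.card ≤ r₂ k).filter fun k => b k ≠ 0 := by
        rw [hT₂, Finset.filter_filter]
        simp only [and_comm]
      rw [this]
      exact (Finset.sum_filter_of_ne fun k _ hk => by intro h; simp [h] at hk).symm
    · calc selSum w b (S₂.filter fun k => ¬ F.card ≤ r₂ k) r₂
          ≤ ∑ k ∈ S₂.filter fun k => ¬ F.card ≤ r₂ k, m :=
            Finset.sum_le_sum fun k _ => (mul_le_mul' (hm k) (w.ew_le_one _)).trans (by simp)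
        _ = (S₂.filter fun k => ¬ F.card ≤ r₂ k).card * m := by simp
        _ ≤ F.card * m := by
            refine mul_le_mul_left (Nat.cast_le.2 ?_) _
            have : (S₂.filter fun k => ¬ F.card ≤ r₂ k).card ≤ (Finset.range F.card).card :=
              Finset.card_le_card_of_injOn r₂
                (fun j hj => by simpa using (Finset.mem_filter.1 hj).2)
                ((R.injOn h₂).mono (by intro j hj; exact (Finset.mem_filter.1 hj).1))
            rwa [Finset.card_range] at this
  refine (add_le_add e₁ e₂).trans ?_
  rw [← add_assoc]
  refine add_le_add (le_trans ?_ (selSum_le_gauge adm _)) le_rfl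
  conv_rhs => rw [selSum, Finset.sum_union hT]
  refine add_le_add (Finset.sum_le_sum fun k hk => ?_) (Finset.sum_le_sum fun k hk => ?_)
  · simp only [hk, if_true]
    gcongr
    exact le_self_add
  · simp only [Finset.disjoint_right.1 hT hk, if_false]
    gcongr
    exact le_add_self

/-- Superadditivity of the gauge along a sequence of flatter and flatter terms. -/
theorem sum_gauge_le {f : ℕ → ℕ → ℝ≥0∞} {F : ℕ → Finset ℕ} (hf : ∀ j, ∀ k ∉ F j, f j k = 0)
    (hdis : ∀ i j, i < j → Disjoint (F i) (F j))
    (hpre : ∀ j, R.Precedes (⋃ i < j, (F i : Set ℕ)) (F j))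
    {ε : ℕ → ℝ≥0∞} (hε : ∀ j k, (∑ i ∈ Finset.range j, (F i).card : ℕ) * f j k ≤ ε j) (n : ℕ) :
    ∑ j ∈ Finset.range n, R.gauge w (f j) ≤
      R.gauge w (fun k => ∑ j ∈ Finset.range n, f j k) + ∑ j ∈ Finset.range n, ε j := by
  classical
  induction n with
  | zero => simp
  | succ n ih =>
    simp only [Finset.sum_range_succ]
    set G := (Finset.range n).biUnion F with hG
    have hGcard : G.card ≤ ∑ i ∈ Finset.range n, (F i).card := Finset.card_biUnion_le
    have hG0 : ∀ k ∉ G, ∑ j ∈ Finset.range n, f j k = 0 := fun k hk =>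
      Finset.sum_eq_zero fun j hj => hf j k fun hjk => hk (Finset.mem_biUnion.2 ⟨j, hj, hjk⟩)
    have hGcoe : (G : Set ℕ) = ⋃ i < n, (F i : Set ℕ) := by
      ext k; simp [hG]
    have hsup : (G.card : ℝ≥0∞) * (⨆ k, f n k) ≤ ε n := by
      rw [ENNReal.mul_iSup]
      refine iSup_le fun k => (mul_le_mul_left ?_ _).trans (hε n k)
      exact_mod_cast hGcard
    have key := gauge_add_gauge_le (w := w) (hGcoe ▸ hpre n)
      (by
        rw [Finset.disjoint_coe, hG, Finset.disjoint_biUnion_left]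
        exact fun i hi => hdis i n (Finset.mem_range.1 hi))
      (a := fun k => ∑ j ∈ Finset.range n, f j k) (b := f n)
      (fun k hk => hG0 k (by simpa using hk)) (fun k hk => hf n k (by simpa using hk)) hG0
      (fun k => le_iSup (f n) k)
    calc _ ≤ R.gauge w (fun k => ∑ j ∈ Finset.range n, f j k) + ∑ j ∈ Finset.range n, ε j
          + R.gauge w (f n) := add_le_add ih le_rfl
      _ = R.gauge w (fun k => ∑ j ∈ Finset.range n, f j k) + R.gauge w (f n)
          + ∑ j ∈ Finset.range n, ε j := by ring
      _ ≤ _ := add_le_add (key.trans (add_le_add le_rfl hsup)) le_rfl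
      _ = _ := by ring

/-! ### Sequences of finite gauge -/

/-- The number of terms that are at least `ε` is controlled by the gauge. -/
theorem exists_card_bound (w : Weight) {C ε : ℝ≥0∞} (hC : C ≠ ∞) (hε : 0 < ε) :
    ∃ M : ℕ, ∀ (R : SelectionRule) (a : ℕ → ℝ≥0∞), R.gauge w a ≤ C →
      ∀ F : Finset ℕ, (∀ k ∈ F, ε ≤ a k) → F.card ≤ M := by
  rcases eq_or_ne ε ∞ with rfl | hε'
  · refine ⟨0, fun R a ha F hF => ?_⟩
    by_contra h
    obtain ⟨k, hk⟩ := (Finset.card_pos (s := F)).1 (by omega)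
    exact hC (top_le_iff.1 ((hF k hk).trans ((le_gauge a k).trans ha)))
  -- The bound depends only on the weight, `C` and `ε`, so it is uniform over rules and sequences;
  -- the extra `1` makes the contradiction strict.
  obtain ⟨N, hN⟩ := w.exists_partialSum_ge (x := C / ε + 1)
    (ENNReal.add_ne_top.2 ⟨ENNReal.div_ne_top hC hε.ne', by simp⟩)
  refine ⟨N, fun R a ha F hF => ?_⟩
  by_contra h
  have h1 := hN F.card (by omega)
  have h2 := (mul_partialSum_le_gauge (R := R) (w := w) F hF).trans ha
  have h3 : w.partialSum F.card ≤ C / ε := by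
    rwa [ENNReal.le_div_iff_mul_le (Or.inl hε.ne') (Or.inl hε'), mul_comm]
  exact absurd (h1.trans h3) (not_le.2 (ENNReal.lt_add_right
    (ENNReal.div_ne_top hC hε.ne') one_ne_zero))

theorem eventually_lt_of_gauge_ne_top {a : ℕ → ℝ≥0∞} (h : R.gauge w a ≠ ∞) {ε : ℝ≥0∞}
    (hε : 0 < ε) : ∀ᶠ k in atTop, a k < ε := by
  obtain ⟨M, hM⟩ := exists_card_bound w h hε
  have hfin : {k | ε ≤ a k}.Finite := by
    by_contra hinf
    obtain ⟨F, hF, hcard⟩ := Set.Infinite.exists_subset_card_eq hinf (M + 1)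
    have := hM R a le_rfl F fun k hk => hF hk
    omega
  obtain ⟨N, hN⟩ := hfin.bddAbove
  filter_upwards [eventually_gt_atTop N] with k hk
  by_contra hc
  exact absurd (hN (not_lt.1 hc)) (by omega)

theorem tendsto_of_gauge_ne_top {a : ℕ → ℝ≥0∞} (h : R.gauge w a ≠ ∞) :
    Tendsto a atTop (𝓝 0) :=
  tendsto_order.2 ⟨fun _ h' => absurd h' not_lt_zero, fun _ => eventually_lt_of_gauge_ne_top h⟩

theorem gauge_indicator_le (A : Set ℕ) (a : ℕ → ℝ≥0∞) :
    R.gauge w (A.indicator a) ≤ R.gauge w a :=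
  gauge_mono fun k => Set.indicator_le_self _ _ k

theorem exists_gauge_le_head (a : ℕ → ℝ≥0∞) {c : ℝ≥0∞} (hc : c < R.gauge w a) :
    ∃ N, c < R.gauge w ((Set.Iio N).indicator a) := by
  obtain ⟨⟨⟨S, r⟩, hr⟩, h⟩ := lt_iSup_iff.1 hc
  dsimp only at hr h
  obtain ⟨N, hN⟩ := S.bddAbove
  refine ⟨N + 1, h.trans_le (le_trans (le_of_eq ?_) (selSum_le_gauge hr _))⟩
  refine Finset.sum_congr rfl fun k hk => ?_
  rw [Set.indicator_of_mem]
  exact Set.mem_Iio.2 (Nat.lt_succ_of_le (hN hk))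

/-- Rules in which the terms of a sequence can be selected successively. -/
class Successive (R : SelectionRule) : Prop where
  precedes : ∀ A B : Set ℕ, (∀ a ∈ A, ∀ b ∈ B, a < b) → R.Precedes A B

instance : Successive increasing := ⟨fun _ _ => precedes_increasing⟩

instance : Successive injective := ⟨fun A B _ => precedes_injective A B⟩

/-- A finite head already carries almost all of the gauge. Far out the terms are so small that the
tail is flat relative to that head; by almost superadditivity, head plus tail cannot much exceed the
whole, which leaves little for the tail. -/
theorem eventually_gauge_tail_le [Successive R] {a : ℕ → ℝ≥0∞} (h : R.gauge w a ≠ ∞) {δ : ℝ≥0∞}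
    (hδ : 0 < δ) : ∀ᶠ N in atTop, R.gauge w ((Set.Ici N).indicator a) ≤ δ := by
  rcases eq_or_ne (R.gauge w a) 0 with h0 | h0
  · exact Eventually.of_forall fun N => (gauge_indicator_le _ _).trans (by simp [h0])
  have hδ2 : 0 < δ / 2 := ENNReal.half_pos hδ.ne'
  obtain ⟨N, hN⟩ := exists_gauge_le_head (R := R) (w := w) a (ENNReal.sub_lt_self h h0 hδ2.ne')
  have hN' : R.gauge w a ≤ R.gauge w ((Set.Iio N).indicator a) + δ / 2 :=
    tsub_le_iff_right.1 hN.le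
  have hsmall : 0 < δ / 2 / (N + 1) :=
    ENNReal.div_pos hδ2.ne' (by simp)
  filter_upwards [eventually_forall_ge_atTop.2 (eventually_lt_of_gauge_ne_top h hsmall),
    eventually_ge_atTop N] with n hn hnN
  have key := gauge_add_gauge_le (R := R) (w := w) (A := Set.Iio N) (B := Set.Ici n)
    (a := (Set.Iio N).indicator a) (b := (Set.Ici n).indicator a)
    (Successive.precedes _ _ fun x hx y hy =>
      (Set.mem_Iio.1 hx).trans_le (hnN.trans (Set.mem_Ici.1 hy)))
    (Set.disjoint_left.2 fun x hx hy =>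
      absurd ((Set.mem_Iio.1 hx).trans_le (hnN.trans (Set.mem_Ici.1 hy))) (lt_irrefl _))
    (fun k hk => Set.indicator_of_notMem hk _) (fun k hk => Set.indicator_of_notMem hk _)
    (F := Finset.range N) (fun k hk => Set.indicator_of_notMem (by simpa using hk) _)
    (m := δ / 2 / (N + 1)) (fun k => Set.indicator_apply_le' (fun hk => (hn k hk).le) fun _ => zero_le)
  have hle : R.gauge w (fun k => (Set.Iio N).indicator a k + (Set.Ici n).indicator a k) ≤
      R.gauge w a := gauge_mono fun k => by
    by_cases h1 : k < N
    · simp [h1, h1.trans_le hnN]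
    · simp only [Set.mem_Iio, h1, not_false_eq_true, Set.indicator_of_notMem, zero_add]
      exact Set.indicator_le_self _ _ _
  have herr : ((Finset.range N).card : ℝ≥0∞) * (δ / 2 / (N + 1)) ≤ δ / 2 := by
    rw [Finset.card_range]
    calc (N : ℝ≥0∞) * (δ / 2 / (N + 1)) ≤ (N + 1) * (δ / 2 / (N + 1)) := by
          gcongr
          exact le_self_add
      _ ≤ δ / 2 := ENNReal.mul_div_le
  have hfin : R.gauge w ((Set.Iio N).indicator a) ≠ ∞ :=
    ne_top_of_le_ne_top h (gauge_indicator_le _ _)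
  refine (ENNReal.add_le_add_iff_left hfin).1 ?_
  calc _ ≤ R.gauge w a + δ / 2 := key.trans (add_le_add hle herr)
    _ ≤ R.gauge w ((Set.Iio N).indicator a) + δ / 2 + δ / 2 := add_le_add hN' le_rfl
    _ = _ := by rw [add_assoc, ENNReal.add_halves]

/-! ### Flat parts of block sequences -/

/-- The part of a sequence made of the terms that are at most `ε`. -/
def smallPart (ε : ℝ≥0∞) (a : ℕ → ℝ≥0∞) : ℕ → ℝ≥0∞ := {k | a k ≤ ε}.indicator a

/-- The part of a sequence made of the terms that exceed `ε`. -/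
def bigPart (ε : ℝ≥0∞) (a : ℕ → ℝ≥0∞) : ℕ → ℝ≥0∞ := {k | ε < a k}.indicator a

theorem smallPart_add_bigPart (ε : ℝ≥0∞) (a : ℕ → ℝ≥0∞) (k : ℕ) :
    smallPart ε a k + bigPart ε a k = a k := by
  by_cases h : a k ≤ ε
  · simp [smallPart, bigPart, h, not_lt.2 h]
  · simp [smallPart, bigPart, h, not_le.1 h]

theorem smallPart_le_self (ε : ℝ≥0∞) (a : ℕ → ℝ≥0∞) (k : ℕ) : smallPart ε a k ≤ a k :=
  Set.indicator_le_self _ _ k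

theorem bigPart_le_self (ε : ℝ≥0∞) (a : ℕ → ℝ≥0∞) (k : ℕ) : bigPart ε a k ≤ a k :=
  Set.indicator_le_self _ _ k

theorem smallPart_le (ε : ℝ≥0∞) (a : ℕ → ℝ≥0∞) (k : ℕ) : smallPart ε a k ≤ ε :=
  Set.indicator_apply_le' (fun h => h) fun _ => zero_le

variable (R w) in
/-- The small parts of the terms of a family are uniformly small in gauge. -/
def NoFlatPart (a : ℕ → ℕ → ℝ≥0∞) : Prop :=
  ∀ η > 0, ∃ ε > 0, ∀ n, R.gauge w (smallPart ε (a n)) ≤ η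

/-- The terms of the family are supported in the successive intervals `[s n, s (n + 1))`. -/
structure IsBlock (a : ℕ → ℕ → ℝ≥0∞) (s : ℕ → ℕ) : Prop where
  mono : Monotone s
  supp : ∀ n k, a n k ≠ 0 → s n ≤ k ∧ k < s (n + 1)

theorem IsBlock.eq_zero {a : ℕ → ℕ → ℝ≥0∞} {s : ℕ → ℕ} (ha : IsBlock a s) {n k : ℕ}
    (hk : k ∉ Finset.Ico (s n) (s (n + 1))) : a n k = 0 := by
  by_contra h
  exact hk (Finset.mem_Ico.2 (ha.supp n k h))

/-- The first `N` blocks have finitely many non-zero values. Below all of these values their small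
parts vanish, so flat parts must be found in later blocks. -/
theorem IsBlock.exists_ge {a : ℕ → ℕ → ℝ≥0∞} {s : ℕ → ℕ} (ha : IsBlock a s) {η : ℝ≥0∞}
    (h : ∀ ε > 0, ∃ n, η < R.gauge w (smallPart ε (a n))) (N : ℕ) {ε : ℝ≥0∞} (hε : 0 < ε) :
    ∃ n ≥ N, η < R.gauge w (smallPart ε (a n)) := by
  have h1 : ∀ᶠ x in 𝓝[>] (0 : ℝ≥0∞), ∀ n ∈ Finset.range N, ∀ k ∈ Finset.range (s N),
      a n k ≠ 0 → x < a n k := by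
    refine (Finset.eventually_all _).2 fun n _ => (Finset.eventually_all _).2 fun k _ => ?_
    by_cases hk : a n k = 0
    · exact Eventually.of_forall fun _ h => absurd hk h
    · filter_upwards [Ioo_mem_nhdsGT (pos_iff_ne_zero.2 hk)] with x hx _ using hx.2
  obtain ⟨x, hx, hxε⟩ := (h1.and (Ioc_mem_nhdsGT hε)).exists
  obtain ⟨n, hn⟩ := h x hxε.1
  refine ⟨n, ?_, hn.trans_le (gauge_mono fun k => ?_)⟩
  · by_contra hnN
    have hzero : smallPart x (a n) = fun _ => 0 := by
      funext k
      by_contra hk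
      have hk' : a n k ≠ 0 := fun h0 => hk (le_antisymm ((smallPart_le_self _ _ _).trans h0.le) zero_le)
      have hle : a n k ≤ x := by
        by_contra hlt
        exact hk (Set.indicator_of_notMem (by simpa using hlt) _)
      exact absurd (hx n (Finset.mem_range.2 (by omega)) k
        (Finset.mem_range.2 ((ha.supp n k hk').2.trans_le (ha.mono (by omega)))) hk') (not_lt.2 hle)
    rw [hzero, gauge_zero] at hn
    exact not_lt_zero hn
  · refine Set.indicator_le_indicator_of_subset (fun k hk => ?_) (fun _ => zero_le) k
    exact le_trans hk hxε.2

/-- A block sequence with flat parts has a subsequence with a lower `ℓ₁` estimate for the gauge. -/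
theorem IsBlock.exists_lower_estimate [Successive R] {a : ℕ → ℕ → ℝ≥0∞} {s : ℕ → ℕ}
    (ha : IsBlock a s) (h : ¬ NoFlatPart R w a) :
    ∃ η : ℝ≥0∞, 0 < η ∧ ∃ m : ℕ → ℕ, StrictMono m ∧ ∀ (t : ℕ → ℝ≥0) (n : ℕ),
      η * ∑ j ∈ Finset.range n, (t j : ℝ≥0∞) ≤
        R.gauge w (fun k => ∑ j ∈ Finset.range n, t j * a (m j) k) := by
  unfold NoFlatPart at h
  push Not at h
  obtain ⟨η, hη, h⟩ := h
  have hηtop : η ≠ ∞ := by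
    obtain ⟨n, hn⟩ := h 1 one_pos
    exact hn.ne_top
  have hη2 : 0 < η / 2 := ENNReal.half_pos hη.ne'
  -- All blocks before index `N` use at most `s N` coordinates, so this threshold keeps the loss in
  -- the superadditivity at `η / 2` per block.
  have hstep : ∀ N, ∃ n ≥ N, η < R.gauge w (smallPart (η / 2 / (s N + 1)) (a n)) := fun N =>
    ha.exists_ge h N (ENNReal.div_pos hη2.ne' (by simp))
  choose φ hφN hφ using hstep
  -- `M j` is one more than the block index chosen last, so each threshold is adapted to the blocks
  -- already chosen.
  set M : ℕ → ℕ := fun j => Nat.rec 0 (fun _ N => φ N + 1) j with hM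
  have hMs : ∀ j, M (j + 1) = φ (M j) + 1 := fun j => rfl
  have hm : StrictMono fun j => φ (M j) :=
    strictMono_nat_of_lt_succ fun j => by
      have := hφN (M (j + 1))
      rw [hMs] at this ⊢
      omega
  refine ⟨η / 2, hη2, fun j => φ (M j), hm, fun t n => ?_⟩
  set F : ℕ → Finset ℕ := fun j => Finset.Ico (s (φ (M j))) (s (φ (M j) + 1)) with hF
  have hlt : ∀ i j, i < j → ∀ x ∈ F i, ∀ y ∈ F j, x < y := fun i j hij x hx y hy =>
    (Finset.mem_Ico.1 hx).2.trans_le ((ha.mono (Nat.succ_le_of_lt (hm hij))).trans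
      (Finset.mem_Ico.1 hy).1)
  have hcard : ∀ j, ∑ i ∈ Finset.range j, (F i).card ≤ s (M j) := by
    intro j
    induction j with
    | zero => simp
    | succ j ih =>
      rw [Finset.sum_range_succ, hMs]
      have h1 := ha.mono (hφN (M j))
      have h2 := ha.mono (Nat.le_succ (φ (M j)))
      simp only [hF, Nat.card_Ico] at ih ⊢
      simp only [Nat.succ_eq_add_one] at h2
      omega
  have key := sum_gauge_le (R := R) (w := w)
    (f := fun j k => t j * smallPart (η / 2 / (s (M j) + 1)) (a (φ (M j))) k) (F := F)
    (fun j k hk => by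
      have : smallPart (η / 2 / (s (M j) + 1)) (a (φ (M j))) k = 0 :=
        le_antisymm ((smallPart_le_self _ _ _).trans (ha.eq_zero hk).le) zero_le
      simp [this])
    (fun i j hij => Finset.disjoint_left.2 fun x hx hy => lt_irrefl _ (hlt i j hij x hx x hy))
    (fun j => Successive.precedes _ _ fun x hx y hy => by
      simp only [Set.mem_iUnion] at hx
      obtain ⟨i, hij, hx⟩ := hx
      exact hlt i j hij x hx y hy)
    (ε := fun j => t j * (η / 2)) (fun j k => by
      calc ((∑ i ∈ Finset.range j, (F i).card : ℕ) : ℝ≥0∞) *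
            (t j * smallPart (η / 2 / (s (M j) + 1)) (a (φ (M j))) k)
          ≤ (s (M j) + 1) * (t j * (η / 2 / (s (M j) + 1))) := by
            refine mul_le_mul' ?_ (mul_le_mul_right (smallPart_le _ _ _) _)
            exact (Nat.cast_le.2 (hcard j)).trans le_self_add
        _ = t j * ((s (M j) + 1) * (η / 2 / (s (M j) + 1))) := by ring
        _ ≤ t j * (η / 2) := mul_le_mul_right ENNReal.mul_div_le _) n
  have hsum : ∑ j ∈ Finset.range n, (t j : ℝ≥0∞) ≠ ∞ :=
    (ENNReal.sum_lt_top.2 fun _ _ => ENNReal.coe_lt_top).ne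
  rw [← Finset.sum_mul, mul_comm _ (η / 2)] at key
  refine (ENNReal.add_le_add_iff_right (ENNReal.mul_ne_top
    (ENNReal.div_ne_top hηtop (by simp)) hsum)).1 (le_trans ?_ (key.trans (add_le_add
      (gauge_mono fun k => Finset.sum_le_sum fun j _ =>
        mul_le_mul_right (smallPart_le_self _ _ _) _) le_rfl)))
  rw [← add_mul, ENNReal.add_halves, Finset.mul_sum]
  refine Finset.sum_le_sum fun j _ => ?_
  rw [gauge_mul, mul_comm]
  exact mul_le_mul_right (hφ _).le _

/-! ### Families without flat parts -/

/-- Each of the `n` small parts has gauge at most `κ / (n + 1)`, and each big part has a number of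
terms bounded uniformly by `exists_card_bound`. Neither the threshold nor the bound on the support
depends on which `n` members are taken. -/
theorem NoFlatPart.exists_split {a : ℕ → ℕ → ℝ≥0∞} {B : ℕ → Finset ℕ}
    (h : NoFlatPart R w a) (haB : ∀ i, ∀ k ∉ B i, a i k = 0) {C : ℝ≥0∞} (hC : C ≠ ∞)
    (haC : ∀ i, R.gauge w (a i) ≤ C) {κ : ℝ≥0∞} (hκ : 0 < κ) (n : ℕ) :
    ∃ (ε : ℝ≥0∞) (l : ℕ), ∀ A : Finset ℕ, A.card = n →
      R.gauge w (fun k => ∑ i ∈ A, smallPart ε (a i) k) ≤ κ ∧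
      ∃ F : Finset ℕ, F.card ≤ l ∧ F ⊆ A.biUnion B ∧
        ∀ k ∉ F, ∑ i ∈ A, bigPart ε (a i) k = 0 := by
  classical
  obtain ⟨ε, hε, hsmall⟩ := h (κ / (n + 1)) (ENNReal.div_pos hκ.ne' (by simp))
  obtain ⟨M, hM⟩ := exists_card_bound w hC hε
  refine ⟨ε, n * M, fun A hA => ⟨?_, A.biUnion fun i => (B i).filter fun k => ε < a i k, ?_, ?_, ?_⟩⟩
  · calc _ ≤ ∑ i ∈ A, R.gauge w (smallPart ε (a i)) := gauge_sum_le A _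
      _ ≤ ∑ i ∈ A, κ / (n + 1) := Finset.sum_le_sum fun i _ => hsmall i
      _ = n * (κ / (n + 1)) := by simp [hA]
      _ ≤ (n + 1) * (κ / (n + 1)) := by gcongr; exact le_self_add
      _ ≤ κ := ENNReal.mul_div_le
  · rw [← hA]
    refine Finset.card_biUnion_le_card_mul _ _ _ fun i _ => hM R (a i) (haC i) _ fun k hk => ?_
    exact (Finset.mem_filter.1 hk).2.le
  · exact Finset.biUnion_mono fun i _ => Finset.filter_subset _ _
  · intro k hk
    refine Finset.sum_eq_zero fun i hi => ?_
    by_contra hne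
    have h1 : ε < a i k := by
      by_contra hlt
      exact hne (Set.indicator_of_notMem (by simpa using hlt) _)
    refine hk (Finset.mem_biUnion.2 ⟨i, hi, Finset.mem_filter.2 ⟨?_, h1⟩⟩)
    by_contra hB
    rw [haB i k hB] at h1
    exact not_lt_zero h1

/-- Half of `δ` pays for the small parts. The big parts occupy at most `l` coordinates, with values
at most `n * C`, so they contribute little from a position on where the weight is tiny. -/
theorem NoFlatPart.exists_tail {a : ℕ → ℕ → ℝ≥0∞} {B : ℕ → Finset ℕ}
    (h : NoFlatPart R w a) (haB : ∀ i, ∀ k ∉ B i, a i k = 0) {C : ℝ≥0∞} (hC : C ≠ ∞)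
    (haC : ∀ i, R.gauge w (a i) ≤ C) {δ : ℝ≥0∞} (hδ : 0 < δ) (n : ℕ) :
    ∃ P : ℕ, ∀ A : Finset ℕ, A.card = n → ∀ S r, R.Adm S r → (∀ k ∈ S, P ≤ r k) →
      selSum w (fun k => ∑ i ∈ A, a i k) S r ≤ δ := by
  classical
  have hδ2 := ENNReal.half_pos hδ.ne'
  obtain ⟨ε, l, hsplit⟩ := h.exists_split haB hC haC hδ2 n
  have hfin : (l * (n * C) + 1 : ℝ≥0∞) ≠ ∞ := by
    refine ENNReal.add_ne_top.2 ⟨ENNReal.mul_ne_top (by simp) (ENNReal.mul_ne_top (by simp) hC), by simp⟩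
  obtain ⟨P, hP⟩ := (w.tendsto_ew.eventually_lt_const
    (ENNReal.div_pos hδ2.ne' hfin)).exists
  refine ⟨P, fun A hA S r hr hPr => ?_⟩
  obtain ⟨h1, F, hF, -, hF0⟩ := hsplit A hA
  have heq : (fun k => ∑ i ∈ A, a i k) =
      fun k => ∑ i ∈ A, smallPart ε (a i) k + ∑ i ∈ A, bigPart ε (a i) k := by
    funext k
    rw [← Finset.sum_add_distrib]
    exact Finset.sum_congr rfl fun i _ => (smallPart_add_bigPart ε (a i) k).symm
  rw [heq, selSum_add, ← ENNReal.add_halves δ]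
  refine add_le_add ((selSum_le_gauge hr _).trans h1) ?_
  calc selSum w (fun k => ∑ i ∈ A, bigPart ε (a i) k) S r
      = selSum w (fun k => ∑ i ∈ A, bigPart ε (a i) k) (S.filter (· ∈ F)) r := by
        refine (Finset.sum_filter_of_ne fun k _ hk => ?_).symm
        by_contra hkF
        simp [hF0 k hkF] at hk
    _ ≤ ∑ k ∈ S.filter (· ∈ F), (n * C) * w.ew P := by
        refine Finset.sum_le_sum fun k hk => mul_le_mul' ?_
          (w.ew_antitone (hPr k (Finset.mem_filter.1 hk).1))
        refine (Finset.sum_le_sum fun i _ => (bigPart_le_self _ _ _).trans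
          ((le_gauge (R := R) (w := w) (a i) k).trans (haC i))).trans ?_
        simp [hA]
    _ ≤ (l * (n * C) + 1) * (δ / 2 / (l * (n * C) + 1)) := by
        rw [Finset.sum_const, nsmul_eq_mul, ← mul_assoc]
        refine mul_le_mul' ((mul_le_mul_left (Nat.cast_le.2 ?_) _).trans le_self_add) hP.le
        exact (Finset.card_le_card fun k hk => (Finset.mem_filter.1 hk).2).trans hF
    _ ≤ δ / 2 := ENNReal.mul_div_le

/-- Rapidly increasing scales. -/
theorem exists_scales {lam : ℕ → ℝ≥0∞} (hlam : ∀ x ≠ ∞, ∃ n, x ≤ lam n) (h : ℕ → ℕ) {D : ℝ≥0∞}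
    (hD : D ≠ ∞) : ∃ n : ℕ → ℕ, ∀ t, 1 ≤ lam (n t) ∧
      D * (∑ i ∈ Finset.range t, h (n i) : ℕ) ≤ lam (n t) := by
  have : ∀ N : ℕ, ∃ n, max 1 (D * N) ≤ lam n := fun N =>
    hlam _ (max_lt ENNReal.one_lt_top (ENNReal.mul_lt_top hD.lt_top (by simp))).ne
  choose f hf using this
  -- `H t` accumulates the cost `h` of the scales chosen before `t`; the next scale is chosen to
  -- dominate `D * H t`.
  set H : ℕ → ℕ := fun t => Nat.rec 0 (fun _ N => N + h (f N)) t with hH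
  have hHsum : ∀ t, ∑ i ∈ Finset.range t, h (f (H i)) = H t := by
    intro t
    induction t with
    | zero => simp [hH]
    | succ t ih => rw [Finset.sum_range_succ, ih]
  refine ⟨fun t => f (H t), fun t => ⟨(le_max_left _ _).trans (hf (H t)), ?_⟩⟩
  rw [hHsum]
  exact (le_max_right _ _).trans (hf (H t))

/-! ### The upper estimate for increasing selections -/

/-- Since `f` lies to the left of `g`, an increasing selection with at least `P` terms of `f` sends
all terms of `g` to positions from `P` on, where they contribute at most `δ₁`. A selection with
fewer terms of `f` collects at most `δ₂` from them. This is where the order of the coordinates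
matters. -/
theorem gauge_increasing_add_le {f g : ℕ → ℝ≥0∞} (hfg : ∀ k, f k ≠ 0 → ∀ l, g l ≠ 0 → k < l)
    {P : ℕ} {δ₁ δ₂ : ℝ≥0∞}
    (hg : ∀ S r, increasing.Adm S r → (∀ k ∈ S, P ≤ r k) → selSum w g S r ≤ δ₁)
    (hf : ∀ k, P * f k ≤ δ₂) :
    increasing.gauge w (fun k => f k + g k) ≤
      max (increasing.gauge w f + δ₁) (δ₂ + increasing.gauge w g) := by
  classical
  refine gauge_le fun S r hr => ?_
  rw [selSum_add]
  set T := S.filter fun k => f k ≠ 0 with hT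
  by_cases hTP : P ≤ T.card
  · refine le_max_of_le_left (add_le_add (selSum_le_gauge hr _) ?_)
    have : selSum w g S r = selSum w g (S.filter fun k => g k ≠ 0) r :=
      (Finset.sum_filter_of_ne fun k _ hk => by intro h; simp [h] at hk).symm
    rw [this]
    refine hg _ _ (increasing.subset hr (Finset.filter_subset _ _)) fun k hk => hTP.trans ?_
    have hk' := Finset.mem_filter.1 hk
    have hc : T.card ≤ (Finset.range (r k)).card := by
      refine Finset.card_le_card_of_injOn r (fun j hj => ?_)
        ((increasing.injOn hr).mono fun j hj => (Finset.mem_filter.1 hj).1)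
      have hj' := Finset.mem_filter.1 hj
      simpa using hr hj'.1 hk'.1 (hfg j hj'.2 k hk'.2)
    rwa [Finset.card_range] at hc
  · refine le_max_of_le_right (add_le_add ?_ (selSum_le_gauge hr _))
    calc selSum w f S r = selSum w f T r :=
          (Finset.sum_filter_of_ne fun k _ hk => by intro h; simp [h] at hk).symm
      _ ≤ ∑ k ∈ T, ⨆ k, f k :=
          Finset.sum_le_sum fun k _ => (mul_le_mul' (le_iSup f k) (w.ew_le_one _)).trans (by simp)
      _ = T.card * ⨆ k, f k := by simp
      _ ≤ P * ⨆ k, f k := by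
          refine mul_le_mul_left (Nat.cast_le.2 (by omega)) _
      _ ≤ δ₂ := by
          rw [ENNReal.mul_iSup]
          exact iSup_le hf

/-- The supports run from right to left, so each new `f n` stands in front of the earlier ones and
the previous dichotomy applies with `P = H n`. Either alternative raises the bound by at most one
more `δ`: the gauges do not add up. -/
theorem gauge_increasing_sum_le {f : ℕ → ℕ → ℝ≥0∞} {T : ℕ}
    (hf : ∀ i j, i < j → j < T → ∀ k, f j k ≠ 0 → ∀ l, f i l ≠ 0 → k < l) {K δ : ℝ≥0∞}
    (hK : ∀ j < T, increasing.gauge w (f j) ≤ K) {H : ℕ → ℕ} (hH : Monotone H)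
    (htail : ∀ j < T, ∀ S r, increasing.Adm S r → (∀ k ∈ S, H (j + 1) ≤ r k) →
      selSum w (f j) S r ≤ δ)
    (hsup : ∀ j < T, ∀ k, H j * f j k ≤ δ) :
    increasing.gauge w (fun k => ∑ j ∈ Finset.range T, f j k) ≤ K + T * δ := by
  have : ∀ n ≤ T, increasing.gauge w (fun k => ∑ j ∈ Finset.range n, f j k) ≤ K + n * δ := by
    intro n
    induction n with
    | zero => intro _; simp [gauge_zero]
    | succ n ih =>
      intro hn
      simp only [Finset.sum_range_succ]
      have hcomm : (fun k => ∑ j ∈ Finset.range n, f j k + f n k) =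
          fun k => f n k + ∑ j ∈ Finset.range n, f j k := funext fun k => add_comm _ _
      rw [hcomm]
      refine (gauge_increasing_add_le (P := H n) (δ₁ := n * δ) (δ₂ := δ) ?_ ?_
        (hsup n (by omega))).trans (max_le ?_ ?_)
      · intro k hk l hl
        obtain ⟨i, hi, hne⟩ := Finset.exists_ne_zero_of_sum_ne_zero hl
        exact hf i n (Finset.mem_range.1 hi) (by omega) k hk l hne
      · intro S r hr hS
        calc selSum w (fun k => ∑ j ∈ Finset.range n, f j k) S r
            = ∑ j ∈ Finset.range n, selSum w (f j) S r := by
              simp only [selSum, Finset.sum_mul]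
              exact Finset.sum_comm
          _ ≤ ∑ j ∈ Finset.range n, δ := Finset.sum_le_sum fun j hj =>
              htail j (by have := Finset.mem_range.1 hj; omega) S r hr fun k hk =>
                (hH (Nat.succ_le_of_lt (Finset.mem_range.1 hj))).trans (hS k hk)
          _ = n * δ := by simp
      · refine add_le_add (hK n (by omega)) (mul_le_mul_left (Nat.cast_le.2 (Nat.le_succ n)) _)
      · refine (add_le_add le_rfl (ih (by omega))).trans (le_of_eq ?_)
        push_cast
        ring
  exact this T le_rfl

/-- The reversal of the order of the numbers below `N`. -/
def revBelow (N i : ℕ) : ℕ := if i < N then N - 1 - i else i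

theorem revBelow_injective (N : ℕ) : Function.Injective (revBelow N) := by
  intro i j h
  unfold revBelow at h
  split_ifs at h <;> omega

/-- Coefficients that are large in order of appearance, but small in the reversed order. -/
theorem exists_separating_coefficients {a b : ℕ → ℕ → ℝ≥0∞} {B : ℕ → Finset ℕ} {s : ℕ → ℕ}
    (haB : ∀ i, ∀ k ∉ B i, a i k = 0) (hB : ∀ i j, i ≠ j → Disjoint (B i) (B j))
    (hb : IsBlock b s) (hua : NoFlatPart R w a) (hub : NoFlatPart increasing w b)
    {C : ℝ≥0∞} (hC : C ≠ ∞) (haC : ∀ i, R.gauge w (a i) ≤ C)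
    (hbC : ∀ i, increasing.gauge w (b i) ≤ C)
    {lam : ℕ → ℝ≥0∞} (hfin : ∀ n, lam n ≠ ∞) (hlam : ∀ x ≠ ∞, ∃ n, x ≤ lam n)
    {K : ℝ≥0∞} (hK0 : K ≠ 0) (hK : K ≠ ∞)
    (hKa : ∀ A : Finset ℕ, lam A.card ≤ K * R.gauge w (fun k => ∑ i ∈ A, a i k))
    (hKb : ∀ A : Finset ℕ, increasing.gauge w (fun k => ∑ i ∈ A, b i k) ≤ K * lam A.card)
    {σ : ℕ → ℕ → ℕ} (hσ : ∀ N, Function.Injective (σ N))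
    (hpre : ∀ N (I J : Finset ℕ), (∀ i ∈ I, ∀ j ∈ J, i < j) →
      R.Precedes (⋃ i ∈ I, (B (σ N i) : Set ℕ)) (⋃ j ∈ J, (B (σ N j) : Set ℕ))) (T : ℕ) :
    ∃ (N : ℕ) (τ : ℕ → ℝ≥0),
      T ≤ 4 * K * R.gauge w (fun k => ∑ i ∈ Finset.range N, τ i * a (σ N i) k) ∧
      increasing.gauge w (fun k => ∑ i ∈ Finset.range N, τ i * b (revBelow N i) k) ≤ K + 1 := by
  classical
  rcases Nat.eq_zero_or_pos T with rfl | hT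
  · exact ⟨0, 0, by simp, by simp [gauge_zero]⟩
  have hT0 : (T : ℝ≥0∞) ≠ 0 := by exact_mod_cast hT.ne'
  -- A normalized group has gauge at least `1 / K = 2 * κ`: one `κ` is spent on the small parts, and
  -- half of the other on superadditivity, which leaves `κ / 2 = 1 / (4 * K)` per group.
  set κ : ℝ≥0∞ := (2 * K)⁻¹ with hκ
  have h2K : 2 * K ≠ ∞ := ENNReal.mul_ne_top (by simp) hK
  have h2K0 : 2 * K ≠ 0 := mul_ne_zero (by simp) hK0
  have hκ0 : 0 < κ := ENNReal.inv_pos.2 h2K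
  have hκtop : κ ≠ ∞ := ENNReal.inv_ne_top.2 h2K0
  have hκK : 2 * κ * K = 1 := by
    rw [mul_right_comm, hκ]
    exact ENNReal.mul_inv_cancel h2K0 h2K
  set δ : ℝ≥0∞ := (T : ℝ≥0∞)⁻¹ with hδ
  have hδ0 : 0 < δ := ENNReal.inv_pos.2 (by simp)
  choose ε l hsplit using fun n => hua.exists_split haB hC haC hκ0 n
  choose P hP using fun n => hub.exists_tail (B := fun n => Finset.Ico (s n) (s (n + 1)))
    (fun i k hk => hb.eq_zero hk) hC hbC hδ0 n
  -- The summand `C * T` serves the upper estimate (errors `1 / T`), the summand `C * (4 * K)` the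
  -- lower one (errors `κ / 2`).
  set D : ℝ≥0∞ := C * T + C * (4 * K) with hD
  have hDtop : D ≠ ∞ := ENNReal.add_ne_top.2
    ⟨ENNReal.mul_ne_top hC (by simp), ENNReal.mul_ne_top hC (ENNReal.mul_ne_top (by simp) hK)⟩
  -- The `t`-th group has `n t` members and coefficient `1 / lam (n t)`. Its height, at most `C /
  -- lam (n t)`, is negligible against the number `H t`, which counts both the coordinates `l` of
  -- the earlier big parts and the tail positions `P`.
  obtain ⟨n, hn⟩ := exists_scales hlam (fun n => l n + P n) hDtop
  set L : ℕ → ℝ≥0∞ := fun t => lam (n t) with hL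
  have hL0 : ∀ t, L t ≠ 0 := fun t => (one_pos.trans_le (hn t).1).ne'
  have hLtop : ∀ t, L t ≠ ∞ := fun t => hfin _
  have hLinv : ∀ t, (L t)⁻¹ ≤ 1 := fun t => ENNReal.inv_le_one.2 (hn t).1
  set H : ℕ → ℕ := fun t => ∑ i ∈ Finset.range t, (l (n i) + P (n i)) with hH
  have hHL : ∀ t, D * H t ≤ L t := fun t => (hn t).2
  have hHmono : Monotone H := fun i j hij =>
    Finset.sum_le_sum_of_subset (Finset.range_mono hij)
  set M : ℕ → ℕ := fun t => ∑ i ∈ Finset.range t, n i with hM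
  have hMs : ∀ t, M (t + 1) = M t + n t := fun t => Finset.sum_range_succ _ _
  have hMmono : Monotone M := fun i j hij =>
    Finset.sum_le_sum_of_subset (Finset.range_mono hij)
  set A : ℕ → Finset ℕ := fun t => Finset.Ico (M t) (M (t + 1)) with hA
  have hAcard : ∀ t, (A t).card = n t := fun t => by simp [hA, hMs]
  have hAlt : ∀ i j, i < j → ∀ x ∈ A i, ∀ y ∈ A j, x < y := fun i j hij x hx y hy =>
    (Finset.mem_Ico.1 hx).2.trans_le ((hMmono (Nat.succ_le_of_lt hij)).trans
      (Finset.mem_Ico.1 hy).1)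
  have hAsub : ∀ t < T, ∀ i ∈ A t, i < M T := fun t ht i hi =>
    (Finset.mem_Ico.1 hi).2.trans_le (hMmono (Nat.succ_le_of_lt ht))
  set N := M T with hN
  -- the coefficients
  set τ : ℕ → ℝ≥0 := fun i => ∑ t ∈ Finset.range T, if i ∈ A t then ((L t)⁻¹).toNNReal else 0
    with hτ
  have hτsum : ∀ x : ℕ → ℝ≥0∞, ∑ i ∈ Finset.range N, τ i * x i =
      ∑ t ∈ Finset.range T, (L t)⁻¹ * ∑ i ∈ A t, x i := by
    intro x
    have h1 : ∀ i, (τ i : ℝ≥0∞) * x i =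
        ∑ t ∈ Finset.range T, if i ∈ A t then (L t)⁻¹ * x i else 0 := by
      intro i
      rw [hτ, ENNReal.ofNNReal_finsetSum, Finset.sum_mul]
      refine Finset.sum_congr rfl fun t _ => ?_
      split_ifs
      · rw [ENNReal.coe_toNNReal (ENNReal.inv_ne_top.2 (hL0 t))]
      · simp
    simp only [h1]
    rw [Finset.sum_comm]
    refine Finset.sum_congr rfl fun t ht => ?_
    rw [← Finset.sum_filter, Finset.mul_sum]
    refine Finset.sum_congr ?_ fun _ _ => rfl
    ext i
    simp only [Finset.mem_filter, Finset.mem_range, and_iff_right_iff_imp]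
    exact hAsub t (Finset.mem_range.1 ht) i
  refine ⟨N, τ, ?_, ?_⟩
  · -- the lower estimate
    set f : ℕ → ℕ → ℝ≥0∞ := fun t k =>
      (L t)⁻¹ * ∑ i ∈ A t, bigPart (ε (n t)) (a (σ N i)) k with hf
    have himg : ∀ (t : ℕ) (x : ℕ → ℝ≥0∞),
        ∑ i ∈ (A t).image (σ N), x i = ∑ i ∈ A t, x (σ N i) :=
      fun t x => Finset.sum_image (hσ N).injOn
    have hcard : ∀ t, ((A t).image (σ N)).card = n t := fun t => by
      rw [Finset.card_image_of_injective _ (hσ N), hAcard]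
    choose hsm F hFl hFB hF0 using fun t => hsplit (n t) _ (hcard t)
    -- Since `lam (n t) ≥ 1`, normalization does not enlarge the small part, whose gauge is at most
    -- `κ`.
    have hlow : ∀ t, κ ≤ R.gauge w (f t) := by
      intro t
      have h1 : 2 * κ ≤ (L t)⁻¹ * R.gauge w (fun k => ∑ i ∈ (A t).image (σ N), a i k) := by
        have := hKa ((A t).image (σ N))
        rw [hcard] at this
        calc 2 * κ = (2 * κ) * ((L t)⁻¹ * L t) := by
              rw [ENNReal.inv_mul_cancel (hL0 t) (hLtop t), mul_one]
          _ ≤ (2 * κ) * ((L t)⁻¹ * (K * R.gauge w (fun k => ∑ i ∈ (A t).image (σ N), a i k))) := by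
              gcongr
          _ = (2 * κ * K) * ((L t)⁻¹ * R.gauge w (fun k => ∑ i ∈ (A t).image (σ N), a i k)) := by
              ring
          _ = _ := by rw [hκK, one_mul]
      have h2 : R.gauge w (fun k => ∑ i ∈ (A t).image (σ N), a i k) ≤
          κ + R.gauge w (fun k => ∑ i ∈ (A t).image (σ N), bigPart (ε (n t)) (a i) k) := by
        refine le_trans (gauge_mono fun k => ?_) ((gauge_add_le _ _).trans
          (add_le_add (hsm t) le_rfl))
        rw [← Finset.sum_add_distrib]
        exact Finset.sum_le_sum fun i _ => (smallPart_add_bigPart _ (a i) k).ge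
      have h3 : R.gauge w (f t) = (L t)⁻¹ *
          R.gauge w (fun k => ∑ i ∈ (A t).image (σ N), bigPart (ε (n t)) (a i) k) := by
        rw [← gauge_mul]
        simp only [himg, hf]
      refine (ENNReal.add_le_add_iff_left hκtop).1 ?_
      calc κ + κ = 2 * κ := (two_mul κ).symm
        _ ≤ (L t)⁻¹ * (κ + R.gauge w
              (fun k => ∑ i ∈ (A t).image (σ N), bigPart (ε (n t)) (a i) k)) := h1.trans (by gcongr)
        _ = (L t)⁻¹ * κ + R.gauge w (f t) := by rw [mul_add, h3]
        _ ≤ 1 * κ + R.gauge w (f t) := by gcongr; exact hLinv t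
        _ = _ := by rw [one_mul]
    have hFdis : ∀ i j, i < j → Disjoint (F i) (F j) := by
      intro i j hij
      rw [Finset.disjoint_left]
      intro x hxi hxj
      obtain ⟨p, hp, hxp⟩ := Finset.mem_biUnion.1 (hFB i hxi)
      obtain ⟨q, hq, hxq⟩ := Finset.mem_biUnion.1 (hFB j hxj)
      obtain ⟨p', hp', rfl⟩ := Finset.mem_image.1 hp
      obtain ⟨q', hq', rfl⟩ := Finset.mem_image.1 hq
      exact Finset.disjoint_left.1
        (hB _ _ fun h => (hAlt i j hij _ hp' _ hq').ne (hσ N h)) hxp hxq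
    have hFpre : ∀ j, R.Precedes (⋃ i < j, (F i : Set ℕ)) (F j) := by
      intro j S₁ S₂ r₁ r₂ hS₁ hS₂
      refine hpre N ((Finset.range j).biUnion A) (A j) ?_ S₁ S₂ r₁ r₂ (hS₁.trans ?_) (hS₂.trans ?_)
      · intro x hx y hy
        obtain ⟨i, hi, hx⟩ := Finset.mem_biUnion.1 hx
        exact hAlt i j (Finset.mem_range.1 hi) x hx y hy
      · intro x hx
        simp only [Set.mem_iUnion] at hx ⊢
        obtain ⟨i, hi, hx⟩ := hx
        obtain ⟨p, hp, hxp⟩ := Finset.mem_biUnion.1 (hFB i hx)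
        obtain ⟨p', hp', rfl⟩ := Finset.mem_image.1 hp
        exact ⟨p', Finset.mem_biUnion.2 ⟨i, Finset.mem_range.2 hi, hp'⟩, hxp⟩
      · intro x hx
        simp only [Set.mem_iUnion]
        obtain ⟨p, hp, hxp⟩ := Finset.mem_biUnion.1 (hFB j hx)
        obtain ⟨p', hp', rfl⟩ := Finset.mem_image.1 hp
        exact ⟨p', hp', hxp⟩
    have hsup : ∀ t k, f t k ≤ (L t)⁻¹ * C := by
      intro t k
      refine mul_le_mul_right ?_ _
      refine (Finset.sum_le_sum fun i _ => bigPart_le_self _ _ k).trans ?_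
      rw [← himg t (fun i => a i k)]
      by_cases h : ∃ i ∈ (A t).image (σ N), k ∈ B i
      · obtain ⟨i, hi, hk⟩ := h
        rw [Finset.sum_eq_single_of_mem i hi fun j _ hj => haB j k
          (Finset.disjoint_left.1 (hB i j hj.symm) hk)]
        exact (le_gauge (R := R) (w := w) (a i) k).trans (haC i)
      · push Not at h
        rw [Finset.sum_eq_zero fun i hi => haB i k (h i hi)]
        exact zero_le
    have hκ2 : κ / 2 * (4 * K) = 1 := by
      rw [← hκK, div_eq_mul_inv]
      calc κ * 2⁻¹ * (4 * K) = κ * K * (2⁻¹ * (2 * 2)) := by ring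
        _ = κ * K * 2 := by
            rw [← mul_assoc 2⁻¹, ENNReal.inv_mul_cancel (by simp) (by simp), one_mul]
        _ = _ := by ring
    -- In order of appearance, the big parts of the earlier groups occupy at most `H t` coordinates
    -- and the `t`-th group is flat at that scale.
    have key := sum_gauge_le (R := R) (w := w) (f := f) (F := F)
      (fun j k hk => by
        have h0 := hF0 j k hk
        rw [himg j (fun i => bigPart (ε (n j)) (a i) k)] at h0
        simp only [hf, h0, mul_zero]) hFdis hFpre
      (ε := fun _ => κ / 2) (fun t k => by
        have h1 : ((∑ i ∈ Finset.range t, (F i).card : ℕ) : ℝ≥0∞) ≤ H t := by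
          refine Nat.cast_le.2 (Finset.sum_le_sum fun i _ => (hFl i).trans (Nat.le_add_right _ _))
        calc _ ≤ (H t : ℝ≥0∞) * ((L t)⁻¹ * C) := mul_le_mul' h1 (hsup t k)
          _ = κ / 2 * (4 * K) * ((H t : ℝ≥0∞) * ((L t)⁻¹ * C)) := by rw [hκ2, one_mul]
          _ = κ / 2 * ((L t)⁻¹ * (C * (4 * K) * H t)) := by ring
          _ ≤ κ / 2 * ((L t)⁻¹ * (D * H t)) := by
              gcongr
              exact le_add_self
          _ ≤ κ / 2 * ((L t)⁻¹ * L t) := by gcongr; exact hHL t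
          _ = κ / 2 := by rw [ENNReal.inv_mul_cancel (hL0 t) (hLtop t), mul_one]) T
    have h1 : (T : ℝ≥0∞) * (κ / 2) ≤ R.gauge w (fun k => ∑ j ∈ Finset.range T, f j k) := by
      have h2 : (T : ℝ≥0∞) * κ ≤ R.gauge w (fun k => ∑ j ∈ Finset.range T, f j k) +
          T * (κ / 2) := by
        refine le_trans ?_ (key.trans (le_of_eq (by simp)))
        calc (T : ℝ≥0∞) * κ = ∑ j ∈ Finset.range T, κ := by simp
          _ ≤ _ := Finset.sum_le_sum fun j _ => hlow j
      refine (ENNReal.add_le_add_iff_right (a := T * (κ / 2)) (ENNReal.mul_ne_top (by simp)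
        (ENNReal.div_ne_top hκtop (by simp)))).1 ?_
      rwa [← mul_add, ENNReal.add_halves]
    calc (T : ℝ≥0∞) = T * (κ / 2 * (4 * K)) := by rw [hκ2, mul_one]
      _ = 4 * K * (T * (κ / 2)) := by ring
      _ ≤ 4 * K * R.gauge w (fun k => ∑ j ∈ Finset.range T, f j k) := by gcongr
      _ ≤ _ := by
          refine mul_le_mul_right (gauge_mono fun k => ?_) _
          rw [hτsum fun i => a (σ N i) k]
          exact Finset.sum_le_sum fun t _ => mul_le_mul_right
            (Finset.sum_le_sum fun i _ => bigPart_le_self _ _ _) _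
  · -- the upper estimate
    have hcard : ∀ t, ((A t).image (revBelow N)).card = n t := fun t => by
      rw [Finset.card_image_of_injective _ (revBelow_injective N), hAcard]
    have himg : ∀ (t : ℕ) (x : ℕ → ℝ≥0∞),
        ∑ i ∈ (A t).image (revBelow N), x i = ∑ i ∈ A t, x (revBelow N i) :=
      fun t x => Finset.sum_image (revBelow_injective N).injOn
    have hpoint : ∀ t k, ∑ i ∈ (A t).image (revBelow N), b i k ≤ C := by
      intro t k
      by_cases h : ∃ i ∈ (A t).image (revBelow N), b i k ≠ 0
      · obtain ⟨i, hi, hk⟩ := h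
        rw [Finset.sum_eq_single_of_mem i hi fun j _ hj => ?_]
        · exact (le_gauge (R := increasing) (w := w) (b i) k).trans (hbC i)
        · by_contra hjk
          have h1 := hb.supp i k hk
          have h2 := hb.supp j k hjk
          rcases lt_or_gt_of_ne hj with h | h
          · have := hb.mono (Nat.succ_le_of_lt h)
            simp only [Nat.succ_eq_add_one] at this
            omega
          · have := hb.mono (Nat.succ_le_of_lt h)
            simp only [Nat.succ_eq_add_one] at this
            omega
      · push Not at h
        rw [Finset.sum_eq_zero fun i hi => h i hi]
        exact zero_le
    -- Reversing the indices puts the flatter groups to the left. Each group has gauge at most `K`,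
    -- and the `T` errors of size `1 / T` add up to `1`.
    have key := gauge_increasing_sum_le (w := w) (T := T) (H := H) (K := K) (δ := δ)
      (f := fun t k => (L t)⁻¹ * ∑ i ∈ (A t).image (revBelow N), b i k)
      (by
        intro i j hij hj k hk l hl
        obtain ⟨p, hp, hpk⟩ := Finset.exists_ne_zero_of_sum_ne_zero (right_ne_zero_of_mul hk)
        obtain ⟨q, hq, hql⟩ := Finset.exists_ne_zero_of_sum_ne_zero (right_ne_zero_of_mul hl)
        obtain ⟨p', hp', rfl⟩ := Finset.mem_image.1 hp
        obtain ⟨q', hq', rfl⟩ := Finset.mem_image.1 hq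
        have h1 := hAlt i j hij q' hq' p' hp'
        have h2 := hAsub j hj p' hp'
        have h3 : revBelow N p' < revBelow N q' := by
          unfold revBelow
          rw [if_pos h2, if_pos (h1.trans h2)]
          omega
        exact (hb.supp _ k hpk).2.trans_le ((hb.mono (Nat.succ_le_of_lt h3)).trans
          (hb.supp _ l hql).1))
      (by
        intro t _
        rw [gauge_mul]
        have := hKb ((A t).image (revBelow N))
        rw [hcard] at this
        calc _ ≤ (L t)⁻¹ * (K * L t) := by gcongr
          _ = K * ((L t)⁻¹ * L t) := by ring
          _ = K := by rw [ENNReal.inv_mul_cancel (hL0 t) (hLtop t), mul_one])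
      hHmono
      (by
        intro t _ S r hr hS
        rw [selSum_mul]
        refine (mul_le_mul' (hLinv t) (hP (n t) _ (hcard t) S r hr fun k hk =>
          le_trans ?_ (hS k hk))).trans (by simp)
        rw [hH]
        simp only [Finset.sum_range_succ]
        omega)
      (by
        intro t _ k
        have hTδ : (T : ℝ≥0∞) * δ = 1 := ENNReal.mul_inv_cancel hT0 (by simp)
        calc (H t : ℝ≥0∞) * ((L t)⁻¹ * ∑ i ∈ (A t).image (revBelow N), b i k)
            ≤ (H t : ℝ≥0∞) * ((L t)⁻¹ * C) := by gcongr; exact hpoint t k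
          _ = (T * δ) * ((H t : ℝ≥0∞) * ((L t)⁻¹ * C)) := by rw [hTδ, one_mul]
          _ = δ * ((L t)⁻¹ * (C * T * H t)) := by ring
          _ ≤ δ * ((L t)⁻¹ * (D * H t)) := by gcongr; exact le_self_add
          _ ≤ δ * ((L t)⁻¹ * L t) := by gcongr; exact hHL t
          _ = δ := by rw [ENNReal.inv_mul_cancel (hL0 t) (hLtop t), mul_one])
    rw [ENNReal.mul_inv_cancel hT0 (by simp)] at key
    refine le_trans (gauge_mono fun k => le_of_eq ?_) key
    rw [hτsum fun i => b (revBelow N i) k]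
    exact Finset.sum_congr rfl fun t _ => by rw [himg t (fun i => b i k)]

theorem sum_revBelow (N : ℕ) (f : ℕ → ℝ≥0∞) :
    ∑ i ∈ Finset.range N, f (revBelow N i) = ∑ i ∈ Finset.range N, f i := by
  rw [← Finset.sum_range_reflect f N]
  exact Finset.sum_congr rfl fun i hi => by rw [revBelow, if_pos (Finset.mem_range.1 hi)]

theorem revBelow_revBelow (N i : ℕ) : revBelow N (revBelow N i) = i := by
  unfold revBelow
  split_ifs <;> omega

theorem exists_enumeration (A : Finset ℕ) :
    ∃ e : ℕ → ℕ, Set.InjOn e (Finset.range A.card) ∧ (Finset.range A.card).image e = A := by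
  have hinj : Set.InjOn (rank A id) A :=
    injective.injOn (adm_rank (R := injective) Function.injective_id.injOn)
  have himg := image_rank (S := A) (r := id) Function.injective_id.injOn
  have hsurj : Set.SurjOn (rank A id) A (Finset.range A.card) := by
    rw [← himg, Finset.coe_image]
    exact Set.surjOn_image _ _
  refine ⟨Function.invFunOn (rank A id) A, ?_, ?_⟩
  · exact hsurj.rightInvOn_invFunOn.injOn
  · rw [← himg, Finset.image_image]
    refine (Finset.image_congr fun k hk => ?_).trans Finset.image_id
    exact hinj.leftInvOn_invFunOn hk

theorem false_of_natCast_le {x : ℝ≥0∞} (hx : x ≠ ∞) (h : ∀ T : ℕ, (T : ℝ≥0∞) ≤ x) : False := by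
  obtain ⟨n, hn⟩ := ENNReal.exists_nat_gt hx
  exact absurd (h n) (not_le.2 hn)

theorem div_mul_le_of_mul_le {η x y K : ℝ≥0∞} (h : η * x ≤ K * y) :
    η / K * x ≤ y := by
  rw [div_eq_mul_inv, mul_right_comm, ← div_eq_mul_inv]
  exact ENNReal.div_le_of_le_mul' h

theorem IsBlock.eq_of_ne_zero {a : ℕ → ℕ → ℝ≥0∞} {s : ℕ → ℕ} (ha : IsBlock a s) {i j k : ℕ}
    (hi : a i k ≠ 0) (hj : a j k ≠ 0) : i = j := by
  by_contra h
  have h1 := ha.supp i k hi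
  have h2 := ha.supp j k hj
  rcases lt_or_gt_of_ne h with h | h
  · have := ha.mono (Nat.succ_le_of_lt h)
    simp only [Nat.succ_eq_add_one] at this
    omega
  · have := ha.mono (Nat.succ_le_of_lt h)
    simp only [Nat.succ_eq_add_one] at this
    omega

theorem IsBlock.disjoint {a : ℕ → ℕ → ℝ≥0∞} {s : ℕ → ℕ} (ha : IsBlock a s) {i j : ℕ}
    (h : i ≠ j) : Disjoint (Finset.Ico (s i) (s (i + 1))) (Finset.Ico (s j) (s (j + 1))) := by
  rw [Finset.disjoint_left]
  intro k hi hj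
  rw [Finset.mem_Ico] at hi hj
  rcases lt_or_gt_of_ne h with h | h
  · have := ha.mono (Nat.succ_le_of_lt h)
    simp only [Nat.succ_eq_add_one] at this
    omega
  · have := ha.mono (Nat.succ_le_of_lt h)
    simp only [Nat.succ_eq_add_one] at this
    omega

theorem IsBlock.precedes [Successive R] {a : ℕ → ℕ → ℝ≥0∞} {s : ℕ → ℕ} (ha : IsBlock a s)
    {I J : Finset ℕ} (h : ∀ i ∈ I, ∀ j ∈ J, i < j) :
    R.Precedes (⋃ i ∈ I, (Finset.Ico (s i) (s (i + 1)) : Set ℕ))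
      (⋃ j ∈ J, (Finset.Ico (s j) (s (j + 1)) : Set ℕ)) := by
  refine Successive.precedes _ _ fun x hx y hy => ?_
  simp only [Set.mem_iUnion, Finset.coe_Ico, Set.mem_Ico] at hx hy
  obtain ⟨i, hi, hx⟩ := hx
  obtain ⟨j, hj, hy⟩ := hy
  have := ha.mono (Nat.succ_le_of_lt (h i hi j hj))
  simp only [Nat.succ_eq_add_one] at this
  omega

/-- A block sequence whose gauge is symmetric up to a constant, for the rule of Garling spaces,
satisfies a lower `ℓ₁` estimate. -/
theorem IsBlock.lower_estimate_of_symmetric {a : ℕ → ℕ → ℝ≥0∞} {s : ℕ → ℕ} (ha : IsBlock a s)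
    {C : ℝ≥0∞} (hC : C ≠ ∞) (haC : ∀ i, increasing.gauge w (a i) ≤ C) {η : ℝ≥0∞} (hη : 0 < η)
    (haη : ∀ i, η ≤ increasing.gauge w (a i)) {K : ℝ≥0∞} (hK : K ≠ ∞)
    (hsym : ∀ (t : ℕ → ℝ≥0) (N : ℕ) (σ τ : ℕ → ℕ), Set.InjOn σ (Finset.range N) →
      Set.InjOn τ (Finset.range N) →
      increasing.gauge w (fun k => ∑ i ∈ Finset.range N, t i * a (σ i) k) ≤
        K * increasing.gauge w (fun k => ∑ i ∈ Finset.range N, t i * a (τ i) k)) :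
    ∃ η : ℝ≥0∞, 0 < η ∧ ∀ (t : ℕ → ℝ≥0) (n : ℕ), η * ∑ i ∈ Finset.range n, (t i : ℝ≥0∞) ≤
      increasing.gauge w (fun k => ∑ i ∈ Finset.range n, t i * a i k) := by
  classical
  -- The shift makes the constant non-zero, so that it can be divided by.
  set K' := K + 1 with hK'
  have hK'0 : K' ≠ 0 := by simp [hK']
  have hK'top : K' ≠ ∞ := ENNReal.add_ne_top.2 ⟨hK, by simp⟩
  have hsym' : ∀ (t : ℕ → ℝ≥0) (N : ℕ) (σ τ : ℕ → ℕ), Set.InjOn σ (Finset.range N) →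
      Set.InjOn τ (Finset.range N) →
      increasing.gauge w (fun k => ∑ i ∈ Finset.range N, t i * a (σ i) k) ≤
        K' * increasing.gauge w (fun k => ∑ i ∈ Finset.range N, t i * a (τ i) k) :=
    fun t N σ τ hσ hτ => (hsym t N σ τ hσ hτ).trans (mul_le_mul_left le_self_add _)
  by_cases hu : NoFlatPart increasing w a
  swap
  -- With flat parts, a subsequence satisfies the estimate and symmetry carries it over to the whole
  -- sequence.
  · obtain ⟨η', hη', m, hm, h⟩ := ha.exists_lower_estimate hu
    refine ⟨η' / K', ENNReal.div_pos hη'.ne' hK'top, fun t n => div_mul_le_of_mul_le ?_⟩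
    exact (h t n).trans (hsym' t n m id hm.injective.injOn Function.injective_id.injOn)
  exfalso
  obtain ⟨ε, hε, hsmall⟩ := hu (η / 2) (ENNReal.half_pos hη.ne')
  have hηtop : η ≠ ∞ := ne_top_of_le_ne_top hC ((haη 0).trans (haC 0))
  -- Without flat parts, each block has a term above `ε`, since its gauge is at least `η` and its
  -- small part accounts for only half of that. These terms make `lam` dominate `ε` times the
  -- partial sums of the weight, hence unbounded.
  have hbig : ∀ i, ∃ k, ε < a i k := by
    intro i
    by_contra hcon
    push Not at hcon
    have : smallPart ε (a i) = a i := funext fun k =>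
      Set.indicator_of_mem (s := {k | a i k ≤ ε}) (hcon k) _
    have h1 := hsmall i
    rw [this] at h1
    exact absurd ((haη i).trans h1) (not_le.2 (ENNReal.half_lt_self hη.ne' hηtop))
  choose q hq using hbig
  have hqinj : Function.Injective q := fun i j hij =>
    ha.eq_of_ne_zero (k := q i) (zero_le.trans_lt (hq i)).ne' (by
      rw [hij]; exact (zero_le.trans_lt (hq j)).ne')
  set lam : ℕ → ℝ≥0∞ := fun n => increasing.gauge w (fun k => ∑ i ∈ Finset.range n, a i k) with hlam
  have hfin : ∀ n, lam n ≠ ∞ := fun n =>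
    ne_top_of_le_ne_top (ENNReal.mul_ne_top (ENNReal.natCast_ne_top n) hC)
      ((gauge_sum_le _ _).trans ((Finset.sum_le_sum fun i _ => haC i).trans (by simp)))
  have hlow : ∀ n, ε * w.partialSum n ≤ lam n := by
    intro n
    have := mul_partialSum_le_gauge (R := increasing) (w := w) (m := ε)
      (a := fun k => ∑ i ∈ Finset.range n, a i k) ((Finset.range n).image q) (by
        intro k hk
        obtain ⟨i, hi, rfl⟩ := Finset.mem_image.1 hk
        exact (hq i).le.trans (Finset.single_le_sum (f := fun i' => a i' (q i))
          (fun _ _ => zero_le) hi))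
    rwa [Finset.card_image_of_injective _ hqinj, Finset.card_range] at this
  have hεtop : ε ≠ ∞ := (hq 0).ne_top
  have hinf : ∀ x ≠ ∞, ∃ n, x ≤ lam n := by
    intro x hx
    obtain ⟨n, hn⟩ := w.exists_partialSum_ge (ENNReal.div_ne_top hx hε.ne')
    refine ⟨n, le_trans ?_ (hlow n)⟩
    calc x = ε * (x / ε) := (ENNReal.mul_div_cancel hε.ne' hεtop).symm
      _ ≤ _ := mul_le_mul_right (hn n le_rfl) _
  have henum : ∀ A : Finset ℕ, ∃ e : ℕ → ℕ, Set.InjOn e (Finset.range A.card) ∧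
      increasing.gauge w (fun k => ∑ i ∈ A, a i k) = increasing.gauge w (fun k =>
        ∑ i ∈ Finset.range A.card, ((fun _ => 1 : ℕ → ℝ≥0) i : ℝ≥0∞) * a (e i) k) := by
    intro A
    obtain ⟨e, he, himg⟩ := exists_enumeration A
    refine ⟨e, he, congrArg _ (funext fun k => ?_)⟩
    have h := Finset.sum_image (f := fun i => a i k) he
    rw [himg] at h
    simpa using h
  have hlam1 : ∀ n, lam n = increasing.gauge w (fun k =>
      ∑ i ∈ Finset.range n, ((fun _ => 1 : ℕ → ℝ≥0) i : ℝ≥0∞) * a (id i) k) := by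
    intro n; simp [hlam]
  refine false_of_natCast_le (x := 4 * K' * (K' * (K' + 1))) ?_ fun T => ?_
  · exact ENNReal.mul_ne_top (ENNReal.mul_ne_top (by simp) hK'top)
      (ENNReal.mul_ne_top hK'top (ENNReal.add_ne_top.2 ⟨hK'top, by simp⟩))
  -- The sequence is compared with its own reversal: symmetry bounds every `T` by a fixed multiple
  -- of the bounded reversed gauge.
  obtain ⟨N, τ, h1, h2⟩ := exists_separating_coefficients (R := increasing) (w := w)
    (a := a) (b := a) (B := fun i => Finset.Ico (s i) (s (i + 1))) (s := s)
    (fun i k hk => ha.eq_zero hk) (fun i j hij => ha.disjoint hij) ha hu hu hC haC haC hfin hinf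
    hK'0 hK'top
    (fun A => by
      obtain ⟨e, he, h⟩ := henum A
      rw [h, hlam1]
      exact hsym' _ _ _ _ Function.injective_id.injOn he)
    (fun A => by
      obtain ⟨e, he, h⟩ := henum A
      rw [h, hlam1]
      exact hsym' _ _ _ _ he Function.injective_id.injOn)
    (σ := fun _ => id) (fun _ => Function.injective_id) (fun N I J hIJ => ha.precedes hIJ) T
  refine h1.trans (mul_le_mul_right ?_ _)
  refine (hsym' τ N id (revBelow N) Function.injective_id.injOn
    (revBelow_injective N).injOn).trans (mul_le_mul_right h2 _)

/-! ### The unit vectors -/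

/-- The unit vectors. -/
def unitSeq (i k : ℕ) : ℝ≥0∞ := if k = i then 1 else 0

theorem isBlock_unitSeq : IsBlock unitSeq id where
  mono := monotone_id
  supp n k h := by
    unfold unitSeq at h
    simp only [ne_eq, ite_eq_right_iff, one_ne_zero, imp_false, not_not] at h
    simp only [id_eq]
    omega

theorem gauge_sum_unitSeq (A : Finset ℕ) :
    R.gauge w (fun k => ∑ i ∈ A, unitSeq i k) = w.partialSum A.card := by
  have h : ∀ k, ∑ i ∈ A, unitSeq i k = if k ∈ A then 1 else 0 := fun k => by
    simp [unitSeq]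
  simp only [h]
  refine le_antisymm ?_ ?_
  · refine (gauge_le_mul_partialSum (m := 1) A (fun k => ?_) fun k hk => ?_).trans (by simp)
    · split_ifs <;> simp
    · simp [hk]
  · have := mul_partialSum_le_gauge (R := R) (w := w) (m := 1)
      (a := fun k => if k ∈ A then 1 else 0) A (fun k hk => by simp [hk])
    simpa using this

theorem gauge_unitSeq (i : ℕ) : R.gauge w (unitSeq i) = 1 := by
  have := gauge_sum_unitSeq (R := R) (w := w) {i}
  simpa [Weight.partialSum, w.ew_zero] using this

theorem noFlatPart_unitSeq : NoFlatPart R w unitSeq := by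
  refine fun η _ => ⟨1 / 2, by simp, fun n => ?_⟩
  have : smallPart (1 / 2) (unitSeq n) = fun _ => 0 := by
    funext k
    unfold smallPart unitSeq
    by_cases hk : k = n
    · rw [Set.indicator_of_notMem]
      simp [hk]
    · simp [hk]
  rw [this, gauge_zero]
  exact zero_le

/-- No block sequence is equivalent, for the rule of Lorentz spaces, to the unit vectors for the
rule of Garling spaces. -/
theorem IsBlock.not_equivalent {a : ℕ → ℕ → ℝ≥0∞} {s : ℕ → ℕ} (ha : IsBlock a s)
    {C : ℝ≥0∞} (hC : C ≠ ∞) (haC : ∀ i, injective.gauge w (a i) ≤ C) {K : ℝ≥0∞} (hK : K ≠ ∞)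
    (hl : ∀ (t : ℕ → ℝ≥0) (N : ℕ),
      increasing.gauge w (fun k => ∑ i ∈ Finset.range N, t i * unitSeq i k) ≤
        K * injective.gauge w (fun k => ∑ i ∈ Finset.range N, t i * a i k))
    (hu : ∀ (t : ℕ → ℝ≥0) (N : ℕ),
      injective.gauge w (fun k => ∑ i ∈ Finset.range N, t i * a i k) ≤
        K * increasing.gauge w (fun k => ∑ i ∈ Finset.range N, t i * unitSeq i k)) : False := by
  classical
  set K' := K + 1 with hK'
  have hKK' : K ≤ K' := le_self_add
  have hK'0 : K' ≠ 0 := by simp [hK']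
  have hK'top : K' ≠ ∞ := ENNReal.add_ne_top.2 ⟨hK, by simp⟩
  have hsum : ∀ A : Finset ℕ, ∃ (t : ℕ → ℝ≥0) (N : ℕ), ∀ x : ℕ → ℝ≥0∞,
      ∑ i ∈ A, x i = ∑ i ∈ Finset.range N, t i * x i := by
    intro A
    obtain ⟨N, hN⟩ := A.bddAbove
    refine ⟨fun i => if i ∈ A then 1 else 0, N + 1, fun x => ?_⟩
    have h1 : ∀ i, ((if i ∈ A then 1 else 0 : ℝ≥0) : ℝ≥0∞) * x i = if i ∈ A then x i else 0 := by
      intro i; split_ifs <;> simp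
    simp only [h1]
    rw [← Finset.sum_filter]
    refine Finset.sum_congr ?_ fun _ _ => rfl
    ext i
    simp only [Finset.mem_filter, Finset.mem_range, iff_and_self]
    exact fun hi => Nat.lt_succ_of_le (hN hi)
  have hlA : ∀ A : Finset ℕ, w.partialSum A.card ≤
      K' * injective.gauge w (fun k => ∑ i ∈ A, a i k) := by
    intro A
    obtain ⟨t, N, h⟩ := hsum A
    rw [← gauge_sum_unitSeq (R := increasing)]
    simp only [h]
    exact (hl t N).trans (mul_le_mul_left hKK' _)
  have huA : ∀ A : Finset ℕ, injective.gauge w (fun k => ∑ i ∈ A, a i k) ≤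
      K' * w.partialSum A.card := by
    intro A
    obtain ⟨t, N, h⟩ := hsum A
    rw [← gauge_sum_unitSeq (R := increasing)]
    simp only [h]
    exact (hu t N).trans (mul_le_mul_left hKK' _)
  by_cases hflat : NoFlatPart injective w a
  swap
  -- With flat parts, sums of `n` blocks would have gauge at least a multiple of `n`, whereas
  -- equivalence bounds it by a multiple of `w.partialSum n`.
  · obtain ⟨η, hη, m, hm, h⟩ := ha.exists_lower_estimate hflat
    obtain ⟨n, -, hn⟩ := w.exists_partialSum_lt (ENNReal.div_pos hη.ne' hK'top)
    refine absurd hn (not_lt.2 (div_mul_le_of_mul_le ?_))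
    have h1 := h (fun _ => 1) n
    have h2 := huA ((Finset.range n).image m)
    rw [Finset.card_image_of_injective _ hm.injective, Finset.card_range] at h2
    simp only [Finset.sum_image hm.injective.injOn] at h2
    simp only [ENNReal.coe_one, one_mul, Finset.sum_const, Finset.card_range, nsmul_eq_mul,
      mul_one] at h1
    exact h1.trans h2
  refine false_of_natCast_le (x := 4 * K' * (K' * (K' + 1))) ?_ fun T => ?_
  · exact ENNReal.mul_ne_top (ENNReal.mul_ne_top (by simp) hK'top)
      (ENNReal.mul_ne_top hK'top (ENNReal.add_ne_top.2 ⟨hK'top, by simp⟩))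
  -- Both sequences are taken in reversed order: this is harmless for distinct positions, so the
  -- Lorentz side stays large while the Garling side is bounded.
  obtain ⟨N, τ, h1, h2⟩ := exists_separating_coefficients (R := injective) (w := w)
    (a := a) (b := unitSeq) (B := fun i => Finset.Ico (s i) (s (i + 1))) (s := id)
    (fun i k hk => ha.eq_zero hk) (fun i j hij => ha.disjoint hij) isBlock_unitSeq hflat
    noFlatPart_unitSeq (C := C + 1) (ENNReal.add_ne_top.2 ⟨hC, by simp⟩)
    (fun i => (haC i).trans le_self_add) (fun i => (gauge_unitSeq i).le.trans le_add_self)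
    (lam := w.partialSum) w.partialSum_ne_top
    (fun x hx => (w.exists_partialSum_ge hx).imp fun n hn => hn n le_rfl) hK'0 hK'top hlA
    (fun A => (gauge_sum_unitSeq A).le.trans (le_mul_of_one_le_left zero_le le_add_self))
    (σ := revBelow) revBelow_injective (fun N I J _ => precedes_injective _ _) T
  have hrev : ∀ x : ℕ → ℝ≥0∞, ∑ i ∈ Finset.range N, τ i * x (revBelow N i) =
      ∑ i ∈ Finset.range N, τ (revBelow N i) * x i := by
    intro x
    rw [← sum_revBelow N fun i => τ (revBelow N i) * x i]
    simp only [revBelow_revBelow]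
  rw [funext fun k => hrev fun i => a i k] at h1
  rw [funext fun k => hrev fun i => unitSeq i k] at h2
  refine h1.trans (mul_le_mul_right ?_ _)
  exact (hu (fun i => τ (revBelow N i)) N).trans (mul_le_mul' hKK' h2)

end SelectionRule

open SelectionRule

/-! ### The two norms as gauges -/

theorem sum_range_le_gauge {R : SelectionRule} {w : Weight} {σ : ℕ → ℕ} {N : ℕ}
    (hσ : Set.InjOn σ (Finset.range N))
    (hr : R.Adm ((Finset.range N).image σ) (Function.invFunOn σ (Finset.range N)))
    (a : ℕ → ℝ≥0∞) : ∑ i ∈ Finset.range N, a (σ i) * w.ew i ≤ R.gauge w a := by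
  refine le_trans (le_of_eq ?_) (selSum_le_gauge hr a)
  rw [selSum, Finset.sum_image hσ]
  refine Finset.sum_congr rfl fun i hi => ?_
  rw [hσ.leftInvOn_invFunOn (Finset.mem_coe.2 hi)]

theorem rpow_one_div_rpow {p : ℝ} (hp : 1 ≤ p) (x : ℝ≥0∞) : (x ^ (1 / p)) ^ p = x := by
  rw [one_div, ENNReal.rpow_inv_rpow (by linarith)]

/-- An increasing `φ`, truncated, is a selection with positions `0, 1, …`. Conversely, a selection
on `S` is dominated by the increasing enumeration `Nat.nth q` of `S` and all indices beyond `S`: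
there each `k ∈ S` occurs at a place not after `r k`, and the added terms only help. -/
theorem garlingENorm_rpow {𝕜 : Type*} [RCLike 𝕜] (w : Weight) {p : ℝ} (hp : 1 ≤ p) (f : ℕ → 𝕜) :
    garlingENorm w p f ^ p = increasing.gauge w (fun k => ‖f k‖ₑ ^ p) := by
  classical
  have hp0 : 0 < p := by linarith
  refine le_antisymm ?_ (gauge_le fun S r hr => ?_)
  · rw [← ENNReal.le_rpow_inv_iff hp0, ← one_div]
    refine iSup_le fun φ => weightedNorm_le w hp fun N => ENNReal.rpow_le_rpow ?_ (by positivity)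
    have hinj : Set.InjOn φ.1 (Finset.range N) := φ.2.injective.injOn
    refine sum_range_le_gauge (R := increasing) hinj ?_ (fun k => ‖f k‖ₑ ^ p)
    intro x hx y hy hxy
    obtain ⟨i, hi, rfl⟩ := Finset.mem_image.1 (Finset.mem_coe.1 hx)
    obtain ⟨j, hj, rfl⟩ := Finset.mem_image.1 (Finset.mem_coe.1 hy)
    rw [hinj.leftInvOn_invFunOn (Finset.mem_coe.2 hi), hinj.leftInvOn_invFunOn (Finset.mem_coe.2 hj)]
    exact φ.2.lt_iff_lt.1 hxy
  · set q : ℕ → Prop := fun k => k ∈ S ∨ ∀ j ∈ S, j < k with hq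
    have hinf : {k | q k}.Infinite := by
      obtain ⟨N, hN⟩ := S.bddAbove
      refine (Set.Ioi_infinite N).mono fun k hk => Or.inr fun j hj => ?_
      exact (hN hj).trans_lt hk
    have hcount : ∀ k ∈ S, Nat.count q k ≤ r k := by
      intro k hk
      rw [Nat.count_eq_card_filter_range]
      refine (Finset.card_le_card fun j hj => ?_).trans (rank_le (increasing.injOn hr) k)
      rw [Finset.mem_filter, Finset.mem_range] at hj
      have hjS : j ∈ S := hj.2.resolve_right fun h => absurd (h k hk) hj.1.not_gt
      exact Finset.mem_filter.2 ⟨hjS, hr hjS hk hj.1⟩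
    have hcinj : Set.InjOn (Nat.count q) S := by
      have : StrictMonoOn (Nat.count q) S := fun i hi j _ hij =>
        Nat.count_strict_mono (Or.inl hi) hij
      exact this.injOn
    calc selSum w (fun k => ‖f k‖ₑ ^ p) S r
        ≤ ∑ k ∈ S, ‖f (Nat.nth q (Nat.count q k))‖ₑ ^ p * w.ew (Nat.count q k) := by
          refine Finset.sum_le_sum fun k hk => ?_
          rw [Nat.nth_count (p := q) (Or.inl hk)]
          exact mul_le_mul_right (w.ew_antitone (hcount k hk)) _
      _ = ∑ i ∈ S.image (Nat.count q), ‖f (Nat.nth q i)‖ₑ ^ p * w.ew i :=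
          (Finset.sum_image hcinj (f := fun i => ‖f (Nat.nth q i)‖ₑ ^ p * w.ew i)).symm
      _ ≤ ∑' i, ‖f (Nat.nth q i)‖ₑ ^ p * w.ew i := ENNReal.sum_le_tsum _
      _ = (weightedNorm w p fun i => ‖f (Nat.nth q i)‖ₑ) ^ p := (rpow_one_div_rpow hp _).symm
      _ ≤ garlingENorm w p f ^ p := by
          refine ENNReal.rpow_le_rpow ?_ hp0.le
          exact le_iSup (fun φ : {φ : ℕ → ℕ // StrictMono φ} =>
            weightedNorm w p (fun i => ‖f (φ.1 i)‖ₑ)) ⟨Nat.nth q, Nat.nth_strictMono hinf⟩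

/-- For null sequences the first terms of the rearrangement are dominated by an injective selection;
conversely any injective selection, compressed to ranks, is dominated by the rearrangement. -/
theorem lorentzENorm_rpow {𝕜 : Type*} [RCLike 𝕜] (w : Weight) {p : ℝ} (hp : 1 ≤ p) {f : ℕ → 𝕜}
    (hf : Tendsto f atTop (𝓝 0)) :
    lorentzENorm w p f ^ p = injective.gauge w (fun k => ‖f k‖ₑ ^ p) := by
  classical
  have hp0 : 0 < p := by linarith
  refine le_antisymm ?_ (gauge_le fun S r hr => ?_)
  · rw [← ENNReal.le_rpow_inv_iff hp0, ← one_div]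
    refine weightedNorm_le w hp fun N => ENNReal.rpow_le_rpow ?_ (by positivity)
    obtain ⟨σ, hσ, hle⟩ := exists_selection hf N
    refine le_trans (Finset.sum_le_sum fun i hi => mul_le_mul_left
      (ENNReal.rpow_le_rpow (hle i (Finset.mem_range.1 hi)) hp0.le) _)
      (sum_range_le_gauge (R := injective) hσ ?_ (fun k => ‖f k‖ₑ ^ p))
    intro x hx y hy hxy
    obtain ⟨i, hi, rfl⟩ := Finset.mem_image.1 (Finset.mem_coe.1 hx)
    obtain ⟨j, hj, rfl⟩ := Finset.mem_image.1 (Finset.mem_coe.1 hy)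
    rw [hσ.leftInvOn_invFunOn (Finset.mem_coe.2 hi), hσ.leftInvOn_invFunOn (Finset.mem_coe.2 hj)]
      at hxy
    rw [hxy]
  · have hinj : Set.InjOn (rank S r) S := injective.injOn (adm_rank (R := injective) hr)
    set e := Function.invFunOn (rank S r) S with he
    have hsurj : Set.SurjOn (rank S r) S (Finset.range S.card) := by
      rw [← image_rank hr, Finset.coe_image]
      exact Set.surjOn_image _ _
    calc selSum w (fun k => ‖f k‖ₑ ^ p) S r
        ≤ selSum w (fun k => ‖f k‖ₑ ^ p) S (rank S r) := selSum_le_selSum_rank hr _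
      _ = ∑ i ∈ S.image (rank S r), ‖f (e i)‖ₑ ^ p * w.ew i := by
          rw [Finset.sum_image hinj]
          refine Finset.sum_congr rfl fun k hk => ?_
          rw [he, hinj.leftInvOn_invFunOn (Finset.mem_coe.2 hk)]
      _ = (weightedNormFin w p S.card fun i => ‖f (e i)‖ₑ) ^ p := by
          rw [image_rank hr]
          exact (rpow_one_div_rpow hp _).symm
      _ ≤ lorentzENorm w p f ^ p := by
          refine ENNReal.rpow_le_rpow ?_ hp0.le
          exact (weightedNormFin_le_rearrangement w hp (fun k => ‖f k‖ₑ) S.card e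
            hsurj.rightInvOn_invFunOn.injOn).trans (weightedNormFin_le w hp _ _)

/-! ### Sequence spaces modelled on a gauge -/

/-- A normed space of sequences whose norm is the `p`-th root of a gauge, and that contains all
sequences of finite gauge. -/
structure GaugeSpace (𝕜 : Type*) [RCLike 𝕜] (R : SelectionRule) (w : Weight) (p : ℝ) (E : Type*)
    [NormedAddCommGroup E] [NormedSpace 𝕜 E] where
  val : E →ₗ[𝕜] (ℕ → 𝕜)
  enorm_rpow : ∀ x, ‖x‖ₑ ^ p = R.gauge w (fun k => ‖val x k‖ₑ ^ p)
  exists_val : ∀ f : ℕ → 𝕜, R.gauge w (fun k => ‖f k‖ₑ ^ p) ≠ ∞ → ∃ x, val x = f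

theorem tendsto_zero_of_rpow {𝕜 : Type*} [RCLike 𝕜] {p : ℝ} (hp : 0 < p) {f : ℕ → 𝕜}
    (h : Tendsto (fun k => ‖f k‖ₑ ^ p) atTop (𝓝 0)) : Tendsto f atTop (𝓝 0) := by
  have h1 := (ENNReal.continuous_rpow_const (y := p⁻¹)).tendsto 0 |>.comp h
  rw [ENNReal.zero_rpow_of_pos (inv_pos.2 hp)] at h1
  rw [tendsto_zero_iff_norm_tendsto_zero]
  have h2 := (ENNReal.tendsto_toReal ENNReal.zero_ne_top).comp h1
  refine h2.congr fun k => ?_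
  simp [ENNReal.rpow_rpow_inv hp.ne']

section Models

variable (𝕜 : Type*) [RCLike 𝕜] (w : Weight) (p : ℝ) [hp : Fact (1 ≤ p)]

/-- Garling spaces are gauge spaces. -/
def garlingModel : GaugeSpace 𝕜 increasing w p (GarlingSpace 𝕜 w p) where
  val :=
    { toFun := fun x => x.1
      map_add' := fun _ _ => rfl
      map_smul' := fun _ _ => rfl }
  enorm_rpow x := by
    have h : ‖x‖ₑ = garlingENorm w p x.1 := by
      rw [← ofReal_norm]
      exact ENNReal.ofReal_toReal x.2.ne
    rw [h]
    exact garlingENorm_rpow w hp.out x.1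
  exists_val f hf := by
    refine ⟨⟨f, ?_⟩, rfl⟩
    rw [← garlingENorm_rpow w hp.out] at hf
    refine lt_top_iff_ne_top.2 fun (h : garlingENorm w p f = ∞) => hf ?_
    rw [h, ENNReal.top_rpow_of_pos (by linarith [hp.out])]

/-- Lorentz spaces are gauge spaces. -/
def lorentzModel : GaugeSpace 𝕜 injective w p (LorentzSpace 𝕜 w p) where
  val :=
    { toFun := fun x => x.1
      map_add' := fun _ _ => rfl
      map_smul' := fun _ _ => rfl }
  enorm_rpow x := by
    have h : ‖x‖ₑ = lorentzENorm w p x.1 := by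
      rw [← ofReal_norm]
      exact ENNReal.ofReal_toReal x.2.2.ne
    rw [h]
    exact lorentzENorm_rpow w hp.out x.2.1
  exists_val f hf := by
    have h0 : Tendsto f atTop (𝓝 0) :=
      tendsto_zero_of_rpow (by linarith [hp.out]) (tendsto_of_gauge_ne_top hf)
    refine ⟨⟨f, h0, ?_⟩, rfl⟩
    rw [← lorentzENorm_rpow w hp.out h0] at hf
    refine lt_top_iff_ne_top.2 fun h => hf ?_
    rw [h, ENNReal.top_rpow_of_pos (by linarith [hp.out])]

end Models

namespace GaugeSpace

variable {𝕜 : Type*} [RCLike 𝕜] {R : SelectionRule} {w : Weight} {p : ℝ} {E : Type*}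
  [NormedAddCommGroup E] [NormedSpace 𝕜 E] (M : GaugeSpace 𝕜 R w p E)

include M

theorem enorm_val_le (hp : 0 < p) (x : E) (k : ℕ) : ‖M.val x k‖ₑ ≤ ‖x‖ₑ := by
  rw [← ENNReal.rpow_le_rpow_iff hp, M.enorm_rpow]
  exact le_gauge (fun k => ‖M.val x k‖ₑ ^ p) k

theorem norm_val_le (hp : 0 < p) (x : E) (k : ℕ) : ‖M.val x k‖ ≤ ‖x‖ :=
  enorm_le_iff_norm_le.1 (M.enorm_val_le hp x k)

theorem gauge_ne_top (hp : 0 < p) (x : E) : R.gauge w (fun k => ‖M.val x k‖ₑ ^ p) ≠ ∞ := by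
  rw [← M.enorm_rpow]
  exact ENNReal.rpow_ne_top_of_nonneg hp.le enorm_ne_top

/-- The coordinates converge. As a supremum of finite weighted sums, the gauge is lower
semicontinuous for coordinatewise convergence, so Cauchy estimates survive in the limit;
`exists_val` then supplies a vector with the limit coordinates. -/
theorem completeSpace (hp : 0 < p) : CompleteSpace E := by
  refine Metric.complete_of_cauchySeq_tendsto fun u hu => ?_
  have hcoord : ∀ k, ∃ l, Tendsto (fun n => M.val (u n) k) atTop (𝓝 l) := fun k => by
    refine cauchySeq_tendsto_of_complete (Metric.cauchySeq_iff.2 fun ε hε => ?_)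
    obtain ⟨N, hN⟩ := Metric.cauchySeq_iff.1 hu ε hε
    refine ⟨N, fun m hm n hn => ?_⟩
    have := M.norm_val_le hp (u m - u n) k
    rw [map_sub, Pi.sub_apply] at this
    rw [dist_eq_norm]
    exact this.trans_lt (by simpa [dist_eq_norm] using hN m hm n hn)
  choose f hf using hcoord
  have hlim : ∀ {N : ℕ} {ε : ℝ}, (∀ m ≥ N, ∀ n ≥ N, dist (u m) (u n) < ε) → ∀ n ≥ N,
      R.gauge w (fun k => ‖M.val (u n) k - f k‖ₑ ^ p) ≤ ENNReal.ofReal ε ^ p := by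
    intro N ε h n hn
    refine gauge_le fun S r hr => ?_
    have ht : Tendsto (fun m => selSum w (fun k => ‖M.val (u n) k - M.val (u m) k‖ₑ ^ p) S r) atTop
        (𝓝 (selSum w (fun k => ‖M.val (u n) k - f k‖ₑ ^ p) S r)) := by
      refine tendsto_finsetSum _ fun k _ => ENNReal.Tendsto.mul_const ?_ (Or.inr ENNReal.ofReal_ne_top)
      exact (ENNReal.continuous_rpow_const.tendsto _).comp
        ((continuous_enorm.tendsto _).comp (tendsto_const_nhds.sub (hf k)))
    refine le_of_tendsto ht (eventually_atTop.2 ⟨N, fun m hm => ?_⟩)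
    refine (selSum_le_gauge hr _).trans ?_
    have h1 := M.enorm_rpow (u n - u m)
    simp only [map_sub, Pi.sub_apply] at h1
    rw [← h1, ← ofReal_norm, ← dist_eq_norm]
    exact ENNReal.rpow_le_rpow (ENNReal.ofReal_le_ofReal (h n hn m hm).le) hp.le
  obtain ⟨N₀, hN₀⟩ := Metric.cauchySeq_iff.1 hu 1 one_pos
  obtain ⟨y, hy⟩ := M.exists_val (fun k => M.val (u N₀) k - f k)
    (ne_top_of_le_ne_top (ENNReal.rpow_ne_top_of_nonneg hp.le ENNReal.ofReal_ne_top)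
      (hlim hN₀ N₀ le_rfl))
  refine ⟨u N₀ - y, Metric.tendsto_atTop.2 fun ε hε => ?_⟩
  obtain ⟨N, hN⟩ := Metric.cauchySeq_iff.1 hu (ε / 2) (half_pos hε)
  refine ⟨N, fun n hn => ?_⟩
  have h1 := hlim hN n hn
  have h2 : (fun k => ‖M.val (u n) k - f k‖ₑ ^ p) =
      fun k => ‖M.val (u n - (u N₀ - y)) k‖ₑ ^ p := by
    funext k
    simp [map_sub, hy]
  rw [h2, ← M.enorm_rpow, ENNReal.rpow_le_rpow_iff hp, ← ofReal_norm,
    ENNReal.ofReal_le_ofReal_iff (half_pos hε).le] at h1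
  rw [dist_eq_norm]
  linarith

/-! ### The unit vector basis -/

theorem exists_unit (hp : 0 < p) (i : ℕ) : ∃ x, M.val x = Pi.single i 1 := by
  refine M.exists_val _ ?_
  have : (fun k => ‖(Pi.single i 1 : ℕ → 𝕜) k‖ₑ ^ p) = unitSeq i := by
    funext k
    unfold unitSeq
    by_cases h : k = i
    · subst h; simp
    · simp [h, hp]
  rw [this, gauge_unitSeq]
  exact ENNReal.one_ne_top

/-- The unit vectors of a gauge space. -/
def unit (hp : 0 < p) (i : ℕ) : E := (M.exists_unit hp i).choose

theorem val_unit (hp : 0 < p) (i : ℕ) : M.val (M.unit hp i) = Pi.single i 1 :=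
  (M.exists_unit hp i).choose_spec

/-- The coordinate functionals of a gauge space. -/
def coord (hp : 0 < p) (k : ℕ) : E →L[𝕜] 𝕜 :=
  LinearMap.mkContinuous ((LinearMap.proj k).comp M.val) 1 fun x => by
    simpa using M.norm_val_le hp x k

@[simp]
theorem coord_apply (hp : 0 < p) (k : ℕ) (x : E) : M.coord hp k x = M.val x k := rfl

theorem val_sum_unit (hp : 0 < p) (A : Finset ℕ) (c : ℕ → 𝕜) (k : ℕ) :
    M.val (∑ i ∈ A, c i • M.unit hp i) k = if k ∈ A then c k else 0 := by
  simp only [map_sum, map_smul, val_unit, Finset.sum_apply, Pi.smul_apply, smul_eq_mul,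
    Pi.single_apply, mul_ite, mul_one, mul_zero, Finset.sum_ite_eq]

/-- The unit vector basis of a gauge space. -/
def basis [Successive R] (hp : 0 < p) : SchauderBasis 𝕜 E where
  basis := M.unit hp
  coord := M.coord hp
  ortho i j := by
    rw [coord_apply, val_unit]
    simp [Pi.single_apply]
  expansion x := by
    rw [HasSum, SummationFilter.conditional_filter_eq_map_range, tendsto_map'_iff]
    refine Metric.tendsto_atTop.2 fun ε hε => ?_
    have hδ : 0 < ENNReal.ofReal (ε / 2) ^ p :=
      ENNReal.rpow_pos (ENNReal.ofReal_pos.2 (half_pos hε)) ENNReal.ofReal_ne_top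
    -- The remainder of the expansion is the restriction to a tail, whose gauge tends to `0`.
    obtain ⟨N, hN⟩ := eventually_atTop.1 (eventually_gauge_tail_le (M.gauge_ne_top hp x) hδ)
    refine ⟨N, fun n hn => ?_⟩
    have h1 := M.enorm_rpow (x - ∑ i ∈ Finset.range n, M.val x i • M.unit hp i)
    have h2 : (fun k => ‖M.val (x - ∑ i ∈ Finset.range n, M.val x i • M.unit hp i) k‖ₑ ^ p) =
        (Set.Ici n).indicator fun k => ‖M.val x k‖ₑ ^ p := by
      funext k
      rw [map_sub, Pi.sub_apply, val_sum_unit]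
      by_cases hk : k < n
      · simp [hk, hp]
      · simp [hk, not_lt.1 hk]
    rw [h2] at h1
    have h3 := h1.trans_le (hN n hn)
    rw [ENNReal.rpow_le_rpow_iff hp, ← ofReal_norm,
      ENNReal.ofReal_le_ofReal_iff (half_pos hε).le] at h3
    rw [Function.comp_apply, dist_comm, dist_eq_norm]
    exact h3.trans_lt (half_lt_self hε)

end GaugeSpace

/-! ### Gliding humps -/

section GlidingHump

variable {𝕜 : Type*} [RCLike 𝕜] {E : Type*} [NormedAddCommGroup E] [NormedSpace 𝕜 E]

/-- Every bounded sequence has a subsequence along which all coordinates converge. -/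
theorem exists_subseq_tendsto_proj (b : SchauderBasis 𝕜 E) {x : ℕ → E} {C : ℝ}
    (hx : ∀ n, ‖x n‖ ≤ C) : ∃ φ : ℕ → ℕ, StrictMono φ ∧
      ∀ s, ∃ y, Tendsto (fun n => b.proj s (x (φ n))) atTop (𝓝 y) := by
  have hK : IsCompact (Set.univ.pi fun k => Metric.closedBall (0 : 𝕜) (‖b.coord k‖ * C)) :=
    isCompact_univ_pi fun k => isCompact_closedBall _ _
  obtain ⟨y, -, φ, hφ, h⟩ := hK.tendsto_subseq (x := fun n k => b.coord k (x n)) fun n k _ => by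
    rw [mem_closedBall_zero_iff]
    exact ((b.coord k).le_opNorm _).trans (mul_le_mul_of_nonneg_left (hx n) (norm_nonneg _))
  rw [tendsto_pi_nhds] at h
  refine ⟨φ, hφ, fun s => ⟨∑ k ∈ Finset.range s, y k • b.basis k, ?_⟩⟩
  simp only [SchauderBasis.proj_apply]
  exact tendsto_finsetSum _ fun k _ => (h k).smul_const _

/-- Along a subsequence with convergent coordinates, differences of late terms have negligible
initial projections; by convergence of the expansion they are also negligible beyond a far enough
index. Passing to differences replaces weak nullity. -/
theorem exists_block_differences (b : SchauderBasis 𝕜 E) {x : ℕ → E} {C : ℝ}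
    (hx : ∀ n, ‖x n‖ ≤ C) {θ : ℕ → ℝ} (hθ : ∀ n, 0 < θ n) (s₀ : ℕ) :
    ∃ i j s : ℕ → ℕ, (∀ n, i n < j n ∧ j n < i (n + 1)) ∧ Monotone s ∧ s 0 = s₀ ∧
      ∀ n, ‖x (i n) - x (j n) - (b.proj (s (n + 1)) (x (i n) - x (j n)) -
        b.proj (s n) (x (i n) - x (j n)))‖ ≤ θ n := by
  obtain ⟨φ, hφ, h⟩ := exists_subseq_tendsto_proj b hx
  have hstep : ∀ (N s n : ℕ), ∃ (i j s' : ℕ), N ≤ i ∧ i < j ∧ s ≤ s' ∧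
      ‖x i - x j - (b.proj s' (x i - x j) - b.proj s (x i - x j))‖ ≤ θ n := by
    intro N s n
    obtain ⟨y, hy⟩ := h s
    obtain ⟨n₀, hn₀⟩ := Metric.cauchySeq_iff.1 hy.cauchySeq (θ n / 2) (half_pos (hθ n))
    set i := φ (max n₀ N)
    set j := φ (max n₀ N + 1)
    have h1 : ‖b.proj s (x i - x j)‖ < θ n / 2 := by
      have := hn₀ (max n₀ N) (le_max_left _ _) (max n₀ N + 1) (by omega)
      rwa [dist_eq_norm, ← map_sub] at this
    obtain ⟨s', hs'⟩ := Metric.tendsto_atTop.1 (b.tendsto_proj (x i - x j)) (θ n / 2)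
      (half_pos (hθ n))
    have h2 := hs' (max s s') (le_max_right _ _)
    rw [dist_comm, dist_eq_norm] at h2
    refine ⟨i, j, max s s', (le_max_right n₀ N).trans (hφ.id_le _), hφ (Nat.lt_succ_self _),
      le_max_left _ _, ?_⟩
    have h3 : x i - x j - (b.proj (max s s') (x i - x j) - b.proj s (x i - x j)) =
        (x i - x j - b.proj (max s s') (x i - x j)) + b.proj s (x i - x j) := by abel
    rw [h3]
    exact (norm_add_le _ _).trans (by linarith)
  choose I J S hNI hIJ hsS hest using hstep
  -- The state records the least index still allowed for the next pair and the end point of the last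
  -- block.
  set st : ℕ → ℕ × ℕ := fun n => Nat.rec (0, s₀)
    (fun n q => (J q.1 q.2 n + 1, S q.1 q.2 n)) n with hst
  have hst1 : ∀ n, st (n + 1) = (J (st n).1 (st n).2 n + 1, S (st n).1 (st n).2 n) := fun n => rfl
  refine ⟨fun n => I (st n).1 (st n).2 n, fun n => J (st n).1 (st n).2 n, fun n => (st n).2,
    fun n => ⟨hIJ _ _ _, ?_⟩, monotone_nat_of_le_succ fun n => ?_, rfl, fun n => ?_⟩
  · refine lt_of_lt_of_le ?_ (hNI _ _ _)
    rw [hst1]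
    exact Nat.lt_succ_self _
  · rw [hst1]
    exact hsS _ _ _
  · simp only [hst1]
    exact hest _ _ _

theorem interleaved_lt {i j : ℕ → ℕ} (h : ∀ n, i n < j n ∧ j n < i (n + 1)) {m n : ℕ}
    (hmn : m < n) : j m < i n := by
  have hi : StrictMono i := strictMono_nat_of_lt_succ fun n => (h n).1.trans (h n).2
  exact (h m).2.trans_le (hi.monotone hmn)

theorem interleaved_strictMono {i j : ℕ → ℕ} (h : ∀ n, i n < j n ∧ j n < i (n + 1)) :
    StrictMono i ∧ StrictMono j :=
  ⟨strictMono_nat_of_lt_succ fun n => (h n).1.trans (h n).2,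
    strictMono_nat_of_lt_succ fun n => (h n).2.trans (h (n + 1)).1⟩

theorem interleaved_ne {i j : ℕ → ℕ} (h : ∀ n, i n < j n ∧ j n < i (n + 1)) (m n : ℕ) :
    i m ≠ j n := by
  rcases lt_trichotomy m n with hmn | rfl | hmn
  · exact (((interleaved_strictMono h).1 hmn).trans (h n).1).ne
  · exact (h m).1.ne
  · exact (interleaved_lt h hmn).ne'

theorem sum_geometric_image_le {A : Finset ℕ} {σ : ℕ → ℕ} (hσ : Set.InjOn σ A) {δ : ℝ}
    (hδ : 0 ≤ δ) : ∑ i ∈ A, δ * (1 / 2) ^ σ i ≤ 2 * δ := by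
  rw [← Finset.mul_sum, ← Finset.sum_image hσ (f := fun n => (1 / 2 : ℝ) ^ n)]
  have := sum_le_hasSum (A.image σ) (fun _ _ => by positivity) hasSum_geometric_two
  nlinarith

/-- A small perturbation of a sequence whose coefficients are controlled by the norms of the
linear combinations. -/
theorem perturbation {x u : ℕ → E} {δ : ℝ}
    (hxu : ∀ n, ‖x n - u n‖ ≤ δ / 4 * (1 / 2) ^ n)
    (hcoef : ∀ (A : Finset ℕ) (c : ℕ → 𝕜) (σ : ℕ → ℕ), Set.InjOn σ A → ∀ i ∈ A,
      ‖c i‖ * δ ≤ ‖∑ i ∈ A, c i • u (σ i)‖)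
    (A : Finset ℕ) (c : ℕ → 𝕜) {σ : ℕ → ℕ} (hσ : Set.InjOn σ A) :
    ‖∑ i ∈ A, c i • u (σ i)‖ ≤ 2 * ‖∑ i ∈ A, c i • x (σ i)‖ ∧
      ‖∑ i ∈ A, c i • x (σ i)‖ ≤ 2 * ‖∑ i ∈ A, c i • u (σ i)‖ := by
  -- Each coefficient is at most `m / δ`, so the total perturbation is at most `(m / 4) * ∑ 2⁻ⁿ ≤ m
  -- / 2`.
  have key : ‖∑ i ∈ A, c i • x (σ i) - ∑ i ∈ A, c i • u (σ i)‖ ≤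
      1 / 2 * ‖∑ i ∈ A, c i • u (σ i)‖ := by
    rw [← Finset.sum_sub_distrib]
    set m := ‖∑ i ∈ A, c i • u (σ i)‖ with hm
    calc ‖∑ i ∈ A, (c i • x (σ i) - c i • u (σ i))‖
        ≤ ∑ i ∈ A, ‖c i • x (σ i) - c i • u (σ i)‖ := norm_sum_le _ _
      _ ≤ ∑ i ∈ A, m / 4 * (1 / 2) ^ σ i := by
          refine Finset.sum_le_sum fun i hi => ?_
          rw [← smul_sub, norm_smul]
          calc ‖c i‖ * ‖x (σ i) - u (σ i)‖ ≤ ‖c i‖ * (δ / 4 * (1 / 2) ^ σ i) :=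
                mul_le_mul_of_nonneg_left (hxu _) (norm_nonneg _)
            _ = (‖c i‖ * δ) * (1 / 4 * (1 / 2) ^ σ i) := by ring
            _ ≤ m * (1 / 4 * (1 / 2) ^ σ i) :=
                mul_le_mul_of_nonneg_right (hcoef A c σ hσ i hi) (by positivity)
            _ = _ := by ring
      _ ≤ 2 * (m / 4) := sum_geometric_image_le hσ (by positivity)
      _ = 1 / 2 * m := by ring
  constructor
  · have := norm_sub_norm_le (∑ i ∈ A, c i • u (σ i)) (∑ i ∈ A, c i • x (σ i))
    rw [norm_sub_rev] at this
    linarith [norm_nonneg (∑ i ∈ A, c i • u (σ i))]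
  · have := norm_sub_norm_le (∑ i ∈ A, c i • x (σ i)) (∑ i ∈ A, c i • u (σ i))
    linarith [norm_nonneg (∑ i ∈ A, c i • u (σ i))]

end GlidingHump

/-- At most one term of the sum is non-zero. -/
theorem enorm_sum_rpow {𝕜 : Type*} [RCLike 𝕜] {p : ℝ} (hp : 0 < p) (A : Finset ℕ) (z : ℕ → 𝕜)
    (h : ∀ i ∈ A, ∀ j ∈ A, z i ≠ 0 → z j ≠ 0 → i = j) :
    ‖∑ i ∈ A, z i‖ₑ ^ p = ∑ i ∈ A, ‖z i‖ₑ ^ p := by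
  by_cases h0 : ∃ i ∈ A, z i ≠ 0
  · obtain ⟨i, hi, hzi⟩ := h0
    have hj : ∀ j ∈ A, j ≠ i → z j = 0 := fun j hj hne => by
      by_contra hzj
      exact hne (h j hj i hi hzj hzi)
    rw [Finset.sum_eq_single_of_mem i hi hj, Finset.sum_eq_single_of_mem i hi fun j hjA hne => by
      simp [hj j hjA hne, hp]]
  · push Not at h0
    rw [Finset.sum_eq_zero h0, Finset.sum_eq_zero fun i hi => by simp [h0 i hi, hp]]
    simp [hp]

/-- A scalar whose norm is a given `p`-th root. -/
def rootScalar (𝕜 : Type*) [RCLike 𝕜] (p : ℝ) (t : ℝ≥0) : 𝕜 := ((t ^ p⁻¹ : ℝ≥0) : ℝ)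

theorem enorm_rootScalar (𝕜 : Type*) [RCLike 𝕜] {p : ℝ} (hp : 0 < p) (t : ℝ≥0) :
    ‖rootScalar 𝕜 p t‖ₑ ^ p = t := by
  have h : ‖rootScalar 𝕜 p t‖ₑ = ((t ^ p⁻¹ : ℝ≥0) : ℝ≥0∞) := by
    rw [← ofReal_norm, rootScalar, RCLike.norm_ofReal, abs_of_nonneg (NNReal.coe_nonneg _),
      ENNReal.ofReal_coe_nnreal]
  rw [h, ENNReal.coe_rpow_of_nonneg _ (inv_pos.2 hp).le, ENNReal.rpow_inv_rpow hp.ne']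

theorem enorm_rpow_le_of_norm_le {E F : Type*} [NormedAddCommGroup E] [NormedAddCommGroup F]
    {p : ℝ} (hp : 0 < p) {K : ℝ} (hK : 0 ≤ K) {x : E} {y : F} (h : ‖x‖ ≤ K * ‖y‖) :
    ‖x‖ₑ ^ p ≤ ENNReal.ofReal K ^ p * ‖y‖ₑ ^ p := by
  rw [← ENNReal.mul_rpow_of_nonneg _ _ hp.le]
  refine ENNReal.rpow_le_rpow ?_ hp.le
  rw [← ofReal_norm, ← ofReal_norm, ← ENNReal.ofReal_mul hK]
  exact ENNReal.ofReal_le_ofReal h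

theorem ofReal_rpow_ne_top {p : ℝ} (hp : 0 < p) (K : ℝ) : ENNReal.ofReal K ^ p ≠ ∞ :=
  ENNReal.rpow_ne_top_of_nonneg hp.le ENNReal.ofReal_ne_top

/-! ### Block sequences in gauge spaces -/

namespace GaugeSpace

variable {𝕜 : Type*} [RCLike 𝕜] {R : SelectionRule} {w : Weight} {p : ℝ} {E : Type*}
  [NormedAddCommGroup E] [NormedSpace 𝕜 E] (M : GaugeSpace 𝕜 R w p E)

/-- The sequence of `p`-th powers of the moduli of the coordinates. -/
def modulus (x : E) (k : ℕ) : ℝ≥0∞ := ‖M.val x k‖ₑ ^ p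

theorem enorm_rpow_eq_gauge_modulus (x : E) : ‖x‖ₑ ^ p = R.gauge w (M.modulus x) := M.enorm_rpow x

/-- Disjointly supported vectors: the gauge of linear combinations. -/
theorem enorm_rpow_sum (hp : 0 < p) {u : ℕ → E} {s : ℕ → ℕ} (hu : IsBlock (fun n => M.modulus (u n)) s)
    (A : Finset ℕ) (c : ℕ → 𝕜) {σ : ℕ → ℕ} (hσ : Set.InjOn σ A) :
    ‖∑ i ∈ A, c i • u (σ i)‖ₑ ^ p =
      R.gauge w (fun k => ∑ i ∈ A, ‖c i‖ₑ ^ p * M.modulus (u (σ i)) k) := by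
  rw [M.enorm_rpow]
  refine congrArg _ (funext fun k => ?_)
  simp only [map_sum, map_smul, Finset.sum_apply, Pi.smul_apply, smul_eq_mul]
  rw [enorm_sum_rpow hp]
  · refine Finset.sum_congr rfl fun i _ => ?_
    rw [enorm_mul, ENNReal.mul_rpow_of_nonneg _ _ hp.le]
    rfl
  · intro i hi j hj hzi hzj
    refine hσ hi hj (hu.eq_of_ne_zero (k := k) ?_ ?_)
    · simpa [modulus, hp.le, ENNReal.rpow_eq_zero_iff_of_pos hp] using right_ne_zero_of_mul hzi
    · simpa [modulus, hp.le, ENNReal.rpow_eq_zero_iff_of_pos hp] using right_ne_zero_of_mul hzj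

theorem coef_le_of_block (hp : 0 < p) {u : ℕ → E} {s : ℕ → ℕ}
    (hu : IsBlock (fun n => M.modulus (u n)) s) {δ : ℝ} (hδ : ∀ n, δ ≤ ‖u n‖)
    (A : Finset ℕ) (c : ℕ → 𝕜) (σ : ℕ → ℕ) (hσ : Set.InjOn σ A) (i : ℕ) (hi : i ∈ A) :
    ‖c i‖ * δ ≤ ‖∑ i ∈ A, c i • u (σ i)‖ := by
  have h1 : ‖c i • u (σ i)‖ₑ ^ p ≤ ‖∑ i ∈ A, c i • u (σ i)‖ₑ ^ p := by
    have h2 := M.enorm_rpow_sum hp hu {i} c (σ := σ) (by simp)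
    rw [Finset.sum_singleton] at h2
    rw [h2, M.enorm_rpow_sum hp hu A c hσ]
    exact gauge_mono fun k => Finset.sum_le_sum_of_subset (by simpa using hi)
  rw [ENNReal.rpow_le_rpow_iff hp, enorm_le_iff_norm_le, norm_smul] at h1
  exact (mul_le_mul_of_nonneg_left (hδ _) (norm_nonneg _)).trans h1

theorem val_proj [Successive R] (hp : 0 < p) (s : ℕ) (x : E) (k : ℕ) :
    M.val ((M.basis hp).proj s x) k = if k < s then M.val x k else 0 := by
  rw [SchauderBasis.proj_apply]
  exact (M.val_sum_unit hp (Finset.range s) (M.val x) k).trans (by simp)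

/-- A gliding hump with errors `δ / 8 * 2⁻ⁿ`. The blocks keep norm at least `δ / 2`, so their
coefficients are controlled by disjointness of supports and the perturbation lemma applies. -/
theorem exists_blocks [Successive R] (hp : 0 < p) {x : ℕ → E} {C : ℝ} (hC : ∀ n, ‖x n‖ ≤ C)
    {δ : ℝ} (hδ : 0 < δ) (hx : ∀ m n, m ≠ n → δ ≤ ‖x m - x n‖) :
    ∃ (i j s : ℕ → ℕ) (u : ℕ → E), (∀ n, i n < j n ∧ j n < i (n + 1)) ∧
      IsBlock (fun n => M.modulus (u n)) s ∧ (∀ n, ‖u n‖ ≤ 2 * C + δ) ∧ (∀ n, δ / 2 ≤ ‖u n‖) ∧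
      ∀ (A : Finset ℕ) (c : ℕ → 𝕜) (σ : ℕ → ℕ), Set.InjOn σ A →
        ‖∑ k ∈ A, c k • u (σ k)‖ ≤ 2 * ‖∑ k ∈ A, c k • (x (i (σ k)) - x (j (σ k)))‖ ∧
        ‖∑ k ∈ A, c k • (x (i (σ k)) - x (j (σ k)))‖ ≤ 2 * ‖∑ k ∈ A, c k • u (σ k)‖ := by
  obtain ⟨i, j, s, hij, hs, -, hest⟩ := exists_block_differences (M.basis hp) hC
    (θ := fun n => δ / 2 / 4 * (1 / 2) ^ n) (fun n => by positivity) 0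
  set d : ℕ → E := fun n => x (i n) - x (j n) with hd
  set u : ℕ → E := fun n => (M.basis hp).proj (s (n + 1)) (d n) - (M.basis hp).proj (s n) (d n)
    with hu
  have hθ : ∀ n, δ / 2 / 4 * (1 / 2 : ℝ) ^ n ≤ δ / 8 := fun n => by
    have : (1 / 2 : ℝ) ^ n ≤ 1 := pow_le_one₀ (by norm_num) (by norm_num)
    nlinarith
  have hblock : IsBlock (fun n => M.modulus (u n)) s := by
    refine ⟨hs, fun n k hk => ?_⟩
    have h1 : M.val (u n) k ≠ 0 := fun h0 => hk (by simp [modulus, h0, hp])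
    rw [hu] at h1
    simp only [map_sub, Pi.sub_apply, val_proj] at h1
    have := hs (Nat.le_succ n)
    simp only [Nat.succ_eq_add_one] at this
    by_contra hcon
    rw [not_and_or] at hcon
    rcases hcon with hcon | hcon
    · rw [if_pos (by omega), if_pos (by omega)] at h1
      simp at h1
    · rw [if_neg (by omega), if_neg (by omega)] at h1
      simp at h1
  have hlow : ∀ n, δ / 2 ≤ ‖u n‖ := fun n => by
    have h1 := hx (i n) (j n) (hij n).1.ne
    have h2 := norm_sub_norm_le (d n) (u n)
    have h3 := hest n
    have h4 := hθ n
    linarith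
  refine ⟨i, j, s, u, hij, hblock, fun n => ?_, hlow, fun A c σ hσ => ?_⟩
  · have h1 : ‖d n‖ ≤ C + C := (norm_sub_le _ _).trans (add_le_add (hC _) (hC _))
    have h2 := norm_sub_norm_le (u n) (d n)
    rw [norm_sub_rev (u n) (d n)] at h2
    have h3 := hest n
    have h4 := hθ n
    linarith
  · exact perturbation (x := d) hest
      (fun A c σ hσ => M.coef_le_of_block hp hblock hlow A c σ hσ) A c hσ

end GaugeSpace

/-! ### Symmetric sequences in Garling spaces -/

section Symmetric

variable {𝕜 : Type*} [RCLike 𝕜] {w : Weight} {p : ℝ} {E : Type*}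
  [NormedAddCommGroup E] [NormedSpace 𝕜 E]

/-- A sequence is symmetric with constant `K` if the norms of its linear combinations change
by a factor of at most `K` when the vectors are exchanged for others of the same sequence. -/
def SymmetricWith (𝕜 : Type*) [RCLike 𝕜] [NormedSpace 𝕜 E] (K : ℝ) (x : ℕ → E) : Prop :=
  ∀ (N : ℕ) (c : ℕ → 𝕜) (σ τ : ℕ → ℕ), Set.InjOn σ (Finset.range N) →
    Set.InjOn τ (Finset.range N) →
    ‖∑ k ∈ Finset.range N, c k • x (σ k)‖ ≤ K * ‖∑ k ∈ Finset.range N, c k • x (τ k)‖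

/-- The juxtaposition of two finite sequences of indices. -/
def juxtapose {α : Type*} (N : ℕ) (f g : ℕ → α) (k : ℕ) : α := if k < N then f k else g (k - N)

theorem juxtapose_injOn {N : ℕ} {f g : ℕ → ℕ} (hf : Set.InjOn f (Finset.range N))
    (hg : Set.InjOn g (Finset.range N)) (hfg : ∀ k < N, ∀ l < N, f k ≠ g l) :
    Set.InjOn (juxtapose N f g) (Finset.range (N + N)) := by
  intro k hk l hl h
  simp only [Finset.coe_range, Set.mem_Iio] at hk hl
  unfold juxtapose at h
  split_ifs at h with h1 h2 h2
  · exact hf (by simpa using h1) (by simpa using h2) h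
  · exact absurd h (hfg k h1 _ (by omega))
  · exact absurd h.symm (hfg l h2 _ (by omega))
  · have := hg (by simp; omega) (by simp; omega) h
    omega

theorem sum_juxtapose (x : ℕ → E) (N : ℕ) (c : ℕ → 𝕜) (f g : ℕ → ℕ) :
    ∑ k ∈ Finset.range (N + N), juxtapose N c (fun k => -c k) k • x (juxtapose N f g k) =
      ∑ k ∈ Finset.range N, c k • (x (f k) - x (g k)) := by
  rw [Finset.sum_range_add, ← Finset.sum_add_distrib]
  refine Finset.sum_congr rfl fun k hk => ?_
  rw [Finset.mem_range] at hk
  simp [juxtapose, hk, sub_eq_add_neg]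

/-- A combination of `N` differences of distinct vectors is a combination of `2 * N` vectors with
coefficients `c` and `-c`, so symmetry applies to it directly. -/
theorem SymmetricWith.differences {K : ℝ} {x : ℕ → E} (h : SymmetricWith 𝕜 K x) (N : ℕ)
    (c : ℕ → 𝕜) {f g f' g' : ℕ → ℕ} (hf : Set.InjOn f (Finset.range N))
    (hg : Set.InjOn g (Finset.range N)) (hfg : ∀ k < N, ∀ l < N, f k ≠ g l)
    (hf' : Set.InjOn f' (Finset.range N)) (hg' : Set.InjOn g' (Finset.range N))
    (hfg' : ∀ k < N, ∀ l < N, f' k ≠ g' l) :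
    ‖∑ k ∈ Finset.range N, c k • (x (f k) - x (g k))‖ ≤
      K * ‖∑ k ∈ Finset.range N, c k • (x (f' k) - x (g' k))‖ := by
  rw [← sum_juxtapose, ← sum_juxtapose x N c f' g']
  exact h (N + N) _ _ _ (juxtapose_injOn hf hg hfg) (juxtapose_injOn hf' hg' hfg')

/-- Every bounded separated symmetric sequence of a Garling space satisfies `ℓ_p` estimates. -/
theorem SymmetricWith.estimates (M : GaugeSpace 𝕜 increasing w p E) (hp : 0 < p) {K : ℝ}
    (hK : 0 ≤ K) {x : ℕ → E} (h : SymmetricWith 𝕜 K x) {C : ℝ} (hC : ∀ n, ‖x n‖ ≤ C) {δ : ℝ}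
    (hδ : 0 < δ) (hx : ∀ m n, m ≠ n → δ ≤ ‖x m - x n‖) :
    ∃ η L : ℝ≥0∞, 0 < η ∧ L ≠ ∞ ∧
      (∀ (N : ℕ) (c : ℕ → 𝕜), η * ∑ k ∈ Finset.range N, ‖c k‖ₑ ^ p ≤
        ‖∑ k ∈ Finset.range N, c k • x k‖ₑ ^ p) ∧
      ∀ (N : ℕ) (c : ℕ → 𝕜), ‖∑ k ∈ Finset.range N, c k • (x k - x (N + k))‖ₑ ^ p ≤
        L * ∑ k ∈ Finset.range N, ‖c k‖ₑ ^ p := by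
  obtain ⟨i, j, s, u, hij, hblock, hub, hlb, hequiv⟩ := M.exists_blocks hp hC hδ hx
  have hi := (interleaved_strictMono hij).1.injective
  have hj := (interleaved_strictMono hij).2.injective
  set B : ℝ≥0∞ := ENNReal.ofReal (2 * C + δ) ^ p with hB
  have hBtop : B ≠ ∞ := ofReal_rpow_ne_top hp _
  have huB : ∀ n, increasing.gauge w (M.modulus (u n)) ≤ B := fun n => by
    rw [← M.enorm_rpow_eq_gauge_modulus, ← ofReal_norm]
    exact ENNReal.rpow_le_rpow (ENNReal.ofReal_le_ofReal (hub n)) hp.le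
  have hulow : ∀ n, ENNReal.ofReal (δ / 2) ^ p ≤ increasing.gauge w (M.modulus (u n)) := fun n => by
    rw [← M.enorm_rpow_eq_gauge_modulus, ← ofReal_norm]
    exact ENNReal.rpow_le_rpow (ENNReal.ofReal_le_ofReal (hlb n)) hp.le
  have hσij : ∀ {σ : ℕ → ℕ} {N : ℕ}, Set.InjOn σ (Finset.range N) →
      Set.InjOn (fun k => i (σ k)) (Finset.range N) ∧
      Set.InjOn (fun k => j (σ k)) (Finset.range N) := fun hσ =>
    ⟨hi.injOn.comp hσ (Set.mapsTo_univ _ _), hj.injOn.comp hσ (Set.mapsTo_univ _ _)⟩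
  have hsymd : ∀ (N : ℕ) (c : ℕ → 𝕜) (σ τ : ℕ → ℕ), Set.InjOn σ (Finset.range N) →
      Set.InjOn τ (Finset.range N) →
      ‖∑ k ∈ Finset.range N, c k • u (σ k)‖ ≤
        4 * K * ‖∑ k ∈ Finset.range N, c k • u (τ k)‖ := by
    intro N c σ τ hσ hτ
    have h1 := (hequiv (Finset.range N) c σ hσ).1
    have h2 := h.differences N c (hσij hσ).1 (hσij hσ).2 (fun _ _ _ _ => interleaved_ne hij _ _)
      (hσij hτ).1 (hσij hτ).2 (fun _ _ _ _ => interleaved_ne hij _ _)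
    have h3 := (hequiv (Finset.range N) c τ hτ).2
    have h4 := mul_le_mul_of_nonneg_left h3 hK
    linarith
  obtain ⟨η, hη, hlow⟩ := hblock.lower_estimate_of_symmetric (w := w) hBtop huB
    (ENNReal.rpow_pos (ENNReal.ofReal_pos.2 (half_pos hδ)) ENNReal.ofReal_ne_top) hulow
    (ofReal_rpow_ne_top hp (4 * K)) (by
      intro t N σ τ hσ hτ
      have h1 := enorm_rpow_le_of_norm_le hp (by positivity)
        (hsymd N (fun k => rootScalar 𝕜 p (t k)) σ τ hσ hτ)
      rw [M.enorm_rpow_sum hp hblock _ _ hσ, M.enorm_rpow_sum hp hblock _ _ hτ] at h1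
      simpa only [enorm_rootScalar 𝕜 hp] using h1)
  have hlow' : ∀ (N : ℕ) (c : ℕ → 𝕜), η * ∑ k ∈ Finset.range N, ‖c k‖ₑ ^ p ≤
      ‖∑ k ∈ Finset.range N, c k • u k‖ₑ ^ p := by
    intro N c
    have h1 := hlow (fun k => ‖c k‖₊ ^ p) N
    have h2 := M.enorm_rpow_sum hp hblock (Finset.range N) c (σ := id) Function.injective_id.injOn
    simp only [id_eq] at h2
    rw [h2]
    simpa only [ENNReal.coe_rpow_of_nonneg _ hp.le, ← enorm_eq_nnnorm] using h1
  have hid : ∀ N, Set.InjOn (id : ℕ → ℕ) (Finset.range N) := fun N => Function.injective_id.injOn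
  set Q : ℝ≥0∞ := ENNReal.ofReal (4 * K) ^ p with hQ
  have hQtop : Q ≠ ∞ := ofReal_rpow_ne_top hp _
  refine ⟨η / (Q + 1), ENNReal.ofReal (2 * K) ^ p * B,
    ENNReal.div_pos hη.ne' (ENNReal.add_ne_top.2 ⟨hQtop, by simp⟩),
    ENNReal.mul_ne_top (ofReal_rpow_ne_top hp _) hBtop, fun N c => ?_, fun N c => ?_⟩
  -- The blocks are equivalent to differences of terms of the sequence, and by symmetry a
  -- combination of differences is at most `2 * K` times the combination of the `x k`.
  · refine div_mul_le_of_mul_le ((hlow' N c).trans ?_)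
    refine le_trans ?_ (mul_le_mul_left (le_self_add (a := Q) (b := 1)) _)
    refine enorm_rpow_le_of_norm_le hp (by positivity) ?_
    have h1 := (hequiv (Finset.range N) c id (hid N)).1
    simp only [id_eq, smul_sub, Finset.sum_sub_distrib] at h1
    have h2 := h N c i id hi.injOn (hid N)
    have h3 := h N c j id hj.injOn (hid N)
    simp only [id_eq] at h2 h3
    have h4 := norm_sub_le (∑ k ∈ Finset.range N, c k • x (i k)) (∑ k ∈ Finset.range N, c k • x (j k))
    linarith
  -- By symmetry these differences can be exchanged for those close to the blocks, whose disjoint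
  -- supports and subadditive gauge give the upper estimate. The second halves have indices from `N`
  -- on, so that a basis projection can later remove them.
  · have h1 := h.differences N c (f := id) (g := fun k => N + k) (f' := i) (g' := j) (hid N)
      (fun a _ b _ hab => by simpa using hab) (fun k hk l hl => by simp only [id_eq]; omega)
      hi.injOn hj.injOn (fun _ _ _ _ => interleaved_ne hij _ _)
    have h2 := (hequiv (Finset.range N) c id (hid N)).2
    simp only [id_eq] at h1 h2
    have h3 : ‖∑ k ∈ Finset.range N, c k • (x k - x (N + k))‖ ≤
        2 * K * ‖∑ k ∈ Finset.range N, c k • u k‖ := by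
      have := mul_le_mul_of_nonneg_left h2 hK
      linarith
    refine (enorm_rpow_le_of_norm_le hp (by positivity) h3).trans ?_
    rw [mul_assoc]
    refine mul_le_mul_right ?_ _
    have h4 := M.enorm_rpow_sum hp hblock (Finset.range N) c (σ := id) (hid N)
    simp only [id_eq] at h4
    rw [h4, Finset.mul_sum]
    refine (gauge_sum_le _ _).trans (Finset.sum_le_sum fun k _ => ?_)
    rw [gauge_mul, mul_comm]
    exact mul_le_mul_left (huB k) _

end Symmetric

/-! ### Transport of selections -/

namespace SelectionRule

variable {R : SelectionRule} {w : Weight}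

/-- Positions are carried along `ψ`: each selection for `a` becomes a selection for `b` with the
same positions and larger values. -/
theorem gauge_le_of_transport {a b : ℕ → ℝ≥0∞} {A : Set ℕ} (ha : ∀ k ∉ A, a k = 0) {ψ : ℕ → ℕ}
    (hψ : Set.InjOn ψ A) (hab : ∀ k ∈ A, a k ≤ b (ψ k))
    (hadm : ∀ (S : Finset ℕ) r, (S : Set ℕ) ⊆ A → R.Adm S r →
      R.Adm (S.image ψ) (r ∘ Function.invFunOn ψ A)) : R.gauge w a ≤ R.gauge w b := by
  classical
  refine gauge_le fun S r hr => ?_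
  set S' := S.filter fun k => a k ≠ 0 with hS'
  have hS'A : (S' : Set ℕ) ⊆ A := fun k hk => by
    by_contra h
    exact (Finset.mem_filter.1 hk).2 (ha k h)
  have hadm' := hadm S' r hS'A (R.subset hr (Finset.filter_subset _ _))
  calc selSum w a S r = selSum w a S' r :=
        (Finset.sum_filter_of_ne fun k _ hk => by intro h; simp [h] at hk).symm
    _ ≤ selSum w b (S'.image ψ) (r ∘ Function.invFunOn ψ A) := by
        rw [selSum, selSum, Finset.sum_image (hψ.mono hS'A)]
        refine Finset.sum_le_sum fun k hk => ?_
        rw [Function.comp_apply, hψ.leftInvOn_invFunOn (hS'A hk)]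
        exact mul_le_mul_left (hab k (hS'A hk)) _
    _ ≤ R.gauge w b := selSum_le_gauge hadm' b

theorem gauge_injective_le_of_injOn {a b : ℕ → ℝ≥0∞} {A : Set ℕ} (ha : ∀ k ∉ A, a k = 0)
    {ψ : ℕ → ℕ} (hψ : Set.InjOn ψ A) (hab : ∀ k ∈ A, a k ≤ b (ψ k)) :
    injective.gauge w a ≤ injective.gauge w b := by
  refine gauge_le_of_transport ha hψ hab fun S r hS hr x hx y hy hxy => ?_
  obtain ⟨i, hi, rfl⟩ := Finset.mem_image.1 (Finset.mem_coe.1 hx)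
  obtain ⟨j, hj, rfl⟩ := Finset.mem_image.1 (Finset.mem_coe.1 hy)
  rw [Function.comp_apply, Function.comp_apply, hψ.leftInvOn_invFunOn (hS hi),
    hψ.leftInvOn_invFunOn (hS hj)] at hxy
  rw [hr hi hj hxy]

theorem gauge_increasing_le_of_strictMonoOn {a b : ℕ → ℝ≥0∞} {A : Set ℕ} (ha : ∀ k ∉ A, a k = 0)
    {ψ : ℕ → ℕ} (hψ : StrictMonoOn ψ A) (hab : ∀ k ∈ A, a k ≤ b (ψ k)) :
    increasing.gauge w a ≤ increasing.gauge w b := by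
  refine gauge_le_of_transport ha hψ.injOn hab fun S r hS hr x hx y hy hxy => ?_
  obtain ⟨i, hi, rfl⟩ := Finset.mem_image.1 (Finset.mem_coe.1 hx)
  obtain ⟨j, hj, rfl⟩ := Finset.mem_image.1 (Finset.mem_coe.1 hy)
  rw [Function.comp_apply, Function.comp_apply, hψ.injOn.leftInvOn_invFunOn (hS hi),
    hψ.injOn.leftInvOn_invFunOn (hS hj)]
  exact hr hi hj ((hψ.lt_iff_lt (hS hi) (hS hj)).1 hxy)

theorem sum_unitSeq_apply {N : ℕ} {σ : ℕ → ℕ} (hσ : Set.InjOn σ (Finset.range N)) (t : ℕ → ℝ≥0∞)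
    {i : ℕ} (hi : i ∈ Finset.range N) :
    ∑ j ∈ Finset.range N, t j * unitSeq (σ j) (σ i) = t i := by
  rw [Finset.sum_eq_single_of_mem i hi fun j hj hne => ?_]
  · simp [unitSeq]
  · rw [unitSeq, if_neg fun h => hne (hσ hi hj h).symm, mul_zero]

theorem sum_unitSeq_eq_zero {N : ℕ} {σ : ℕ → ℕ} (t : ℕ → ℝ≥0∞) {k : ℕ}
    (hk : k ∉ σ '' Finset.range N) : ∑ j ∈ Finset.range N, t j * unitSeq (σ j) k = 0 :=
  Finset.sum_eq_zero fun j hj => by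
    rw [unitSeq, if_neg fun h => hk ⟨j, hj, h.symm⟩, mul_zero]

/-- The unit vectors are symmetric for the rule of Lorentz spaces. -/
theorem gauge_injective_sum_unitSeq_le {N : ℕ} {σ τ : ℕ → ℕ} (hσ : Set.InjOn σ (Finset.range N))
    (hτ : Set.InjOn τ (Finset.range N)) (t : ℕ → ℝ≥0∞) :
    injective.gauge w (fun k => ∑ j ∈ Finset.range N, t j * unitSeq (σ j) k) ≤
      injective.gauge w (fun k => ∑ j ∈ Finset.range N, t j * unitSeq (τ j) k) := by
  refine gauge_injective_le_of_injOn (A := σ '' Finset.range N)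
    (ψ := τ ∘ Function.invFunOn σ (Finset.range N)) (fun k hk => sum_unitSeq_eq_zero t hk) ?_ ?_
  · rintro _ ⟨i, hi, rfl⟩ _ ⟨j, hj, rfl⟩ h
    rw [Function.comp_apply, Function.comp_apply, hσ.leftInvOn_invFunOn hi,
      hσ.leftInvOn_invFunOn hj] at h
    rw [hτ hi hj h]
  · rintro _ ⟨i, hi, rfl⟩
    rw [Function.comp_apply, hσ.leftInvOn_invFunOn hi, sum_unitSeq_apply hσ t hi,
      sum_unitSeq_apply hτ t hi]

/-- The unit vectors can be pulled together for the rule of Garling spaces. -/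
theorem gauge_increasing_sum_unitSeq_le (N : ℕ) {i : ℕ → ℕ} (hi : StrictMono i) (t : ℕ → ℝ≥0∞) :
    increasing.gauge w (fun k => ∑ j ∈ Finset.range N, t j * unitSeq (i j) k) ≤
      increasing.gauge w (fun k => ∑ j ∈ Finset.range N, t j * unitSeq j k) := by
  have hinj : Set.InjOn i (Finset.range N) := hi.injective.injOn
  refine gauge_increasing_le_of_strictMonoOn (A := i '' Finset.range N)
    (ψ := Function.invFunOn i (Finset.range N)) (fun k hk => sum_unitSeq_eq_zero t hk) ?_ ?_
  · rintro _ ⟨k, hk, rfl⟩ _ ⟨l, hl, rfl⟩ h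
    rw [hinj.leftInvOn_invFunOn hk, hinj.leftInvOn_invFunOn hl]
    exact hi.lt_iff_lt.1 h
  · rintro _ ⟨k, hk, rfl⟩
    have := sum_unitSeq_apply (σ := id) (N := N) Function.injective_id.injOn t (i := k) hk
    simp only [id_eq] at this
    rw [hinj.leftInvOn_invFunOn hk, sum_unitSeq_apply hinj t hk, this]

end SelectionRule

/-! ### Norms of combinations of unit vectors -/

namespace GaugeSpace

variable {𝕜 : Type*} [RCLike 𝕜] {R : SelectionRule} {w : Weight} {p : ℝ} {E : Type*}
  [NormedAddCommGroup E] [NormedSpace 𝕜 E] (M : GaugeSpace 𝕜 R w p E)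

theorem modulus_unit (hp : 0 < p) (i : ℕ) : M.modulus (M.unit hp i) = unitSeq i := by
  funext k
  rw [modulus, val_unit, unitSeq]
  by_cases h : k = i
  · subst h; simp
  · simp [h, hp]

theorem enorm_rpow_sum_unit (hp : 0 < p) (A : Finset ℕ) (c : ℕ → 𝕜) {σ : ℕ → ℕ}
    (hσ : Set.InjOn σ A) : ‖∑ i ∈ A, c i • M.unit hp (σ i)‖ₑ ^ p =
      R.gauge w (fun k => ∑ i ∈ A, ‖c i‖ₑ ^ p * unitSeq (σ i) k) := by
  have hb : IsBlock (fun n => M.modulus (M.unit hp n)) id := by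
    simp only [modulus_unit]
    exact isBlock_unitSeq
  rw [M.enorm_rpow_sum hp hb A c hσ]
  simp only [modulus_unit]

theorem norm_unit (hp : 0 < p) (i : ℕ) : ‖M.unit hp i‖ = 1 := by
  have h : ‖M.unit hp i‖ₑ ^ p = 1 := by
    rw [M.enorm_rpow_eq_gauge_modulus, modulus_unit, gauge_unitSeq]
  have h2 : ‖M.unit hp i‖ₑ = 1 := by
    have := congrArg (fun z => z ^ p⁻¹) h
    simpa [ENNReal.rpow_rpow_inv hp.ne'] using this
  rw [← toReal_enorm, h2, ENNReal.toReal_one]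

theorem one_le_norm_unit_sub (hp : 0 < p) {i j : ℕ} (h : i ≠ j) :
    1 ≤ ‖M.unit hp i - M.unit hp j‖ := by
  have := M.norm_val_le hp (M.unit hp i - M.unit hp j) i
  simpa [map_sub, val_unit, h] using this

theorem enorm_rpow_sum_range_unit (hp : 0 < p) (N : ℕ) {σ : ℕ → ℕ}
    (hσ : Function.Injective σ) :
    ‖∑ i ∈ Finset.range N, M.unit hp (σ i)‖ₑ ^ p = w.partialSum N := by
  have h := M.enorm_rpow_sum_unit hp (Finset.range N) (fun _ => 1) (σ := σ) hσ.injOn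
  simp only [one_smul, enorm_one, ENNReal.one_rpow, one_mul] at h
  have h2 := gauge_sum_unitSeq (R := R) (w := w) ((Finset.range N).image σ)
  rw [Finset.card_image_of_injective _ hσ, Finset.card_range] at h2
  rw [h, ← h2]
  exact congrArg _ (funext fun k => (Finset.sum_image hσ.injOn (f := fun i => unitSeq i k)).symm)

end GaugeSpace

/-- The averages of the weight tend to `0`. All contradictions with `ℓ_p` behaviour end here. -/
theorem not_lower_estimate_partialSum (w : Weight) {η L : ℝ≥0∞} (hη : 0 < η) (hL : L ≠ ∞)
    (h : ∀ n : ℕ, 0 < n → η * n ≤ L * w.partialSum n) : False := by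
  have hL' : L + 1 ≠ ∞ := ENNReal.add_ne_top.2 ⟨hL, by simp⟩
  obtain ⟨n, hn0, hn⟩ := w.exists_partialSum_lt (ENNReal.div_pos hη.ne' hL')
  exact absurd hn (not_lt.2 (div_mul_le_of_mul_le
    ((h n hn0).trans (mul_le_mul_left le_self_add _))))

/-! ### Lorentz and Garling spaces do not embed in each other -/

section Embeddings

variable {𝕜 : Type*} [RCLike 𝕜] {w : Weight} {p : ℝ} {D G : Type*}
  [NormedAddCommGroup D] [NormedSpace 𝕜 D] [NormedAddCommGroup G] [NormedSpace 𝕜 G]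

theorem map_sum_smul (Φ : D →L[𝕜] G) (A : Finset ℕ) (c : ℕ → 𝕜) (x : ℕ → D) :
    ∑ k ∈ A, c k • Φ (x k) = Φ (∑ k ∈ A, c k • x k) := by simp

/-- Lorentz spaces do not embed into the corresponding Garling spaces. -/
theorem not_embedding_lorentz_garling (MD : GaugeSpace 𝕜 injective w p D)
    (MG : GaugeSpace 𝕜 increasing w p G) (hp : 0 < p) (Φ : D →L[𝕜] G) {K : ℝ}
    (hΦ : ∀ y, ‖y‖ ≤ K * ‖Φ y‖) : False := by
  have hK : 0 < K := by
    by_contra hK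
    have h1 := hΦ (MD.unit hp 0)
    rw [MD.norm_unit] at h1
    nlinarith [norm_nonneg (Φ (MD.unit hp 0))]
  have hsymD : ∀ (N : ℕ) (c : ℕ → 𝕜) (σ τ : ℕ → ℕ), Set.InjOn σ (Finset.range N) →
      Set.InjOn τ (Finset.range N) → ‖∑ k ∈ Finset.range N, c k • MD.unit hp (σ k)‖ ≤
        ‖∑ k ∈ Finset.range N, c k • MD.unit hp (τ k)‖ := by
    intro N c σ τ hσ hτ
    rw [← enorm_le_iff_norm_le, ← ENNReal.rpow_le_rpow_iff hp, MD.enorm_rpow_sum_unit hp _ c hσ,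
      MD.enorm_rpow_sum_unit hp _ c hτ]
    exact gauge_injective_sum_unitSeq_le hσ hτ _
  -- An embedding carries the symmetry of the unit vectors of the Lorentz space to a bounded
  -- separated sequence of the Garling space.
  have hsym : SymmetricWith 𝕜 (‖Φ‖ * K) (fun n => Φ (MD.unit hp n)) := by
    intro N c σ τ hσ hτ
    rw [map_sum_smul Φ _ c (fun k => MD.unit hp (σ k)), map_sum_smul Φ _ c fun k => MD.unit hp (τ k)]
    refine (Φ.le_opNorm _).trans ?_
    rw [mul_assoc]
    exact mul_le_mul_of_nonneg_left ((hsymD N c σ τ hσ hτ).trans (hΦ _)) (norm_nonneg _)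
  obtain ⟨η, L, hη, -, hlow, -⟩ := hsym.estimates MG hp (by positivity) (C := ‖Φ‖)
    (fun n => by simpa [MD.norm_unit] using Φ.le_opNorm (MD.unit hp n))
    (δ := K⁻¹) (inv_pos.2 hK) (fun m n hmn => by
      have h1 := (MD.one_le_norm_unit_sub hp hmn).trans (hΦ _)
      rw [map_sub] at h1
      rwa [inv_le_iff_one_le_mul₀' hK])
  refine not_lower_estimate_partialSum w hη (ofReal_rpow_ne_top hp ‖Φ‖) fun n _ => ?_
  have h1 := hlow n (fun _ => 1)
  simp only [enorm_one, ENNReal.one_rpow, Finset.sum_const, Finset.card_range, nsmul_eq_mul,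
    mul_one, one_smul] at h1
  refine h1.trans ?_
  rw [← map_sum, ← MD.enorm_rpow_sum_range_unit hp n Function.injective_id]
  exact enorm_rpow_le_of_norm_le hp (norm_nonneg _) (Φ.le_opNorm _)

/-- Garling spaces do not embed into the corresponding Lorentz spaces. -/
theorem not_embedding_garling_lorentz (MG : GaugeSpace 𝕜 increasing w p G)
    (MD : GaugeSpace 𝕜 injective w p D) (hp : 0 < p) (Ψ : G →L[𝕜] D) {K : ℝ}
    (hΨ : ∀ y, ‖y‖ ≤ K * ‖Ψ y‖) : False := by
  have hK : 0 < K := by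
    by_contra hK
    have h1 := hΨ (MG.unit hp 0)
    rw [MG.norm_unit] at h1
    nlinarith [norm_nonneg (Ψ (MG.unit hp 0))]
  obtain ⟨i, j, s, u, hij, hblock, hub, -, hequiv⟩ := MD.exists_blocks hp
    (x := fun n => Ψ (MG.unit hp n)) (C := ‖Ψ‖)
    (fun n => by simpa [MG.norm_unit] using Ψ.le_opNorm (MG.unit hp n))
    (δ := K⁻¹) (inv_pos.2 hK) (fun m n hmn => by
      have h1 := (MG.one_le_norm_unit_sub hp hmn).trans (hΨ _)
      rw [map_sub] at h1
      rwa [inv_le_iff_one_le_mul₀' hK])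
  obtain ⟨hi, hj⟩ := interleaved_strictMono hij
  have hid : ∀ N, Set.InjOn (id : ℕ → ℕ) (Finset.range N) := fun N => Function.injective_id.injOn
  have hnorm : ∀ (N : ℕ) (c : ℕ → 𝕜), ‖∑ k ∈ Finset.range N, c k • MG.unit hp k‖ₑ ^ p =
      increasing.gauge w (fun k => ∑ j ∈ Finset.range N, ‖c j‖ₑ ^ p * unitSeq j k) := fun N c =>
    MG.enorm_rpow_sum_unit hp (Finset.range N) c (σ := id) (hid N)
  -- Together with `hlower`, this makes the differences `e (i k) - e (j k)` equivalent to the unit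
  -- vectors themselves, although the images are close to blocks only after taking differences.
  have hspread : ∀ (N : ℕ) (c : ℕ → 𝕜) {f : ℕ → ℕ}, StrictMono f →
      ‖∑ k ∈ Finset.range N, c k • MG.unit hp (f k)‖ ≤ ‖∑ k ∈ Finset.range N, c k • MG.unit hp k‖ := by
    intro N c f hf
    rw [← enorm_le_iff_norm_le, ← ENNReal.rpow_le_rpow_iff hp, hnorm,
      MG.enorm_rpow_sum_unit hp _ c hf.injective.injOn]
    exact gauge_increasing_sum_unitSeq_le N hf _
  have hupper : ∀ (N : ℕ) (c : ℕ → 𝕜),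
      ‖∑ k ∈ Finset.range N, c k • (MG.unit hp (i k) - MG.unit hp (j k))‖ ≤
        2 * ‖∑ k ∈ Finset.range N, c k • MG.unit hp k‖ := by
    intro N c
    simp only [smul_sub, Finset.sum_sub_distrib]
    have h1 := hspread N c hi
    have h2 := hspread N c hj
    have h3 := norm_sub_le (∑ k ∈ Finset.range N, c k • MG.unit hp (i k))
      (∑ k ∈ Finset.range N, c k • MG.unit hp (j k))
    linarith
  have hlower : ∀ (N : ℕ) (c : ℕ → 𝕜), ‖∑ k ∈ Finset.range N, c k • MG.unit hp k‖ ≤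
      ‖∑ k ∈ Finset.range N, c k • (MG.unit hp (i k) - MG.unit hp (j k))‖ := by
    intro N c
    -- The coefficient `c k` reappears at coordinate `i k`, since no `j l` equals `i k`, and `i` is
    -- increasing.
    rw [← enorm_le_iff_norm_le, ← ENNReal.rpow_le_rpow_iff hp, hnorm, MG.enorm_rpow]
    refine gauge_increasing_le_of_strictMonoOn (A := Finset.range N) (ψ := i) (fun k hk => ?_)
      (hi.strictMonoOn _) fun k hk => ?_
    · have := sum_unitSeq_eq_zero (σ := id) (N := N) (fun j => ‖c j‖ₑ ^ p) (k := k) (by simpa using hk)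
      simpa using this
    · have h1 := sum_unitSeq_apply (hid N) (fun j => ‖c j‖ₑ ^ p) (Finset.mem_coe.1 hk)
      simp only [id_eq] at h1
      rw [h1]
      refine le_of_eq ?_
      simp only [map_sum, map_smul, map_sub, GaugeSpace.val_unit, Finset.sum_apply, Pi.smul_apply,
        Pi.sub_apply, smul_eq_mul]
      rw [Finset.sum_eq_single_of_mem k (Finset.mem_coe.1 hk) fun l _ hlk => ?_]
      · simp [interleaved_ne hij k k]
      · simp [hi.injective.ne hlk.symm, interleaved_ne hij k l]
  have hdiff : ∀ (N : ℕ) (c : ℕ → 𝕜), ∑ k ∈ Finset.range N,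
      c k • (Ψ (MG.unit hp (i k)) - Ψ (MG.unit hp (j k))) =
        Ψ (∑ k ∈ Finset.range N, c k • (MG.unit hp (i k) - MG.unit hp (j k))) := fun N c => by
    simp
  set Q := ENNReal.ofReal (2 * K) ^ p + ENNReal.ofReal (4 * ‖Ψ‖) ^ p with hQ
  refine hblock.not_equivalent (w := w) (C := ENNReal.ofReal (2 * ‖Ψ‖ + K⁻¹) ^ p)
    (ofReal_rpow_ne_top hp _) (fun n => ?_) (K := Q)
    (ENNReal.add_ne_top.2 ⟨ofReal_rpow_ne_top hp _, ofReal_rpow_ne_top hp _⟩) (fun t N => ?_)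
    fun t N => ?_
  · rw [← MD.enorm_rpow_eq_gauge_modulus, ← ofReal_norm]
    exact ENNReal.rpow_le_rpow (ENNReal.ofReal_le_ofReal (hub n)) hp.le
  · set c : ℕ → 𝕜 := fun k => rootScalar 𝕜 p (t k) with hc
    have h1 := hnorm N c
    have h2 := MD.enorm_rpow_sum hp hblock (Finset.range N) c (hid N)
    simp only [hc, enorm_rootScalar 𝕜 hp, id_eq] at h1 h2
    rw [← h1, ← h2]
    refine le_trans (enorm_rpow_le_of_norm_le hp (by positivity) (K := 2 * K) ?_)
      (mul_le_mul_left le_self_add _)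
    have h3 := (hlower N c).trans (hΨ _)
    rw [← hdiff] at h3
    have h4 := (hequiv (Finset.range N) c id (hid N)).2
    simp only [id_eq] at h4
    have h5 := mul_le_mul_of_nonneg_left h4 hK.le
    simp only [hc] at h3 h5 ⊢
    linarith
  · set c : ℕ → 𝕜 := fun k => rootScalar 𝕜 p (t k) with hc
    have h1 := hnorm N c
    have h2 := MD.enorm_rpow_sum hp hblock (Finset.range N) c (hid N)
    simp only [hc, enorm_rootScalar 𝕜 hp, id_eq] at h1 h2
    rw [← h1, ← h2]
    refine le_trans (enorm_rpow_le_of_norm_le hp (by positivity) (K := 4 * ‖Ψ‖) ?_)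
      (mul_le_mul_left le_add_self _)
    have h4 := (hequiv (Finset.range N) c id (hid N)).1
    simp only [id_eq] at h4
    rw [hdiff] at h4
    have h5 := Ψ.le_opNorm (∑ k ∈ Finset.range N, c k • (MG.unit hp (i k) - MG.unit hp (j k)))
    have h6 := mul_le_mul_of_nonneg_left (hupper N c) (norm_nonneg Ψ)
    simp only [hc] at h4 h5 h6 ⊢
    linarith

end Embeddings

/-! ### Isomorphisms onto the image and lower bounds -/

section Isomorphisms

variable {𝕜 : Type*} [RCLike 𝕜] {E F : Type*}
  [NormedAddCommGroup E] [NormedSpace 𝕜 E] [NormedAddCommGroup F] [NormedSpace 𝕜 F]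

theorem IsIsomorphismOn.exists_norm_le {S : E →L[𝕜] F} {X : Submodule 𝕜 E}
    (h : IsIsomorphismOn S X) : ∃ K : ℝ, 0 ≤ K ∧ ∀ x ∈ X, ‖x‖ ≤ K * ‖S x‖ := by
  obtain ⟨e, he⟩ := h
  refine ⟨‖(e.symm : X.map (S : E →ₗ[𝕜] F) →L[𝕜] X)‖, norm_nonneg _, fun x hx => ?_⟩
  have := (e.symm : X.map (S : E →ₗ[𝕜] F) →L[𝕜] X).le_opNorm (e ⟨x, hx⟩)
  rw [ContinuousLinearEquiv.coe_coe, ContinuousLinearEquiv.symm_apply_apply] at this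
  rwa [Submodule.coe_norm, Submodule.coe_norm, he] at this

theorem isIsomorphismOn_of_norm_le {S : E →L[𝕜] F} {X : Submodule 𝕜 E} {K : ℝ}
    (h : ∀ x ∈ X, ‖x‖ ≤ K * ‖S x‖) : IsIsomorphismOn S X := by
  have hinj : Function.Injective ((S : E →ₗ[𝕜] F).domRestrict X) := by
    refine (injective_iff_map_eq_zero _).2 fun x hx => ?_
    have h1 := h x x.2
    have h2 : S x = 0 := hx
    rw [h2, norm_zero, mul_zero] at h1
    exact Subtype.ext (norm_le_zero_iff.1 h1)
  let e₀ : X ≃ₗ[𝕜] X.map (S : E →ₗ[𝕜] F) :=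
    LinearEquiv.ofBijective ((S : E →ₗ[𝕜] F).submoduleMap X)
      ⟨fun x y hxy => hinj (congrArg Subtype.val hxy), LinearMap.submoduleMap_surjective _ _⟩
  refine ⟨e₀.toContinuousLinearEquivOfBounds ‖S‖ K (fun x => S.le_opNorm x) fun y => ?_,
    fun x => rfl⟩
  have h1 := h (e₀.symm y) (e₀.symm y).2
  have h2 : S (e₀.symm y) = y := congrArg Subtype.val (e₀.apply_symm_apply y)
  rwa [h2] at h1

end Isomorphisms

/-! ### Strict inclusion, subspaces and factorization -/

section Main

variable (𝕜 : Type*) [RCLike 𝕜] (w : Weight) (p : ℝ) [hp : Fact (1 ≤ p)]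

theorem exponent_pos : 0 < p := by linarith [hp.out]

theorem isEmpty_garling_equiv (X : Submodule 𝕜 (LorentzSpace 𝕜 w p)) :
    IsEmpty (X ≃L[𝕜] GarlingSpace 𝕜 w p) := by
  refine ⟨fun e => ?_⟩
  refine not_embedding_garling_lorentz (garlingModel 𝕜 w p) (lorentzModel 𝕜 w p) (exponent_pos p)
    (X.subtypeL.comp (e.symm : GarlingSpace 𝕜 w p →L[𝕜] X))
    (K := ‖(e : X →L[𝕜] GarlingSpace 𝕜 w p)‖) fun y => ?_
  have := (e : X →L[𝕜] GarlingSpace 𝕜 w p).le_opNorm (e.symm y)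
  rwa [ContinuousLinearEquiv.coe_coe, e.apply_symm_apply] at this

/-- If `T ∘ I` is bounded below on `X`, so is `I`; composed with an isomorphism from the Lorentz
space onto `X`, it embeds the Lorentz space in the Garling space. -/
theorem not_isIsomorphismOn_comp_inclusion (T : GarlingSpace 𝕜 w p →L[𝕜] LorentzSpace 𝕜 w p)
    (X : Submodule 𝕜 (LorentzSpace 𝕜 w p)) (hX : Nonempty (X ≃L[𝕜] LorentzSpace 𝕜 w p)) :
    ¬ IsIsomorphismOn (T.comp (inclusionDG 𝕜 w p)) X := by
  intro h
  obtain ⟨e⟩ := hX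
  obtain ⟨K, hK, hbelow⟩ := h.exists_norm_le
  refine not_embedding_lorentz_garling (lorentzModel 𝕜 w p) (garlingModel 𝕜 w p) (exponent_pos p)
    ((inclusionDG 𝕜 w p).comp (X.subtypeL.comp (e.symm : LorentzSpace 𝕜 w p →L[𝕜] X)))
    (K := ‖(e : X →L[𝕜] LorentzSpace 𝕜 w p)‖ * (K * ‖T‖)) fun y => ?_
  have h1 := (e : X →L[𝕜] LorentzSpace 𝕜 w p).le_opNorm (e.symm y)
  rw [ContinuousLinearEquiv.coe_coe, e.apply_symm_apply] at h1
  have h2 := hbelow (e.symm y) (e.symm y).2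
  have h3 := T.le_opNorm (inclusionDG 𝕜 w p (e.symm y))
  have h4 := mul_le_mul_of_nonneg_left h3 hK
  have h5 := mul_le_mul_of_nonneg_left (h2.trans h4)
    (norm_nonneg (e : X →L[𝕜] LorentzSpace 𝕜 w p))
  calc ‖y‖ ≤ _ := h1
    _ ≤ _ := h5
    _ = _ := by
      simp only [ContinuousLinearMap.comp_apply, mul_assoc]
      rfl

/-- If the two spaces had the same elements, the open mapping theorem would make the inclusion an
isomorphism, and its inverse `T` would have `T ∘ I` equal to the identity on the Lorentz space. -/
theorem lorentz_lt_garling : lorentzSubmodule 𝕜 w p < garlingSubmodule 𝕜 w p := by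
  refine lt_of_le_of_ne (lorentzSubmodule_le_garlingSubmodule 𝕜 w p) fun h => ?_
  have := (garlingModel 𝕜 w p).completeSpace (exponent_pos p)
  have := (lorentzModel 𝕜 w p).completeSpace (exponent_pos p)
  have hinj : Function.Injective (inclusionDG 𝕜 w p) := fun x y hxy =>
    Subtype.ext (congrArg (fun z : GarlingSpace 𝕜 w p => z.1) hxy)
  have hsurj : Function.Surjective (inclusionDG 𝕜 w p) := fun y =>
    ⟨⟨y.1, h.ge y.2⟩, rfl⟩
  let e := ContinuousLinearEquiv.ofBijective (inclusionDG 𝕜 w p)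
    (LinearMap.ker_eq_bot.2 hinj) (LinearMap.range_eq_top.2 hsurj)
  refine not_isIsomorphismOn_comp_inclusion 𝕜 w p
    (e.symm : GarlingSpace 𝕜 w p →L[𝕜] LorentzSpace 𝕜 w p) ⊤
    ⟨(LinearIsometryEquiv.ofTop (LorentzSpace 𝕜 w p) ⊤ rfl).toContinuousLinearEquiv⟩ (isIsomorphismOn_of_norm_le (K := 1) fun x _ => ?_)
  have h1 : e.symm (inclusionDG 𝕜 w p x) = x := e.symm_apply_apply x
  rw [ContinuousLinearMap.comp_apply, ContinuousLinearEquiv.coe_coe, h1, one_mul]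

end Main

/-! ### Flat blocks -/

/-- The end points of successive intervals of lengths `1, 2, 3, …`. -/
def endpoint (n : ℕ) : ℕ := ∑ i ∈ Finset.range n, (i + 1)

theorem endpoint_succ (n : ℕ) : endpoint (n + 1) = endpoint n + (n + 1) := Finset.sum_range_succ _ _

/-- The normalized indicator functions of successive intervals of lengths `1, 2, 3, …`. -/
def flatBlock (w : Weight) (n : ℕ) : ℕ → ℝ≥0∞ :=
  (Finset.Ico (endpoint n) (endpoint (n + 1)) : Set ℕ).indicator fun _ => (w.partialSum (n + 1))⁻¹

theorem flatBlock_le (w : Weight) (n k : ℕ) : flatBlock w n k ≤ (w.partialSum (n + 1))⁻¹ :=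
  Set.indicator_apply_le fun _ => le_rfl

theorem isBlock_flatBlock (w : Weight) : IsBlock (flatBlock w) endpoint where
  mono := monotone_nat_of_le_succ fun n => by rw [endpoint_succ]; omega
  supp n k h := by
    have := Set.mem_of_indicator_ne_zero h
    rwa [Finset.coe_Ico, Set.mem_Ico] at this

theorem gauge_flatBlock (R : SelectionRule) (w : Weight) (n : ℕ) :
    R.gauge w (flatBlock w n) = 1 := by
  set F := Finset.Ico (endpoint n) (endpoint (n + 1)) with hF
  have hcard : F.card = n + 1 := by rw [hF, Nat.card_Ico, endpoint_succ]; omega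
  have h0 : w.partialSum (n + 1) ≠ 0 := (one_pos.trans_le (w.one_le_partialSum n.succ_ne_zero)).ne'
  have h1 : (w.partialSum (n + 1))⁻¹ * w.partialSum F.card = 1 := by
    rw [hcard, ENNReal.inv_mul_cancel h0 (w.partialSum_ne_top _)]
  refine le_antisymm ?_ ?_
  · exact (gauge_le_mul_partialSum F (flatBlock_le w n) fun k hk =>
      Set.indicator_of_notMem (fun h => hk (Finset.mem_coe.1 h)) _).trans h1.le
  · refine h1.ge.trans (mul_partialSum_le_gauge F fun k hk => ?_)
    have h2 : flatBlock w n k = (w.partialSum (n + 1))⁻¹ :=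
      Set.indicator_of_mem (Finset.mem_coe.2 hk) _
    exact h2.ge

/-- The heights tend to `0` because the weight is not summable, while every block has gauge `1`. -/
theorem not_noFlatPart_flatBlock (R : SelectionRule) (w : Weight) :
    ¬ NoFlatPart R w (flatBlock w) := by
  intro h
  obtain ⟨ε, hε, hsmall⟩ := h (1 / 2) (by simp)
  obtain ⟨n, hn⟩ := w.exists_partialSum_ge (x := ε⁻¹) (ENNReal.inv_ne_top.2 hε.ne')
  have h1 : smallPart ε (flatBlock w n) = flatBlock w n := funext fun k =>
    Set.indicator_of_mem (s := {k | flatBlock w n k ≤ ε}) ((flatBlock_le w n k).trans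
      (ENNReal.inv_le_iff_inv_le.1 (hn (n + 1) n.le_succ))) _
  have h2 := hsmall n
  rw [h1, gauge_flatBlock] at h2
  exact absurd h2 (not_le.2 (by simp))

theorem GaugeSpace.exists_modulus_eq {𝕜 : Type*} [RCLike 𝕜] {R : SelectionRule} {w : Weight}
    {p : ℝ} {E : Type*} [NormedAddCommGroup E] [NormedSpace 𝕜 E] (M : GaugeSpace 𝕜 R w p E)
    (hp : 0 < p) {a : ℕ → ℝ≥0∞} (ha : R.gauge w a ≠ ∞) : ∃ x, M.modulus x = a := by
  have h : (fun k => ‖rootScalar 𝕜 p (a k).toNNReal‖ₑ ^ p) = a := by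
    funext k
    rw [enorm_rootScalar 𝕜 hp, ENNReal.coe_toNNReal (ne_top_of_le_ne_top ha (le_gauge a k))]
  obtain ⟨x, hx⟩ := M.exists_val (fun k => rootScalar 𝕜 p (a k).toNNReal) (by rwa [h])
  refine ⟨x, ?_⟩
  rw [← h]
  unfold modulus
  rw [hx]

/-- The inclusion of a Lorentz space into the corresponding Garling space is an isomorphism on the
closed linear span of a sequence of flat blocks. -/
theorem not_isStrictlySingular_of_val_eq {𝕜 : Type*} [RCLike 𝕜] {w : Weight} {p : ℝ} {D G : Type*}
    [NormedAddCommGroup D] [NormedSpace 𝕜 D] [NormedAddCommGroup G] [NormedSpace 𝕜 G]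
    (MD : GaugeSpace 𝕜 injective w p D) (MG : GaugeSpace 𝕜 increasing w p G) (hp : 0 < p)
    (I : D →L[𝕜] G) (hI : ∀ x, MG.val (I x) = MD.val x) : ¬ IsStrictlySingular I := by
  have hex : ∀ n, ∃ x, MD.modulus x = flatBlock w n := fun n =>
    MD.exists_modulus_eq hp (by rw [gauge_flatBlock]; exact ENNReal.one_ne_top)
  choose f hf using hex
  have hIf : ∀ n, MG.modulus (I (f n)) = flatBlock w n := fun n => by
    rw [← hf n]
    unfold GaugeSpace.modulus
    rw [hI]
  have hbD : IsBlock (fun n => MD.modulus (f n)) endpoint := by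
    simp only [hf]
    exact isBlock_flatBlock w
  have hbG : IsBlock (fun n => MG.modulus (I (f n))) endpoint := by
    simp only [hIf]
    exact isBlock_flatBlock w
  have hnorm : ∀ n, ‖f n‖ₑ ^ p = 1 := fun n => by
    rw [MD.enorm_rpow_eq_gauge_modulus, hf, gauge_flatBlock]
  obtain ⟨η, hη, m, hm, hlow⟩ :=
    (isBlock_flatBlock w).exists_lower_estimate (not_noFlatPart_flatBlock increasing w)
  have hηtop : η ≠ ∞ := by
    have h1 := hlow (fun _ => 1) 1
    simp only [Finset.range_one, Finset.sum_singleton, ENNReal.coe_one, mul_one, one_mul] at h1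
    exact ne_top_of_le_ne_top ENNReal.one_ne_top (h1.trans (gauge_flatBlock _ w _).le)
  have hκ0 : 0 < (η ^ p⁻¹).toReal := ENNReal.toReal_pos
    (ENNReal.rpow_pos hη hηtop).ne' (ENNReal.rpow_ne_top_of_nonneg (inv_pos.2 hp).le hηtop)
  set κ := (η ^ p⁻¹).toReal with hκ
  have hκη : ENNReal.ofReal κ ^ p = η := by
    rw [hκ, ENNReal.ofReal_toReal (ENNReal.rpow_ne_top_of_nonneg (inv_pos.2 hp).le hηtop),
      ENNReal.rpow_inv_rpow hp.ne']
  have hcomb : ∀ (c : ℕ → 𝕜) (N : ℕ), κ * ‖∑ j ∈ Finset.range N, c j • f (m j)‖ ≤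
      ‖I (∑ j ∈ Finset.range N, c j • f (m j))‖ := by
    intro c N
    have h1 : η * ‖∑ j ∈ Finset.range N, c j • f (m j)‖ₑ ^ p ≤
        ‖I (∑ j ∈ Finset.range N, c j • f (m j))‖ₑ ^ p := by
      rw [map_sum]
      simp only [map_smul]
      rw [MD.enorm_rpow_sum hp hbD _ _ hm.injective.injOn,
        MG.enorm_rpow_sum hp hbG _ _ hm.injective.injOn]
      simp only [hf, hIf]
      -- The Lorentz side is at most `∑ |c j| ^ p` by subadditivity of the gauge, and the Garling
      -- side is at least `η` times that sum.
      refine le_trans (mul_le_mul_right ((gauge_sum_le _ _).trans (le_of_eq ?_)) _)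
        (le_of_le_of_eq (hlow (fun j => ‖c j‖₊ ^ p) N) ?_)
      · refine Finset.sum_congr rfl fun j _ => ?_
        rw [gauge_mul, gauge_flatBlock, mul_one, enorm_eq_nnnorm, ENNReal.coe_rpow_of_nonneg _ hp.le]
      · simp only [ENNReal.coe_rpow_of_nonneg _ hp.le, ← enorm_eq_nnnorm]
    rw [← hκη, ← ENNReal.mul_rpow_of_nonneg _ _ hp.le, ENNReal.rpow_le_rpow_iff hp, ← ofReal_norm,
      ← ofReal_norm, ← ENNReal.ofReal_mul hκ0.le, ENNReal.ofReal_le_ofReal_iff (norm_nonneg _)] at h1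
    exact h1
  set X₀ := Submodule.span 𝕜 (Set.range fun j => f (m j)) with hX₀
  have hspan : ∀ x ∈ X₀, κ * ‖x‖ ≤ ‖I x‖ := by
    intro x hx
    obtain ⟨c, rfl⟩ := Finsupp.mem_span_range_iff_exists_finsupp.1 hx
    obtain ⟨N, hN⟩ := c.support.bddAbove
    have h1 : (c.sum fun i a => a • f (m i)) = ∑ j ∈ Finset.range (N + 1), c j • f (m j) :=
      Finsupp.sum_of_support_subset _
        (fun i hi => Finset.mem_range.2 (Nat.lt_succ_of_le (hN hi))) _ (by simp)
    rw [h1]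
    exact hcomb c (N + 1)
  have hclosure : ∀ x ∈ X₀.topologicalClosure, κ * ‖x‖ ≤ ‖I x‖ := by
    have hclosed : IsClosed {x | κ * ‖x‖ ≤ ‖I x‖} :=
      isClosed_le (by fun_prop) (by fun_prop)
    exact fun x hx => closure_minimal (s := (X₀ : Set D)) hspan hclosed hx
  have hmem : ∀ j, f (m j) ∈ X₀.topologicalClosure := fun j =>
    X₀.le_topologicalClosure (Submodule.subset_span ⟨j, rfl⟩)
  intro hI
  refine hI X₀.topologicalClosure X₀.isClosed_topologicalClosure (fun hfin => ?_)
    (isIsomorphismOn_of_norm_le (K := κ⁻¹) fun x hx => ?_)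
  · have hli : LinearIndependent 𝕜 fun j => (⟨f (m j), hmem j⟩ : X₀.topologicalClosure) := by
      refine LinearIndependent.of_comp X₀.topologicalClosure.subtype
        (linearIndependent_iff'.2 fun s c hc i hi => ?_)
      have h1 := MD.coef_le_of_block hp hbD (δ := 1) (fun n => ?_) s c m hm.injective.injOn i hi
      · have h2 : ∑ i ∈ s, c i • f (m i) = 0 := hc
        rw [h2, norm_zero, mul_one] at h1
        exact norm_le_zero_iff.1 h1
      · have h2 := hnorm n
        rw [← ENNReal.one_rpow p] at h2
        rw [← toReal_enorm, ENNReal.rpow_left_injective hp.ne' h2, ENNReal.toReal_one]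
    exact not_finite_iff_infinite.2 (inferInstance : Infinite ℕ) hli.finite
  · rw [inv_mul_eq_div, le_div_iff₀' hκ0]
    exact hclosure x hx

theorem not_isStrictlySingular_inclusion (𝕜 : Type*) [RCLike 𝕜] (w : Weight) (p : ℝ)
    [hp : Fact (1 ≤ p)] : ¬ IsStrictlySingular (inclusionDG 𝕜 w p) :=
  not_isStrictlySingular_of_val_eq (lorentzModel 𝕜 w p) (garlingModel 𝕜 w p) (exponent_pos p) _
    fun _ => rfl

/-! ### Symmetric bases are uniformly symmetric -/

/-- A partial permutation whose domain and range have infinite complements can be extended. -/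
theorem exists_perm_comp_eq {ι : Type*} {S T : ι → ℕ} (hS : Function.Injective S)
    (hT : Function.Injective T) (hS' : (Set.range S)ᶜ.Infinite) (hT' : (Set.range T)ᶜ.Infinite) :
    ∃ π : Equiv.Perm ℕ, ∀ i, π (T i) = S i := by
  classical
  have := hS'.to_subtype
  have := hT'.to_subtype
  obtain ⟨f⟩ := nonempty_equiv_of_countable (α := ↑(Set.range T)ᶜ) (β := ↑(Set.range S)ᶜ)
  let e : Set.range T ≃ Set.range S :=
    (Equiv.ofInjective T hT).symm.trans (Equiv.ofInjective S hS)
  refine ⟨(Equiv.Set.sumCompl (Set.range T)).symm.trans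
    ((Equiv.sumCongr e f).trans (Equiv.Set.sumCompl (Set.range S))), fun i => ?_⟩
  rw [Equiv.trans_apply, Equiv.Set.sumCompl_symm_apply_of_mem (Set.mem_range_self i)]
  have h1 : (Equiv.ofInjective T hT).symm ⟨T i, Set.mem_range_self i⟩ = i :=
    Equiv.ofInjective_symm_apply hT i
  simp [e, h1]

section Schauder

variable {𝕜 : Type*} [RCLike 𝕜] {E : Type*} [NormedAddCommGroup E] [NormedSpace 𝕜 E]

/-- Failure of symmetry with constant `K`, rescaled: one arrangement has norm `1`, the other norm at
most `1 / K`. The bound `B` allows such examples to be placed in successive intervals. -/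
theorem exists_normalized_of_not_symmetricWith {x : ℕ → E} {K : ℝ} (hK : 0 < K)
    (h : ¬ SymmetricWith 𝕜 K x) : ∃ (N B : ℕ) (c : ℕ → 𝕜) (σ τ : ℕ → ℕ),
      Set.InjOn σ (Finset.range N) ∧ Set.InjOn τ (Finset.range N) ∧
      (∀ k < N, σ k < B ∧ τ k < B) ∧ ‖∑ k ∈ Finset.range N, c k • x (σ k)‖ = 1 ∧
      ‖∑ k ∈ Finset.range N, c k • x (τ k)‖ ≤ K⁻¹ := by
  unfold SymmetricWith at h
  push Not at h
  obtain ⟨N, c, σ, τ, hσ, hτ, h⟩ := h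
  set A := ‖∑ k ∈ Finset.range N, c k • x (σ k)‖ with hA
  have hA0 : 0 < A := lt_of_le_of_lt (by positivity) h
  have hscale : ∀ ρ : ℕ → ℕ, ‖∑ k ∈ Finset.range N, (((A⁻¹ : ℝ) : 𝕜) * c k) • x (ρ k)‖ =
      A⁻¹ * ‖∑ k ∈ Finset.range N, c k • x (ρ k)‖ := fun ρ => by
    simp only [mul_smul, ← Finset.smul_sum]
    rw [norm_smul, RCLike.norm_ofReal, abs_of_nonneg (inv_nonneg.2 hA0.le)]
  refine ⟨N, ∑ k ∈ Finset.range N, (σ k + τ k) + 1, fun k => ((A⁻¹ : ℝ) : 𝕜) * c k, σ, τ, hσ, hτ,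
    fun k hk => ?_, ?_, ?_⟩
  · have := Finset.single_le_sum (f := fun k => σ k + τ k) (fun _ _ => Nat.zero_le _)
      (Finset.mem_range.2 hk)
    omega
  · rw [hscale, ← hA, inv_mul_cancel₀ hA0.ne']
  · rw [hscale, inv_mul_le_iff₀ hA0, ← div_eq_mul_inv, le_div_iff₀ hK, mul_comm]
    exact h.le

/-- A tail of a symmetric basis is symmetric with some constant. -/
theorem IsSymmetricBasis.exists_symmetricWith [CompleteSpace E] {b : SchauderBasis 𝕜 E}
    (hb : IsSymmetricBasis b) : ∃ (M : ℕ) (K : ℝ), 0 < K ∧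
      SymmetricWith 𝕜 K fun n => b.basis (M + n) := by
  by_contra hcon
  push Not at hcon
  have hbad := fun (M j : ℕ) => exists_normalized_of_not_symmetricWith (K := 2 ^ j)
    (by positivity) (hcon M (2 ^ j) (by positivity))
  choose N B c σ τ hσ hτ hB hone hsmall using hbad
  -- The `j`-th bad example, with constant `2 ^ j`, is placed in `[m j, m (j + 1))`. The extra `1`
  -- leaves the index `m j + B` unused, so that the partial permutation sending `τ`-places to
  -- `σ`-places has infinite complements and extends.
  set m : ℕ → ℕ := fun j => Nat.rec 0 (fun j M => M + B M j + 1) j with hm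
  have hm1 : ∀ j, m (j + 1) = m j + B (m j) j + 1 := fun j => rfl
  have hmono : StrictMono m := strictMono_nat_of_lt_succ fun j => by rw [hm1]; omega
  have hblock : ∀ {i j k l : ℕ}, k < B (m i) i + 1 → l < B (m j) j + 1 → m i + k = m j + l →
      i = j := by
    intro i j k l hk hl h
    have h1 := hm1 i
    have h2 := hm1 j
    rcases lt_trichotomy i j with hij | hij | hij
    · have := hmono.monotone (Nat.succ_le_of_lt hij)
      simp only [Nat.succ_eq_add_one] at this
      omega
    · exact hij
    · have := hmono.monotone (Nat.succ_le_of_lt hij)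
      simp only [Nat.succ_eq_add_one] at this
      omega
  have hinj : ∀ ρ : ∀ M j : ℕ, ℕ → ℕ, (∀ j, Set.InjOn (ρ (m j) j) (Finset.range (N (m j) j))) →
      (∀ j, ∀ k < N (m j) j, ρ (m j) j k < B (m j) j) →
      Function.Injective (fun i : Σ j, Fin (N (m j) j) => m i.1 + ρ (m i.1) i.1 i.2) ∧
      (Set.range fun i : Σ j, Fin (N (m j) j) => m i.1 + ρ (m i.1) i.1 i.2)ᶜ.Infinite := by
    intro ρ hρ hρB
    constructor
    · rintro ⟨i, k⟩ ⟨j, l⟩ h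
      simp only at h
      obtain rfl : i = j := hblock ((hρB i k k.2).trans (Nat.lt_succ_self _))
        ((hρB j l l.2).trans (Nat.lt_succ_self _)) h
      have h1 := hρ i (by simp) (by simp) (Nat.add_left_cancel h)
      rw [Fin.ext h1]
    · have hinj' : Function.Injective fun j => m j + B (m j) j := fun i j h =>
        hblock (Nat.lt_succ_self _) (Nat.lt_succ_self _) h
      refine (Set.infinite_range_of_injective hinj').mono ?_
      rintro _ ⟨j, rfl⟩ ⟨⟨i, k⟩, h⟩
      simp only at h
      obtain rfl : i = j := hblock ((hρB i k k.2).trans (Nat.lt_succ_self _))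
        (Nat.lt_succ_self _) h
      have := hρB i k k.2
      omega
  obtain ⟨hS, hS'⟩ := hinj σ (fun j => hσ _ _) fun j k hk => (hB _ _ k hk).1
  obtain ⟨hT, hT'⟩ := hinj τ (fun j => hτ _ _) fun j k hk => (hB _ _ k hk).2
  obtain ⟨π, hπ⟩ := exists_perm_comp_eq hS hT hS' hT'
  have hπ' : ∀ j, ∀ k < N (m j) j, π (m j + τ (m j) j k) = m j + σ (m j) j k :=
    fun j k hk => hπ ⟨j, ⟨k, hk⟩⟩
  set y : ℕ → E := fun j => ∑ k ∈ Finset.range (N (m j) j),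
    c (m j) j k • b.basis (m j + τ (m j) j k) with hy
  have hysum : Summable y := by
    refine Summable.of_norm_bounded summable_geometric_two fun j => ?_
    rw [one_div, inv_pow]
    exact hsmall (m j) j
  have hcoordy : ∀ n j, b.coord n (y j) = ∑ k ∈ Finset.range (N (m j) j),
      if n = m j + τ (m j) j k then c (m j) j k else 0 := by
    intro n j
    rw [hy]
    simp only [map_sum, map_smul, b.ortho, smul_eq_mul, Pi.single_apply, mul_ite, mul_one, mul_zero]
  have hcoord : ∀ j, ∀ n ∈ Finset.Ico (m j) (m (j + 1)), b.coord n (∑' i, y i) =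
      ∑ k ∈ Finset.range (N (m j) j), if n = m j + τ (m j) j k then c (m j) j k else 0 := by
    intro j n hn
    rw [Finset.mem_Ico, hm1] at hn
    rw [(b.coord n).map_tsum hysum, tsum_eq_single j fun i hij => ?_, hcoordy]
    rw [hcoordy]
    refine Finset.sum_eq_zero fun k hk => if_neg fun h => hij ?_
    refine hblock (k := τ (m i) i k) (l := n - m j)
      ((hB _ _ k (Finset.mem_range.1 hk)).2.trans (Nat.lt_succ_self _)) (by omega) (by omega)
  -- The small arrangements have a convergent sum, and symmetry makes its permuted expansion
  -- converge too; but over each interval the permuted terms sum to a vector of norm `1`.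
  obtain ⟨l, hl⟩ := (hb π fun n => b.coord n (∑' i, y i)).2 ⟨∑' i, y i, by
    simpa using! b.tendsto_proj (∑' i, y i)⟩
  have hdiff : ∀ j, ‖∑ n ∈ Finset.range (m (j + 1)), b.coord n (∑' i, y i) • b.basis (π n) -
      ∑ n ∈ Finset.range (m j), b.coord n (∑' i, y i) • b.basis (π n)‖ = 1 := by
    intro j
    rw [← Finset.sum_Ico_eq_sub _ (hmono.monotone j.le_succ), ← hone (m j) j]
    congr 1
    rw [Finset.sum_congr rfl fun n hn => by rw [hcoord j n hn, Finset.sum_smul], Finset.sum_comm]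
    refine Finset.sum_congr rfl fun k hk => ?_
    have hk' := Finset.mem_range.1 hk
    rw [← hπ' j k hk', Finset.sum_eq_single_of_mem (m j + τ (m j) j k)]
    · rw [if_pos rfl]
    · have := (hB (m j) j k hk').2
      rw [Finset.mem_Ico, hm1]
      omega
    · intro n _ hne
      rw [if_neg hne, zero_smul]
  obtain ⟨n₀, hn₀⟩ := Metric.cauchySeq_iff.1 hl.cauchySeq 1 one_pos
  have h1 := hn₀ (m (n₀ + 1)) (n₀.le_succ.trans (hmono.id_le _)) (m n₀) (hmono.id_le _)
  rw [dist_eq_norm, hdiff] at h1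
  exact lt_irrefl _ h1

end Schauder

/-! ### Garling spaces have no symmetric basis -/

theorem sum_Ico_eq_sum_range_ite {α : Type*} [AddCommMonoid α] (f : ℕ → α) {M A : ℕ} (h : M ≤ A)
    (B : ℕ) : ∑ k ∈ Finset.Ico A B, f k =
      ∑ k ∈ Finset.range (B - M), if A ≤ M + k then f (M + k) else 0 := by
  rw [← Finset.sum_Ico_eq_sum_range (fun k => if A ≤ k then f k else 0), ← Finset.sum_filter]
  refine Finset.sum_congr (Finset.ext fun k => ?_) fun _ _ => rfl
  simp only [Finset.mem_Ico, Finset.mem_filter]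
  omega

theorem sum_range_sum_Ico {α : Type*} [AddCommMonoid α] (f : ℕ → α) {s : ℕ → ℕ} (hs : Monotone s)
    (n : ℕ) : ∑ j ∈ Finset.range n, ∑ k ∈ Finset.Ico (s j) (s (j + 1)), f k =
      ∑ k ∈ Finset.Ico (s 0) (s n), f k := by
  induction n with
  | zero => simp
  | succ n ih =>
    rw [Finset.sum_range_succ, ih, Finset.sum_Ico_consecutive _ (hs n.zero_le) (hs n.le_succ)]

namespace GaugeSpace

variable {𝕜 : Type*} [RCLike 𝕜] {R : SelectionRule} {w : Weight} {p : ℝ} {E : Type*}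
  [NormedAddCommGroup E] [NormedSpace 𝕜 E]

/-- No tail of a Schauder basis of a gauge space is equivalent to the unit vector basis of `ℓ_p`. -/
theorem not_basis_estimates [Successive R] (G : GaugeSpace 𝕜 R w p E) (hp : 0 < p)
    (b : SchauderBasis 𝕜 E) {M : ℕ} {η L : ℝ≥0∞} (hη : 0 < η) (hL : L ≠ ∞)
    (hlow : ∀ (A B : ℕ) (c : ℕ → 𝕜), M ≤ A → η * ∑ k ∈ Finset.Ico A B, ‖c k‖ₑ ^ p ≤
      ‖∑ k ∈ Finset.Ico A B, c k • b.basis k‖ₑ ^ p)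
    (hup : ∀ (A B : ℕ) (c : ℕ → 𝕜), M ≤ A → ‖∑ k ∈ Finset.Ico A B, c k • b.basis k‖ₑ ^ p ≤
      L * ∑ k ∈ Finset.Ico A B, ‖c k‖ₑ ^ p) : False := by
  obtain ⟨i, l, s, hil, hs, hs0, hest⟩ := exists_block_differences b (x := G.unit hp) (C := 1)
    (fun n => (G.norm_unit hp n).le) (θ := fun n => 1 / 4 * (1 / 2) ^ n) (fun n => by positivity) M
  obtain ⟨hi, hl⟩ := interleaved_strictMono hil
  set d : ℕ → E := fun j => G.unit hp (i j) - G.unit hp (l j) with hd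
  set v : ℕ → E := fun j => b.proj (s (j + 1)) (d j) - b.proj (s j) (d j) with hv
  have hest' : ∀ j, ‖d j - v j‖ ≤ 1 / 4 * (1 / 2) ^ j := hest
  have hMs : ∀ j, M ≤ s j := fun j => hs0 ▸ hs j.zero_le
  have hv' : ∀ j, v j = ∑ k ∈ Finset.Ico (s j) (s (j + 1)), b.coord k (d j) • b.basis k := by
    intro j
    rw [Finset.sum_Ico_eq_sub _ (hs j.le_succ), hv]
    simp only [SchauderBasis.proj_apply]
  have hvlow : ∀ j, 1 / 2 ≤ ‖v j‖ := fun j => by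
    have h1 : 1 ≤ ‖d j‖ := G.one_le_norm_unit_sub hp (hil j).1.ne
    have h2 := norm_sub_norm_le (d j) (v j)
    have h3 := hest' j
    have h4 : (1 / 2 : ℝ) ^ j ≤ 1 := pow_le_one₀ (by norm_num) (by norm_num)
    linarith
  have hcoordv : ∀ j k, b.coord k (v j) =
      if k ∈ Finset.Ico (s j) (s (j + 1)) then b.coord k (d j) else 0 := by
    intro j k
    rw [hv']
    simp only [map_sum, map_smul, b.ortho, smul_eq_mul, Pi.single_apply, mul_ite, mul_one, mul_zero]
    simp only [eq_comm (a := k), Finset.sum_ite_eq']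
  have hcoord : ∀ n, ∀ j < n, ∀ k ∈ Finset.Ico (s j) (s (j + 1)),
      b.coord k (∑ j ∈ Finset.range n, v j) = b.coord k (d j) := by
    intro n j hj k hk
    rw [map_sum, Finset.sum_eq_single_of_mem j (Finset.mem_range.2 hj) fun j' _ hne => ?_, hcoordv,
      if_pos hk]
    rw [hcoordv, if_neg fun hk' => hne ?_]
    rw [Finset.mem_Ico] at hk hk'
    rcases lt_trichotomy j' j with h | h | h
    · have := hs (Nat.succ_le_of_lt h)
      simp only [Nat.succ_eq_add_one] at this
      omega
    · exact h
    · have := hs (Nat.succ_le_of_lt h)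
      simp only [Nat.succ_eq_add_one] at this
      omega
  refine not_lower_estimate_partialSum w (η := η * ENNReal.ofReal (1 / 2) ^ p)
    (L := L * ENNReal.ofReal 3 ^ p)
    (ENNReal.mul_pos hη.ne' (ENNReal.rpow_pos (by simp) ENNReal.ofReal_ne_top).ne')
    (ENNReal.mul_ne_top hL (ofReal_rpow_ne_top hp 3)) fun n hn => ?_
  -- The vector `z` is a sum of `n` blocks of `b` of norm at least `1 / 2`, so the estimates force
  -- `‖z‖ ^ p` to be at least a multiple of `n`. It is also close to a difference of two sums of `n`
  -- unit vectors, so `‖z‖ ^ p` is at most a multiple of `w.partialSum n`.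
  set z := ∑ j ∈ Finset.range n, v j with hz
  have hzsum : z = ∑ k ∈ Finset.Ico M (s n), b.coord k z • b.basis k := by
    rw [← hs0, ← sum_range_sum_Ico _ hs]
    nth_rewrite 1 [hz]
    refine Finset.sum_congr rfl fun j hj => ?_
    rw [hv']
    exact Finset.sum_congr rfl fun k hk => by rw [hcoord n j (Finset.mem_range.1 hj) k hk]
  have h1 : n * ENNReal.ofReal (1 / 2) ^ p ≤ L * ∑ k ∈ Finset.Ico M (s n), ‖b.coord k z‖ₑ ^ p := by
    rw [← hs0, ← sum_range_sum_Ico _ hs, Finset.mul_sum]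
    calc (n : ℝ≥0∞) * ENNReal.ofReal (1 / 2) ^ p
        = ∑ j ∈ Finset.range n, ENNReal.ofReal (1 / 2) ^ p := by simp
      _ ≤ _ := Finset.sum_le_sum fun j hj => ?_
    calc ENNReal.ofReal (1 / 2) ^ p ≤ ‖v j‖ₑ ^ p := by
          rw [← ofReal_norm]
          exact ENNReal.rpow_le_rpow (ENNReal.ofReal_le_ofReal (hvlow j)) hp.le
      _ ≤ L * ∑ k ∈ Finset.Ico (s j) (s (j + 1)), ‖b.coord k (d j)‖ₑ ^ p := by
          rw [hv']
          exact hup _ _ (fun k => b.coord k (d j)) (hMs j)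
      _ = _ := by
          congr 1
          exact Finset.sum_congr rfl fun k hk => by rw [hcoord n j (Finset.mem_range.1 hj) k hk]
  have h2 : η * ∑ k ∈ Finset.Ico M (s n), ‖b.coord k z‖ₑ ^ p ≤ ‖z‖ₑ ^ p := by
    refine (hlow M (s n) (fun k => b.coord k z) le_rfl).trans (le_of_eq ?_)
    rw [← hzsum]
  set u := ∑ j ∈ Finset.range n, G.unit hp j with hu
  have hupow : ‖u‖ₑ ^ p = w.partialSum n := G.enorm_rpow_sum_range_unit hp n Function.injective_id
  have hnormu : ∀ {f : ℕ → ℕ}, Function.Injective f →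
      ‖∑ j ∈ Finset.range n, G.unit hp (f j)‖ = ‖u‖ := by
    intro f hf
    have h := (G.enorm_rpow_sum_range_unit hp n hf).trans hupow.symm
    rw [← toReal_enorm, ← toReal_enorm, ENNReal.rpow_left_injective hp.ne' h]
  have hu1 : 1 ≤ ‖u‖ := by
    have h := w.one_le_partialSum hn.ne'
    rw [← hupow, ← ENNReal.one_rpow p, ENNReal.rpow_le_rpow_iff hp, ← ofReal_norm,
      ENNReal.one_le_ofReal] at h
    exact h
  have hzu : ‖z‖ ≤ 3 * ‖u‖ := by
    have e1 : z = ∑ j ∈ Finset.range n, G.unit hp (i j) - ∑ j ∈ Finset.range n, G.unit hp (l j) -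
        ∑ j ∈ Finset.range n, (d j - v j) := by
      rw [Finset.sum_sub_distrib, hd, Finset.sum_sub_distrib, hz]
      abel
    have e2 : ‖∑ j ∈ Finset.range n, (d j - v j)‖ ≤ 2 * (1 / 4) :=
      (norm_sum_le _ _).trans ((Finset.sum_le_sum fun j _ => hest' j).trans
        (sum_geometric_image_le (σ := id) Function.injective_id.injOn (by norm_num)))
    have e3 := norm_sub_le (∑ j ∈ Finset.range n, G.unit hp (i j) -
      ∑ j ∈ Finset.range n, G.unit hp (l j)) (∑ j ∈ Finset.range n, (d j - v j))
    have e4 := norm_sub_le (∑ j ∈ Finset.range n, G.unit hp (i j))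
      (∑ j ∈ Finset.range n, G.unit hp (l j))
    rw [hnormu hi.injective, hnormu hl.injective] at e4
    rw [← e1] at e3
    linarith
  have h3 := enorm_rpow_le_of_norm_le hp (by norm_num) hzu
  rw [hupow] at h3
  calc η * ENNReal.ofReal (1 / 2) ^ p * n = η * (n * ENNReal.ofReal (1 / 2) ^ p) := by ring
    _ ≤ η * (L * ∑ k ∈ Finset.Ico M (s n), ‖b.coord k z‖ₑ ^ p) := mul_le_mul_right h1 _
    _ = L * (η * ∑ k ∈ Finset.Ico M (s n), ‖b.coord k z‖ₑ ^ p) := by ring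
    _ ≤ L * (ENNReal.ofReal 3 ^ p * w.partialSum n) := mul_le_mul_right (h2.trans h3) _
    _ = _ := by ring

/-- A tail of the basis is uniformly symmetric, bounded and separated, hence has the `ℓ_p` estimates
of `SymmetricWith.estimates`, which `not_basis_estimates` excludes. -/
theorem not_isSymmetricBasis (G : GaugeSpace 𝕜 increasing w p E) (hp : 0 < p)
    (b : SchauderBasis 𝕜 E) : ¬ IsSymmetricBasis b := by
  intro hb
  have := G.completeSpace hp
  obtain ⟨M, K, hK, hsym⟩ := hb.exists_symmetricWith
  obtain ⟨B₀, hB₀⟩ := b.exists_norm_proj_le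
  obtain ⟨B, hB, hproj⟩ : ∃ B : ℝ, 0 < B ∧ ∀ n x, ‖b.proj n x‖ ≤ B * ‖x‖ :=
    ⟨max B₀ 1, by positivity, fun n x => (b.proj n).le_of_opNorm_le
      ((hB₀ n).trans (le_max_left _ _)) x⟩
  have hsingle : ∀ m n, ‖b.basis (M + m)‖ ≤ K * ‖b.basis (M + n)‖ := fun m n => by
    simpa using hsym 1 (fun _ => 1) (fun _ => m) (fun _ => n) (by simp) (by simp)
  have hpos : 0 < ‖b.basis (M + 0)‖ := norm_pos_iff.2 (b.linearIndependent.ne_zero _)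
  have hlt : ∀ m n, m < n →
      ‖b.basis (M + 0)‖ / (K * B) ≤ ‖b.basis (M + m) - b.basis (M + n)‖ := by
    intro m n hmn
    have h1 := hproj (M + n) (b.basis (M + m) - b.basis (M + n))
    have h2 : b.proj (M + n) (b.basis (M + m) - b.basis (M + n)) = b.basis (M + m) := by
      have e1 := b.proj_apply_basis_mem (M + n) (M + m)
      have e2 := b.proj_apply_basis_mem (M + n) (M + n)
      rw [if_pos (by omega)] at e1
      rw [if_neg (by omega)] at e2
      rw [map_sub]
      exact (congrArg₂ _ e1 e2).trans (sub_zero _)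
    rw [h2] at h1
    rw [div_le_iff₀ (by positivity)]
    have h3 := mul_le_mul_of_nonneg_left h1 hK.le
    linarith [hsingle 0 m]
  obtain ⟨η, L, hη, hL, hlow, hdiff⟩ := hsym.estimates G hp hK.le
    (C := K * ‖b.basis (M + 0)‖) (fun n => hsingle n 0)
    (δ := ‖b.basis (M + 0)‖ / (K * B)) (by positivity) fun m n hmn => by
      rcases lt_or_gt_of_ne hmn with h | h
      · exact hlt m n h
      · rw [norm_sub_rev]
        exact hlt n m h
  have hup : ∀ (N : ℕ) (c : ℕ → 𝕜), ‖∑ k ∈ Finset.range N, c k • b.basis (M + k)‖ₑ ^ p ≤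
      ENNReal.ofReal B ^ p * L * ∑ k ∈ Finset.range N, ‖c k‖ₑ ^ p := by
    intro N c
    -- The upper estimate is known only for differences; the projection onto the first `M + N` basis
    -- vectors keeps the first half of each difference and kills the second.
    have h1 := hproj (M + N) (∑ k ∈ Finset.range N, c k • (b.basis (M + k) - b.basis (M + (N + k))))
    have h2 : b.proj (M + N)
        (∑ k ∈ Finset.range N, c k • (b.basis (M + k) - b.basis (M + (N + k)))) =
        ∑ k ∈ Finset.range N, c k • b.basis (M + k) := by
      rw [map_sum]
      refine Finset.sum_congr rfl fun k hk => ?_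
      rw [Finset.mem_range] at hk
      have e1 := b.proj_apply_basis_mem (M + N) (M + k)
      have e2 := b.proj_apply_basis_mem (M + N) (M + (N + k))
      rw [if_pos (by omega)] at e1
      rw [if_neg (by omega)] at e2
      rw [map_smul, map_sub]
      exact congrArg _ ((congrArg₂ _ e1 e2).trans (sub_zero _))
    rw [h2] at h1
    refine (enorm_rpow_le_of_norm_le hp hB.le h1).trans ?_
    rw [mul_assoc]
    exact mul_le_mul_right (hdiff N c) _
  have hite : ∀ (A k : ℕ) (c : ℕ → 𝕜), ‖if A ≤ M + k then c (M + k) else 0‖ₑ ^ p =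
      if A ≤ M + k then ‖c (M + k)‖ₑ ^ p else 0 := fun A k c => by
    split_ifs
    · rfl
    · simp [hp]
  refine G.not_basis_estimates hp b (M := M) hη
    (ENNReal.mul_ne_top (ofReal_rpow_ne_top hp B) hL) (fun A A' c hA => ?_) fun A A' c hA => ?_
  · rw [sum_Ico_eq_sum_range_ite _ hA, sum_Ico_eq_sum_range_ite _ hA]
    have h := hlow (A' - M) fun k => if A ≤ M + k then c (M + k) else 0
    simpa only [hite, ite_smul, zero_smul] using h
  · rw [sum_Ico_eq_sum_range_ite _ hA, sum_Ico_eq_sum_range_ite _ hA]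
    have h := hup (A' - M) fun k => if A ≤ M + k then c (M + k) else 0
    simpa only [hite, ite_smul, zero_smul] using h

end GaugeSpace

end SeqSpace

end

theorem theorem3p2 {𝕜 : Type*} [RCLike 𝕜] (w : SeqSpace.Weight) (p : ℝ) [Fact (1 ≤ p)] :
    -- (i) there is no symmetric basis for `g(w, p)`
    (¬ ∃ b : SchauderBasis 𝕜 (SeqSpace.GarlingSpace 𝕜 w p), SeqSpace.IsSymmetricBasis b) ∧
    -- (ii) `d(w, p)` is properly contained in `g(w, p)`, as sets of sequences
    SeqSpace.lorentzSubmodule 𝕜 w p < SeqSpace.garlingSubmodule 𝕜 w p ∧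
    -- (iii) no subspace of `d(w, p)` is isomorphic to `g(w, p)`
    (∀ X : Submodule 𝕜 (SeqSpace.LorentzSpace 𝕜 w p),
      IsEmpty (X ≃L[𝕜] SeqSpace.GarlingSpace 𝕜 w p)) ∧
    -- (iv) the inclusion is not strictly singular, but `T ∘ I` does not preserve a copy of `d(w, p)`
    (¬ SeqSpace.IsStrictlySingular (SeqSpace.inclusionDG 𝕜 w p) ∧
      ∀ (T : SeqSpace.GarlingSpace 𝕜 w p →L[𝕜] SeqSpace.LorentzSpace 𝕜 w p)
        (X : Submodule 𝕜 (SeqSpace.LorentzSpace 𝕜 w p)),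
        Nonempty (X ≃L[𝕜] SeqSpace.LorentzSpace 𝕜 w p) →
          ¬ SeqSpace.IsIsomorphismOn (T.comp (SeqSpace.inclusionDG 𝕜 w p)) X) := by
  refine ⟨fun ⟨b, hb⟩ => ?_, SeqSpace.lorentz_lt_garling 𝕜 w p, SeqSpace.isEmpty_garling_equiv 𝕜 w p,
    SeqSpace.not_isStrictlySingular_inclusion 𝕜 w p,
    SeqSpace.not_isIsomorphismOn_comp_inclusion 𝕜 w p⟩
  exact (SeqSpace.garlingModel 𝕜 w p).not_isSymmetricBasis (SeqSpace.exponent_pos p) b hb
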